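/- Let $\alpha>1/2$, $\beta\in(0,1]$, $\gamma>0$, $\mu>0$. Let $\xi(x)$, $x\in\mathbb R$, be a measurable zero-mean Gaussian random process on a probability space $(\Omega,\mathcal F,P)$ with covariance $\mathrm{Cov}(\xi(x),\xi(y))=r(x-y)$, where $$r(x)=\sum_{j=0}^{n}A_j\frac{\cos(w_jx)}{(1+x^2)^{\kappa_j/2}},\qquad \sum_{j=0}^nA_j=1,\quad w_0=0,\quad w_j>0,\ \kappa_j\in(0,1)\ (j=1,\dots,n),$$ and $A_0=0$ (the $A_j$ are real). Let $u(t,x)$, $t\ge 0$, $x\in\mathbb R$, be a mean-square solution of the fractional Riesz–Bessel equation $$\frac{\partial^\beta u(t,x)}{\partial t^\beta}=-\mu\,(I-\Delta)^{\gamma/2}(-\Delta)^{\alpha/2}u(t,x),\quad t>0,\qquad u(0,x)=\xi(x).$$ Here $\partial^\beta/\partial t^\beta$ is the ordinary derivative if $\beta=1$, and if $\beta<1$ it is the regularized (Caputo–Djrbashian) derivative $\frac1{\Gamma(1-\beta)}\big[\frac{d}{dt}\int_0^t(t-\tau)^{-\beta}v(\tau)\,d\tau-t^{-\beta}v(0)\big]$;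 the operator $(I-\Delta)^{\gamma/2}(-\Delta)^{\alpha/2}$ has Fourier symbol $|\lambda|^\alpha(1+\lambda^2)^{\gamma/2}$. Mean-square solution means: $u$ is continuous as a map $[0,\infty)\times\mathbb R\to L^2(\Omega)$ and bounded in $L^2(\Omega)$ on $[0,T]\times\mathbb R$ for every $T$, $u(0,x)=\xi(x)$ a.s. for every $x$, and for all real $\varphi,\psi\in L^1(\mathbb R)$ with $\widehat\psi(\lambda)=|\lambda|^\alpha(1+\lambda^2)^{\gamma/2}\widehat\varphi(\lambda)$ and all $t>0$ one has $\frac{\partial^\beta}{\partial t^\beta}\int\varphi(x)u(t,x)\,dx=-\mu\int\psi(x)u(t,x)\,dx$ in $L^2(\Omega)$. Let $E_\beta(s)=\sum_{k\ge0}s^k/\Gamma(1+\beta k)$, $K_\nu(z)=\frac12\int_0^\infty s^{\nu-1}e^{-\frac12(s+1/s)z}\,ds$, $c_1(\kappa)=2^{(1-\kappa)/2}/(\sqrt\pi\,\Gamma(\kappa/2))$, and $$f(0)=\sum_{j=1}^nc_1(\kappa_j)A_jK_{\frac{\kappa_j-1}2}(|w_j|)\,|w_j|^{\frac{\kappa_j-1}2}$$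 (the value at $0$ of the spectral density of $\xi$). Let $W$ be a symmetric complex Gaussian white noise on $\mathbb R$, that is, a centred Gaussian random measure with $\mathbb E|W(d\lambda)|^2=d\lambda$ and $W(-B)=\overline{W(B)}$. Then $f(0)\ge0$, and as $\varepsilon\downarrow0$ the finite-dimensional distributions of the random fields $$U_\varepsilon(t,x)=\varepsilon^{-\beta/(2\alpha)}\,u\!\left(\frac t\varepsilon,\frac x{\varepsilon^{\beta/\alpha}}\right),\qquad t>0,\ x\in\mathbb R,$$ converge weakly to the finite-dimensional distributions of the real-valued zero-mean Gaussian random field $$U_0(t,x)=\sqrt{f(0)}\int_{\mathbb R}e^{i\lambda x}E_\beta(-\mu t^\beta|\lambda|^\alpha)\,W(d\lambda),\qquad t>0,\ x\in\mathbb R,$$ where the integrand is square-integrable, and for all $t,t'>0$ and $x,x'\in\mathbb R$ $$\mathrm{Cov}(U_0(t,x),U_0(t',x'))=\sum_{j=1}^n2c_1(\kappa_j)A_jK_{\frac{\kappa_j-1}2}(|w_j|)\,|w_j|^{\frac{\kappa_j-1}2}\int_0^\infty\cos(\lambda(x-x'))\,E_\beta(-\mu t^\beta|\lambda|^\alpha)\,E_\beta(-\mu(t')^\beta|\lambda|^\alpha)\,d\lambda,$$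 the integral being absolutely convergent. -/

import Mathlib

open MeasureTheory ProbabilityTheory Filter Topology
open scoped FourierTransform

namespace FRBE

noncomputable section

/-- The Mittag-Leffler function `E_β(s) = ∑ₖ sᵏ / Γ(1 + β k)`. -/
def mittagLeffler (β s : ℝ) : ℝ :=
  ∑' k : ℕ, s ^ k / Real.Gamma (1 + β * k)

/-- The modified Bessel function of the second kind,
`K_ν(z) = (1/2) ∫₀^∞ s^(ν-1) exp(-(s + 1/s) z / 2) ds`. -/
def besselK (ν z : ℝ) : ℝ :=
  (1 / 2) * ∫ s in Set.Ioi (0 : ℝ), s ^ (ν - 1) * Real.exp (-(1 / 2) * (s + 1 / s) * z)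

/-- The constant `c₁(κ) = 2^((1-κ)/2) / (√π Γ(κ/2))` (for the components with index `j ≠ 0`). -/
def c₁ (κ : ℝ) : ℝ :=
  2 ^ ((1 - κ) / 2) / (√Real.pi * Real.Gamma (κ / 2))

/-- `r(x) = ∑_{j=0}^n A_j cos(w_j x) (1 + x²)^(-κ_j/2)`. -/
def initialCov (n : ℕ) (A w κ : ℕ → ℝ) (x : ℝ) : ℝ :=
  ∑ j ∈ Finset.range (n + 1), A j * (Real.cos (w j * x) / (1 + x ^ 2) ^ (κ j / 2))

/-- Conditions on the parameters of the covariance function `initialCov`. -/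
structure CyclicParams (n : ℕ) (A w κ : ℕ → ℝ) : Prop where
  sum_A : ∑ j ∈ Finset.range (n + 1), A j = 1
  w_zero : w 0 = 0
  w_pos : ∀ j, 1 ≤ j → j ≤ n → 0 < w j
  κ_mem : ∀ j, 1 ≤ j → j ≤ n → κ j ∈ Set.Ioo (0 : ℝ) 1

/-- The value at zero of the spectral density when `A₀ = 0`:
`f(0) = ∑_{j=1}^n c₁(κ_j) A_j K_{(κ_j-1)/2}(|w_j|) |w_j|^((κ_j-1)/2)`. -/
def specDensZero (n : ℕ) (A w κ : ℕ → ℝ) : ℝ :=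
  ∑ j ∈ Finset.Icc 1 n,
    c₁ (κ j) * A j * besselK ((κ j - 1) / 2) |w j| * |w j| ^ ((κ j - 1) / 2)

/-- The function `v : [0, ∞) → E` with values in a Banach space has at time `t` the derivative `d`
of order `β ∈ (0, 1]`: the ordinary derivative if `β = 1`, and the regularized
(Caputo–Djrbashian) fractional derivative
`Γ(1-β)⁻¹ (d/dt ∫₀ᵗ (t-τ)^(-β) v(τ) dτ - t^(-β) v(0))` if `β < 1`. -/
def HasTimeDerivAt {E : Type*} [NormedAddCommGroup E] [NormedSpace ℝ E]
    (β : ℝ) (v : ℝ → E) (d : E) (t : ℝ) : Prop :=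
  (β = 1 ∧ HasDerivAt v d t) ∨
  (β < 1 ∧ ∃ D : E,
    HasDerivAt (fun s : ℝ => ∫ τ in (0 : ℝ)..s, ((s - τ) ^ (-β)) • v τ) D t ∧
    d = (Real.Gamma (1 - β))⁻¹ • (D - (t ^ (-β)) • v 0))

/-- `ψ = (I - Δ)^(γ/2) (-Δ)^(α/2) φ` in `L¹(ℝ)`: both functions are integrable and, in the angular
frequency `l = 2πk`, the Fourier transform of `ψ` is `|l|^α (1 + l²)^(γ/2)` times that of `φ`, so
that `φ` is the composition of the Riesz and Bessel potentials applied to `ψ`. -/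
def IsRieszBessel (α γ : ℝ) (φ ψ : ℝ → ℝ) : Prop :=
  Integrable φ ∧ Integrable ψ ∧
    ∀ k : ℝ, 𝓕 (fun x => (ψ x : ℂ)) k =
      ((|2 * Real.pi * k| ^ α * (1 + |2 * Real.pi * k| ^ 2) ^ (γ / 2) : ℝ) : ℂ) *
        𝓕 (fun x => (φ x : ℂ)) k

/-- `u(t, x)`, `t ≥ 0`, is a mean-square solution of
`∂^β u / ∂t^β = -μ (I - Δ)^(γ/2) (-Δ)^(α/2) u`, `t > 0`, with `u(0, x) = ξ(x)`.
The field is regarded as an `L²(Ω)`-valued function `v`, continuous on `[0, ∞) × ℝ` and bounded on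
`[0, T] × ℝ` for every `T`; the time derivative and all integrals are taken in `L²(Ω)`, and the
(self-adjoint) spatial operator acts on the bounded field `v(t, ·)` by duality with `L¹(ℝ)`. -/
def IsMeanSquareSolution {Ω : Type*} [MeasurableSpace Ω] (P : Measure Ω)
    (α β γ μ : ℝ) (ξ : ℝ → Ω → ℝ) (u : ℝ → ℝ → Ω → ℝ) : Prop :=
  ∃ v : ℝ → ℝ → Lp ℝ 2 P,
    (∀ t, 0 ≤ t → ∀ x, u t x =ᵐ[P] v t x) ∧
    ContinuousOn (fun p : ℝ × ℝ => v p.1 p.2) (Set.Ici 0 ×ˢ Set.univ) ∧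
    (∀ T : ℝ, ∃ C : ℝ, ∀ t ∈ Set.Icc 0 T, ∀ x, ‖v t x‖ ≤ C) ∧
    (∀ x, u 0 x =ᵐ[P] ξ x) ∧
    ∀ φ ψ : ℝ → ℝ, IsRieszBessel α γ φ ψ → ∀ t, 0 < t →
      HasTimeDerivAt β (fun s => ∫ x, φ x • v s x) (-μ • ∫ x, ψ x • v t x) t

/-- A symmetric complex Gaussian white noise `W` on `ℝ` with Lebesgue control measure, given by its
Wiener integral `g ↦ ∫ g(l) W(dl)`, a linear isometry `L²(ℝ; ℂ) → L²(Ω; ℂ)` with centred jointly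
Gaussian values (imaginary parts are covered since `Im z = Re (-i z)`). The random measure of a set
is the integral of its indicator; `symm` extends `W(-B) = conj W(B)` from indicators to `L²`. -/
structure SymmWhiteNoise {Ω : Type*} [MeasurableSpace Ω] (P : Measure Ω) where
  toIsometry : Lp ℂ 2 (volume : Measure ℝ) →ₗᵢ[ℂ] Lp ℂ 2 P
  centred : ∀ g, ∫ ω, toIsometry g ω ∂P = 0
  gaussian : IsGaussianProcess
    (fun (g : Lp ℂ 2 (volume : Measure ℝ)) ω => (toIsometry g ω).re) P
  symm : ∀ g h : Lp ℂ 2 (volume : Measure ℝ),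
    (∀ᵐ l : ℝ, h l = star (g (-l))) → toIsometry h = star (toIsometry g)

open Classical in
/-- The Wiener integral `∫ g(l) W(dl)` of a square-integrable function `g` (and `0` otherwise). -/
def SymmWhiteNoise.integral {Ω : Type*} [MeasurableSpace Ω] {P : Measure Ω}
    (W : SymmWhiteNoise P) (g : ℝ → ℂ) (ω : Ω) : ℂ :=
  if h : MemLp g 2 (volume : Measure ℝ) then W.toIsometry (h.toLp g) ω else 0

/-- The kernel `l ↦ e^{ilx} E_β(-μ t^β |l|^α)`. -/
def limitKernel (α β μ t x : ℝ) (l : ℝ) : ℂ :=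
  Complex.exp (Complex.I * l * x) * (mittagLeffler β (-μ * t ^ β * |l| ^ α) : ℂ)

/-- The field `U₀(t,x) = √f(0) ∫ e^{ilx} E_β(-μ t^β |l|^α) W(dl)`, as a complex random variable. -/
def limitField {Ω : Type*} [MeasurableSpace Ω] {P : Measure Ω} (W : SymmWhiteNoise P)
    (n : ℕ) (A w κ : ℕ → ℝ) (α β μ t x : ℝ) (ω : Ω) : ℂ :=
  (√(specDensZero n A w κ) : ℂ) * W.integral (limitKernel α β μ t x) ω

/-- The rescaled field `U_ε(t,x) = ε^(-β/(2α)) u(t/ε, x/ε^(β/α))`. -/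
def rescaled {Ω : Type*} (α β : ℝ) (u : ℝ → ℝ → Ω → ℝ) (ε t x : ℝ) (ω : Ω) : ℝ :=
  ε ^ (-(β / (2 * α))) * u (t / ε) (x / ε ^ (β / α)) ω

end

end FRBE

open MeasureTheory ProbabilityTheory Filter Topology
open scoped FourierTransform

namespace FRBE

/-! ### Growth of the Gamma function -/

/-! The solution never leaves the closed linear span of the initial field in `L²`
(`IsHilbertSolution.mem_of_initial`), and every element of that span is centred Gaussian
(`integral_exp_of_mem_closure_span`). Weak convergence of the finite-dimensional laws is therefore a
matter of covariances only (`tendstoInDistribution_of_inner`).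

The covariance comes from a spectral formula (`IsHilbertSolution.inner_eq`): if the initial field
has spectral density `F`, then the frequency `ξ` evolves by the factor `E_β(-μ t^β symbol ξ)`. Only
a weak equation is available, so the solution is first tested against kernels whose Fourier
transforms are a compactly supported cutoff times the `k`-th power of the symbol. Their `L¹` norms
grow at most geometrically in `k` by a Bernstein-type estimate (`integrable_fourier_even`), and this
is where `α > 1/2` first enters. The smoothed fields `V k` satisfy a chain of equations in which the
derivative of order `β` of `V k` is `-μ V (k + 1)`. Iterating the integrated equation expresses `V 0
t` by its Mittag-Leffler series in the initial values (`hasSum_of_hasTimeDerivAt`). Plancherel-type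
identities turn this into an integral over frequencies, and the cutoff is then removed.

With `h = ε^(β/α)` the rescaled covariance is `h⁻¹` times such an integral, in which the multiplier
lives on frequencies of size `h` (`tendsto_scaled_covariance`). Near zero the substitution `ξ = h l
/ 2π` produces `F 0 / 2π` times the limiting integral, the Bessel factor tending to 1. Away from
zero both Mittag-Leffler factors are `O(h^α)`, and the contribution is `O(h^(2α-1))`. The density is
continuous at 0 because its singularities sit at the nonzero frequencies `±w_j`. Its value there is
nonnegative because it is a limit of variances divided by a positive number.

The analytic input is the bound `|E_β(-x)| ≤ C / (1 + x)` for `x ≥ 0`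
(`exists_abs_mittagLeffler_neg_le`). For `β < 1` it is proved by real-variable means: a first-zero
argument shows `E_{β,β} > 0` on the negative half-line, hence `E_β(-t^β)` decreases, and comparison
with its own fractional integral gives the decay. -/

lemma rpow_mul_exp_neg_le_Gamma {L y : ℝ} (hL : 0 < L) (hy : 0 ≤ y) :
    L ^ y * Real.exp (-L) ≤ Real.Gamma (1 + y) := by
  rw [Real.Gamma_eq_integral (by linarith)]
  have hint := Real.GammaIntegral_convergent (s := 1 + y) (by linarith)
  -- Discarding `(0, L)` loses only positive mass, and on the rest `x^y ≥ L^y`.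
  have h1 : ∫ x in Set.Ioi L, Real.exp (-x) * x ^ (1 + y - 1)
      ≤ ∫ x in Set.Ioi (0 : ℝ), Real.exp (-x) * x ^ (1 + y - 1) := by
    refine setIntegral_mono_set hint ?_ (Set.Ioi_subset_Ioi hL.le).eventuallyLE
    filter_upwards [ae_restrict_mem measurableSet_Ioi] with x hx
    have : (0 : ℝ) < x := hx
    positivity
  have h2 : ∫ x in Set.Ioi L, L ^ y * Real.exp (-x)
      ≤ ∫ x in Set.Ioi L, Real.exp (-x) * x ^ (1 + y - 1) := by
    refine setIntegral_mono_on ((integrableOn_exp_neg_Ioi L).const_mul _)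
      (hint.mono_set (Set.Ioi_subset_Ioi hL.le)) measurableSet_Ioi fun x hx => ?_
    rw [mul_comm, add_sub_cancel_left]
    have : L < x := hx
    gcongr
  rw [integral_const_mul, integral_exp_neg_Ioi] at h2
  exact h2.trans h1

/-- Since `L` is free, this makes `1/Γ` decay faster than any prescribed geometric rate, which
replaces Stirling's formula. -/
lemma inv_Gamma_le {L y : ℝ} (hL : 0 < L) (hy : 0 ≤ y) :
    (Real.Gamma (1 + y))⁻¹ ≤ Real.exp L * L ^ (-y) := by
  have h := rpow_mul_exp_neg_le_Gamma hL hy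
  have hpos : 0 < L ^ y * Real.exp (-L) := by positivity
  calc (Real.Gamma (1 + y))⁻¹ ≤ (L ^ y * Real.exp (-L))⁻¹ := by gcongr
    _ = Real.exp L * L ^ (-y) := by
      rw [mul_inv, Real.exp_neg, inv_inv, Real.rpow_neg hL.le, mul_comm]

/-! ### The two-parameter Mittag-Leffler function -/

/-- The two-parameter Mittag-Leffler function `E_{β,b}(s) = ∑ₖ sᵏ / Γ(b + β k)`. -/
noncomputable def mittagLeffler₂ (β b s : ℝ) : ℝ :=
  ∑' k : ℕ, s ^ k / Real.Gamma (b + β * k)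

lemma mittagLeffler_eq (β s : ℝ) : mittagLeffler β s = mittagLeffler₂ β 1 s := rfl

lemma summable_mittagLeffler₂_abs {β b : ℝ} (hβ : 0 < β) (hb : 0 < b) (s : ℝ) :
    Summable fun k : ℕ => |s| ^ k / Real.Gamma (b + β * k) := by
  -- With this `L` the ratio `|s| / L^β` is at most `1/2`, so the terms are dominated by a geometric
  -- series as soon as `β k ≥ 1`.
  obtain ⟨L, hL1, hL⟩ : ∃ L : ℝ, 1 ≤ L ∧ 2 * |s| ≤ L ^ β := by
    refine ⟨(1 + 2 * |s|) ^ (1 / β), Real.one_le_rpow (by linarith [abs_nonneg s]) (by positivity),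
      ?_⟩
    rw [← Real.rpow_mul (by positivity), one_div_mul_cancel hβ.ne', Real.rpow_one]
    linarith
  have hL0 : 0 < L := by linarith
  obtain ⟨N, hN⟩ := exists_nat_ge (1 / β)
  have hg : Summable fun k : ℕ => Real.exp L * L ^ (1 - b) * (1 / 2 : ℝ) ^ k :=
    (summable_geometric_of_lt_one (by norm_num) (by norm_num)).mul_left _
  refine Summable.of_norm_bounded_eventually_nat hg ?_
  filter_upwards [eventually_ge_atTop N] with k hk
  have hk' : 1 ≤ β * k := by
    have : (1 / β : ℝ) ≤ k := hN.trans (by exact_mod_cast hk)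
    rwa [div_le_iff₀' hβ] at this
  have hG : 0 < Real.Gamma (b + β * k) := Real.Gamma_pos_of_pos (by nlinarith)
  rw [Real.norm_of_nonneg (by positivity), div_eq_mul_inv]
  have h := inv_Gamma_le hL0 (y := b + β * k - 1) (by linarith)
  rw [add_sub_cancel] at h
  calc |s| ^ k * (Real.Gamma (b + β * k))⁻¹
      ≤ |s| ^ k * (Real.exp L * L ^ (-(b + β * k - 1))) := by gcongr
    _ = Real.exp L * L ^ (1 - b) * (|s| ^ k * (L ^ β)⁻¹ ^ k) := by
      rw [show -(b + β * k - 1) = (1 - b) + (-β) * k by ring, Real.rpow_add hL0,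
        Real.rpow_mul hL0.le, Real.rpow_natCast, Real.rpow_neg hL0.le]
      ring
    _ ≤ Real.exp L * L ^ (1 - b) * (1 / 2 : ℝ) ^ k := by
      rw [← mul_pow]
      gcongr
      rw [← div_eq_mul_inv, div_le_iff₀ (by positivity)]
      linarith

lemma Gamma_add_mul_pos {β b : ℝ} (hβ : 0 < β) (hb : 0 < b) (k : ℕ) :
    0 < Real.Gamma (b + β * k) := Real.Gamma_pos_of_pos (by positivity)

lemma summable_mittagLeffler₂ {β b : ℝ} (hβ : 0 < β) (hb : 0 < b) (s : ℝ) :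
    Summable fun k : ℕ => s ^ k / Real.Gamma (b + β * k) := by
  refine Summable.of_norm ?_
  refine (summable_mittagLeffler₂_abs hβ hb s).congr fun k => ?_
  rw [norm_div, norm_pow, Real.norm_eq_abs, Real.norm_of_nonneg (Gamma_add_mul_pos hβ hb k).le]

lemma hasSum_mittagLeffler₂ {β b : ℝ} (hβ : 0 < β) (hb : 0 < b) (s : ℝ) :
    HasSum (fun k : ℕ => s ^ k / Real.Gamma (b + β * k)) (mittagLeffler₂ β b s) :=
  (summable_mittagLeffler₂ hβ hb s).hasSum

lemma abs_mittagLeffler₂_le {β b : ℝ} (hβ : 0 < β) (hb : 0 < b) {s S : ℝ} (hs : |s| ≤ S) :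
    |mittagLeffler₂ β b s| ≤ mittagLeffler₂ β b S := by
  have hS : 0 ≤ S := (abs_nonneg s).trans hs
  rw [← Real.norm_eq_abs, mittagLeffler₂]
  refine (norm_tsum_le_tsum_norm ?_).trans ?_
  · exact (summable_mittagLeffler₂ hβ hb s).norm
  · refine Summable.tsum_le_tsum (fun k => ?_) (summable_mittagLeffler₂ hβ hb s).norm
      (summable_mittagLeffler₂ hβ hb S)
    have := (Gamma_add_mul_pos hβ hb k)
    rw [norm_div, norm_pow, Real.norm_eq_abs, Real.norm_of_nonneg this.le]
    gcongr

lemma differentiable_mittagLeffler₂ {β b : ℝ} (hβ : 0 < β) (hb : 0 < b) :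
    Differentiable ℝ (mittagLeffler₂ β b) := by
  have hrad : (FormalMultilinearSeries.ofScalars ℝ
      (fun k : ℕ => (Real.Gamma (b + β * k))⁻¹)).radius = ⊤ := by
    refine FormalMultilinearSeries.radius_eq_top_of_summable_norm _ fun r => ?_
    refine (summable_mittagLeffler₂_abs hβ hb r).congr fun k => ?_
    rw [FormalMultilinearSeries.ofScalars_norm, norm_inv,
      Real.norm_of_nonneg (Gamma_add_mul_pos hβ hb k).le, NNReal.abs_eq]
    ring
  have h := (FormalMultilinearSeries.ofScalars ℝ
      (fun k : ℕ => (Real.Gamma (b + β * k))⁻¹)).hasFPowerSeriesOnBall (by rw [hrad]; simp)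
  rw [hrad] at h
  have h2 : (FormalMultilinearSeries.ofScalars ℝ
      (fun k : ℕ => (Real.Gamma (b + β * k))⁻¹)).sum = mittagLeffler₂ β b := by
    funext s
    simp only [FormalMultilinearSeries.sum, mittagLeffler₂]
    refine tsum_congr fun k => ?_
    rw [FormalMultilinearSeries.ofScalars_apply_eq, smul_eq_mul]
    ring
  rw [h2] at h
  intro s
  exact (h.analyticAt_of_mem (by simp)).differentiableAt

lemma continuous_mittagLeffler {β : ℝ} (hβ : 0 < β) : Continuous (mittagLeffler β) :=
  (differentiable_mittagLeffler₂ hβ one_pos).continuous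

lemma mittagLeffler₂_zero {β b : ℝ} : mittagLeffler₂ β b 0 = (Real.Gamma b)⁻¹ := by
  rw [mittagLeffler₂, tsum_eq_single 0]
  · simp
  · intro k hk; simp [hk]

/-- A shift of the summation index. With `b = 1` it trades `E_{β,1+β}`, which fractional integration
produces, for `1 - E_β`. -/
lemma mul_mittagLeffler₂_add {β b : ℝ} (hβ : 0 < β) (hb : 0 < b) (s : ℝ) :
    s * mittagLeffler₂ β (b + β) s = mittagLeffler₂ β b s - (Real.Gamma b)⁻¹ := by
  have h := (summable_mittagLeffler₂ hβ hb s).tsum_eq_zero_add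
  rw [mittagLeffler₂, mittagLeffler₂, h, ← tsum_mul_left]
  simp only [pow_zero, CharP.cast_eq_zero, mul_zero, add_zero, one_div, add_sub_cancel_left]
  refine tsum_congr fun k => ?_
  push_cast
  rw [show b + β + β * k = b + β * (k + 1) by ring]
  ring

/-! ### Euler's beta integral -/

lemma integral_sub_rpow_mul_rpow {b c t : ℝ} (hb : 0 < b) (hc : 0 < c) (ht : 0 < t) :
    ∫ τ in (0 : ℝ)..t, (t - τ) ^ (c - 1) * τ ^ (b - 1) =
      t ^ (b + c - 1) * (Real.Gamma b * Real.Gamma c / Real.Gamma (b + c)) := by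
  have h := Complex.betaIntegral_scaled b c ht
  rw [Complex.betaIntegral_eq_Gamma_mul_div _ _ (by simpa) (by simpa)] at h
  have h1 : ∫ x in (0 : ℝ)..t, (x : ℂ) ^ ((b : ℂ) - 1) * ((t : ℂ) - x) ^ ((c : ℂ) - 1)
      = ((∫ τ in (0 : ℝ)..t, (t - τ) ^ (c - 1) * τ ^ (b - 1) : ℝ) : ℂ) := by
    rw [← intervalIntegral.integral_ofReal]
    refine intervalIntegral.integral_congr fun x hx => ?_
    rw [Set.uIcc_of_le ht.le] at hx
    push_cast
    rw [Complex.ofReal_cpow (by linarith [hx.2]), Complex.ofReal_cpow hx.1]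
    push_cast
    ring
  rw [h1] at h
  have h2 : ((t : ℂ) ^ ((b : ℂ) + c - 1)) *
      (Complex.Gamma b * Complex.Gamma c / Complex.Gamma (b + c)) =
      ((t ^ (b + c - 1) * (Real.Gamma b * Real.Gamma c / Real.Gamma (b + c)) : ℝ) : ℂ) := by
    push_cast
    rw [Complex.ofReal_cpow ht.le, ← Complex.Gamma_ofReal, ← Complex.Gamma_ofReal,
      ← Complex.Gamma_ofReal]
    push_cast
    rfl
  rw [h2] at h
  exact_mod_cast h

lemma intervalIntegrable_sub_rpow_mul_rpow {b c t : ℝ} (hb : 0 < b) (hc : 0 < c) (ht : 0 < t) :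
    IntervalIntegrable (fun τ => (t - τ) ^ (c - 1) * τ ^ (b - 1)) volume 0 t := by
  -- The integral of a non-integrable function is 0 by convention, whereas the Beta value is
  -- positive.
  by_contra h
  have h1 := integral_sub_rpow_mul_rpow hb hc ht
  rw [intervalIntegral.integral_undef h] at h1
  have := Real.Gamma_pos_of_pos hb
  have := Real.Gamma_pos_of_pos hc
  have := Real.Gamma_pos_of_pos (add_pos hb hc)
  have : 0 < t ^ (b + c - 1) * (Real.Gamma b * Real.Gamma c / Real.Gamma (b + c)) := by positivity
  linarith

/-- Each term of the series is a power of `τ`, so termwise Beta integrals raise the index `b` to `b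
+ c`. The exchange of sum and integral is allowed because the `L¹` norms of the terms add up to a
multiple of the same series at `+t^β`. The cases used below are `(b, c) = (β, 1)`, `(β, 1 - β)` and
`(1, β)`. -/
lemma integral_sub_rpow_mul_mittagLeffler₂ {β b c t : ℝ} (hβ : 0 < β) (hb : 0 < b) (hc : 0 < c)
    (ht : 0 < t) :
    IntervalIntegrable (fun τ => (t - τ) ^ (c - 1) * (τ ^ (b - 1) * mittagLeffler₂ β b (-τ ^ β)))
      volume 0 t ∧
    ∫ τ in (0 : ℝ)..t, (t - τ) ^ (c - 1) * (τ ^ (b - 1) * mittagLeffler₂ β b (-τ ^ β)) =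
      Real.Gamma c * (t ^ (b + c - 1) * mittagLeffler₂ β (b + c) (-t ^ β)) := by
  have hcont : Continuous (fun τ : ℝ => mittagLeffler₂ β b (-τ ^ β)) :=
    (differentiable_mittagLeffler₂ hβ hb).continuous.comp
      (Real.continuous_rpow_const hβ.le).neg
  have hInt : IntervalIntegrable
      (fun τ => (t - τ) ^ (c - 1) * (τ ^ (b - 1) * mittagLeffler₂ β b (-τ ^ β))) volume 0 t := by
    have := (intervalIntegrable_sub_rpow_mul_rpow hb hc ht).mul_continuousOn hcont.continuousOn
    simpa only [mul_assoc] using this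
  refine ⟨hInt, ?_⟩
  let F : ℕ → ℝ → ℝ := fun k τ =>
    (-1) ^ k / Real.Gamma (b + β * k) * ((t - τ) ^ (c - 1) * τ ^ (b + β * k - 1))
  have hFint : ∀ k, Integrable (F k) (volume.restrict (Set.Ioc 0 t)) := fun k => by
    have := intervalIntegrable_sub_rpow_mul_rpow (b := b + β * k) (by positivity) hc ht
    rw [intervalIntegrable_iff_integrableOn_Ioc_of_le ht.le] at this
    exact this.const_mul _
  have hval : ∀ k : ℕ, ∫ τ in Set.Ioc 0 t, (t - τ) ^ (c - 1) * τ ^ (b + β * k - 1) =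
      Real.Gamma (b + β * k) * (Real.Gamma c * t ^ (b + c - 1) *
        ((t ^ β) ^ k / Real.Gamma (b + c + β * k))) := fun k => by
    rw [← intervalIntegral.integral_of_le ht.le,
      integral_sub_rpow_mul_rpow (by positivity) hc ht,
      show b + β * k + c - 1 = (b + c - 1) + β * k by ring, Real.rpow_add ht, Real.rpow_mul ht.le,
      Real.rpow_natCast, show b + β * k + c = b + c + β * k by ring]
    ring
  have hsum : Summable fun k => ∫ τ in Set.Ioc 0 t, ‖F k τ‖ := by
    refine ((summable_mittagLeffler₂ hβ (add_pos hb hc) (t ^ β)).mul_left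
      (Real.Gamma c * t ^ (b + c - 1))).congr fun k => ?_
    have hG := Gamma_add_mul_pos hβ hb k
    have : ∫ τ in Set.Ioc 0 t, ‖F k τ‖ = ∫ τ in Set.Ioc 0 t,
        (Real.Gamma (b + β * k))⁻¹ * ((t - τ) ^ (c - 1) * τ ^ (b + β * k - 1)) := by
      refine setIntegral_congr_fun measurableSet_Ioc fun τ hτ => ?_
      have h1 : 0 ≤ t - τ := by linarith [hτ.2]
      have h2 : 0 ≤ τ := hτ.1.le
      simp only [F, norm_mul, norm_div, norm_pow, norm_neg, norm_one, one_pow]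
      rw [Real.norm_of_nonneg hG.le, Real.norm_of_nonneg (by positivity),
        Real.norm_of_nonneg (by positivity)]
      ring
    rw [this, integral_const_mul, hval, inv_mul_cancel_left₀ hG.ne']
  have key := hasSum_integral_of_summable_integral_norm hFint hsum
  have hR : ∀ τ ∈ Set.Ioc 0 t, ∑' k, F k τ =
      (t - τ) ^ (c - 1) * (τ ^ (b - 1) * mittagLeffler₂ β b (-τ ^ β)) := fun τ hτ => by
    rw [mittagLeffler₂, ← tsum_mul_left, ← tsum_mul_left]
    refine tsum_congr fun k => ?_
    simp only [F]
    rw [show b + β * k - 1 = (b - 1) + β * k by ring, Real.rpow_add hτ.1, Real.rpow_mul hτ.1.le,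
      Real.rpow_natCast, neg_pow (τ ^ β)]
    ring
  rw [intervalIntegral.integral_of_le ht.le, ← setIntegral_congr_fun measurableSet_Ioc hR]
  refine key.unique ?_
  rw [← mul_assoc]
  refine ((hasSum_mittagLeffler₂ hβ (add_pos hb hc) (-t ^ β)).mul_left _).congr_fun ?_
  intro k
  have hG := Gamma_add_mul_pos hβ hb k
  simp only [F]
  rw [integral_const_mul, hval, neg_pow (t ^ β)]
  field_simp

/-! ### Complete monotonicity of first order and decay of the Mittag-Leffler function -/

/-- A function with a zero at `t₁` which is positive to the left of it has a fractional integral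
of order `1 - β` with strictly negative lower left derivative. -/
lemma not_hasDerivAt_zero_of_first_zero {β t₁ : ℝ} (hβ0 : 0 < β) (hβ : β < 1) (ht₁ : 0 < t₁)
    {h : ℝ → ℝ} (hpos : ∀ τ ∈ Set.Ioo 0 t₁, 0 < h τ) (hzero : h t₁ = 0)
    (hdiff : DifferentiableAt ℝ h t₁)
    (hint : ∀ t, 0 < t → IntervalIntegrable h volume 0 t)
    (hint' : ∀ t, 0 < t → IntervalIntegrable (fun τ => (t - τ) ^ (-β) * h τ) volume 0 t) :
    ¬ HasDerivAt (fun t => ∫ τ in (0 : ℝ)..t, (t - τ) ^ (-β) * h τ) 0 t₁ := by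
  intro hder
  set H : ℝ → ℝ := fun t => ∫ τ in (0 : ℝ)..t, (t - τ) ^ (-β) * h τ with hH
  -- a linear bound for `h` near `t₁`
  obtain ⟨L, hL0, hL⟩ : ∃ L : ℝ, 0 < L ∧ ∀ᶠ τ in 𝓝 t₁, |h τ| ≤ L * |τ - t₁| := by
    obtain ⟨L, hL0, hb⟩ := hdiff.hasDerivAt.isBigO_sub.exists_pos
    refine ⟨L, hL0, ?_⟩
    filter_upwards [hb.bound] with τ hτ
    simpa [hzero] using hτ
  obtain ⟨δ₀, hδ₀, hball⟩ := Metric.eventually_nhds_iff.1 hL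
  set I : ℝ := ∫ τ in (0 : ℝ)..(t₁ / 2), h τ with hI
  have hIpos : 0 < I := by
    refine intervalIntegral.intervalIntegral_pos_of_pos_on (hint _ (by linarith)) ?_ (by linarith)
    intro τ hτ
    exact hpos τ ⟨hτ.1, by linarith [hτ.2]⟩
  set c : ℝ := β * t₁ ^ (-β - 1) * I with hc
  have hcpos : 0 < c := by positivity
  -- the kernel decreases
  have hker : ∀ δ τ, 0 < δ → 0 ≤ τ → τ < t₁ - δ →
      β * t₁ ^ (-β - 1) * δ ≤ (t₁ - δ - τ) ^ (-β) - (t₁ - τ) ^ (-β) := by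
    intro δ τ hδ hτ hτδ
    obtain ⟨x, hx, hx'⟩ := exists_hasDerivAt_eq_slope (fun x : ℝ => x ^ (-β))
      (fun x => (-β) * x ^ (-β - 1)) (a := t₁ - δ - τ) (b := t₁ - τ) (by linarith)
      (fun x hx => (Real.continuousAt_rpow_const x (-β)
        (Or.inl (show x ≠ 0 by linarith [hx.1]))).continuousWithinAt)
      (fun x hx => Real.hasDerivAt_rpow_const (Or.inl (show x ≠ 0 by linarith [hx.1])))
    have hx0 : 0 < x := by linarith [hx.1]
    have hx1 : x ≤ t₁ := by linarith [hx.2]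
    rw [show t₁ - τ - (t₁ - δ - τ) = δ by ring, eq_div_iff hδ.ne'] at hx'
    have : t₁ ^ (-β - 1) ≤ x ^ (-β - 1) :=
      Real.rpow_le_rpow_of_nonpos hx0 hx1 (by linarith)
    have h2 : β * t₁ ^ (-β - 1) * δ ≤ β * x ^ (-β - 1) * δ := by gcongr
    linarith
  -- Stepping back by `δ` enlarges the kernel. On `[0, t₁/2]` alone this gains `c δ`, where `c`
  -- combines the mean value bound for the kernel with the mass `I` of `h`. What is lost is the
  -- integral over the last `δ`, and there the linear bound on `h` beats the singularity of the
  -- kernel, leaving `O(δ^(2-β))`.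
  have hmain : ∀ δ, 0 < δ → δ < δ₀ → δ < t₁ / 2 →
      c * δ - L * δ ^ (1 - β) * δ ≤ H (t₁ - δ) - H t₁ := by
    intro δ hδ hδ1 hδ2
    have hi1 := hint' t₁ ht₁
    have hi2 := hint' (t₁ - δ) (by linarith)
    have hi3 : IntervalIntegrable (fun τ => (t₁ - τ) ^ (-β) * h τ) volume 0 (t₁ - δ) :=
      hi1.mono_set (by
        rw [Set.uIcc_of_le (by linarith), Set.uIcc_of_le (by linarith)]
        exact Set.Icc_subset_Icc_right (by linarith))
    have hi4 : IntervalIntegrable (fun τ => (t₁ - τ) ^ (-β) * h τ) volume (t₁ - δ) t₁ :=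
      hi1.mono_set (by
        rw [Set.uIcc_of_le (by linarith), Set.uIcc_of_le (by linarith)]
        exact Set.Icc_subset_Icc_left (by linarith))
    have hsplit : H t₁ = (∫ τ in (0 : ℝ)..(t₁ - δ), (t₁ - τ) ^ (-β) * h τ) +
        ∫ τ in (t₁ - δ)..t₁, (t₁ - τ) ^ (-β) * h τ :=
      (intervalIntegral.integral_add_adjacent_intervals hi3 hi4).symm
    have hsecond : ∫ τ in (t₁ - δ)..t₁, (t₁ - τ) ^ (-β) * h τ ≤ L * δ ^ (1 - β) * δ := by
      have hle : ∀ τ ∈ Set.Ioo (t₁ - δ) t₁, (t₁ - τ) ^ (-β) * h τ ≤ L * δ ^ (1 - β) := by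
        intro τ hτ
        have h0 : 0 < t₁ - τ := by linarith [hτ.2]
        have hb : |h τ| ≤ L * |τ - t₁| := hball (by
          rw [Real.dist_eq, abs_sub_comm, abs_of_pos h0]; linarith [hτ.1])
        rw [abs_sub_comm, abs_of_pos h0] at hb
        calc (t₁ - τ) ^ (-β) * h τ ≤ (t₁ - τ) ^ (-β) * (L * (t₁ - τ)) := by
              gcongr; exact (le_abs_self _).trans hb
          _ = L * (t₁ - τ) ^ (1 - β) := by
              rw [show (1 - β) = -β + 1 by ring, Real.rpow_add_one h0.ne']; ring
          _ ≤ L * δ ^ (1 - β) := by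
              gcongr
              linarith [hτ.1]
      have := intervalIntegral.integral_mono_on_of_le_Ioo (a := t₁ - δ) (b := t₁) (by linarith)
        hi4 (intervalIntegrable_const (c := L * δ ^ (1 - β))) hle
      rw [intervalIntegral.integral_const, smul_eq_mul] at this
      linarith
    have hsub : H (t₁ - δ) - ∫ τ in (0 : ℝ)..(t₁ - δ), (t₁ - τ) ^ (-β) * h τ =
        ∫ τ in (0 : ℝ)..(t₁ - δ), ((t₁ - δ - τ) ^ (-β) - (t₁ - τ) ^ (-β)) * h τ := by
      rw [hH]
      simp only
      rw [← intervalIntegral.integral_sub hi2 hi3]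
      simp only [sub_mul]
    have hi5 : IntervalIntegrable
        (fun τ => ((t₁ - δ - τ) ^ (-β) - (t₁ - τ) ^ (-β)) * h τ) volume 0 (t₁ - δ) := by
      simp only [sub_mul]
      exact hi2.sub hi3
    have hfirst : c * δ ≤
        ∫ τ in (0 : ℝ)..(t₁ - δ), ((t₁ - δ - τ) ^ (-β) - (t₁ - τ) ^ (-β)) * h τ := by
      have ha : ∫ τ in (0 : ℝ)..(t₁ / 2), ((t₁ - δ - τ) ^ (-β) - (t₁ - τ) ^ (-β)) * h τ ≤
          ∫ τ in (0 : ℝ)..(t₁ - δ), ((t₁ - δ - τ) ^ (-β) - (t₁ - τ) ^ (-β)) * h τ := by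
        refine intervalIntegral.integral_mono_interval le_rfl (by linarith) (by linarith) ?_ hi5
        rw [← restrict_Ioo_eq_restrict_Ioc]
        filter_upwards [ae_restrict_mem measurableSet_Ioo] with τ hτ
        have := hker δ τ hδ hτ.1.le hτ.2
        have h1 : 0 ≤ β * t₁ ^ (-β - 1) * δ := by positivity
        exact mul_nonneg (by linarith) (hpos τ ⟨hτ.1, by linarith [hτ.2]⟩).le
      refine le_trans ?_ ha
      have : c * δ = ∫ τ in (0 : ℝ)..(t₁ / 2), β * t₁ ^ (-β - 1) * δ * h τ := by
        rw [intervalIntegral.integral_const_mul, hc, hI]; ring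
      rw [this]
      refine intervalIntegral.integral_mono_on_of_le_Ioo (by linarith)
        ((hint _ (by linarith)).const_mul _) (hi5.mono_set ?_) ?_
      · rw [Set.uIcc_of_le (by linarith), Set.uIcc_of_le (by linarith)]
        exact Set.Icc_subset_Icc_right (by linarith)
      · intro τ hτ
        have := hker δ τ hδ hτ.1.le (by linarith [hτ.2])
        exact mul_le_mul_of_nonneg_right this (hpos τ ⟨hτ.1, by linarith [hτ.2]⟩).le
    linarith
  -- A zero derivative would make the increment at most `c δ / 4`, while the previous step leaves at
  -- least `3 c δ / 4` for small `δ`.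
  have hsmall : ∀ᶠ δ in 𝓝[>] (0 : ℝ), |H (t₁ - δ) - H t₁| ≤ c / 4 * δ := by
    have h1 := (hasDerivAt_iff_isLittleO.1 hder).def (c := c / 4) (by positivity)
    have h2 : Tendsto (fun δ : ℝ => t₁ - δ) (𝓝[>] 0) (𝓝 t₁) := by
      have : Tendsto (fun δ : ℝ => t₁ - δ) (𝓝 0) (𝓝 (t₁ - 0)) :=
        (continuous_const.sub continuous_id).tendsto 0
      rw [sub_zero] at this
      exact this.mono_left nhdsWithin_le_nhds
    filter_upwards [h2.eventually h1, self_mem_nhdsWithin] with δ hδ hδ0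
    have hδ0 : 0 < δ := hδ0
    simpa [abs_of_pos hδ0] using hδ
  have hpow : ∀ᶠ δ in 𝓝[>] (0 : ℝ), L * δ ^ (1 - β) < c / 4 := by
    have : Tendsto (fun δ : ℝ => L * δ ^ (1 - β)) (𝓝 0) (𝓝 (L * 0 ^ (1 - β))) :=
      ((Real.continuous_rpow_const (by linarith)).tendsto 0).const_mul L
    rw [Real.zero_rpow (by linarith), mul_zero] at this
    exact (this.mono_left nhdsWithin_le_nhds).eventually_lt_const (by positivity)
  have hrange : ∀ᶠ δ in 𝓝[>] (0 : ℝ), δ ∈ Set.Ioo 0 (min δ₀ (t₁ / 2)) :=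
    Ioo_mem_nhdsGT (by positivity)
  obtain ⟨δ, ⟨h1, h2⟩, h3⟩ := ((hsmall.and hpow).and hrange).exists
  have h4 := hmain δ h3.1 (h3.2.trans_le (min_le_left _ _)) (h3.2.trans_le (min_le_right _ _))
  have h5 : L * δ ^ (1 - β) * δ ≤ c / 4 * δ := by
    have := h3.1
    gcongr
  have h6 := (le_abs_self _).trans h1
  nlinarith [mul_pos hcpos h3.1]

lemma integral_mittagLeffler₂_self {β : ℝ} (hβ : 0 < β) {t : ℝ} (ht : 0 < t) :
    IntervalIntegrable (fun τ => τ ^ (β - 1) * mittagLeffler₂ β β (-τ ^ β)) volume 0 t ∧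
    ∫ τ in (0 : ℝ)..t, τ ^ (β - 1) * mittagLeffler₂ β β (-τ ^ β) =
      1 - mittagLeffler β (-t ^ β) := by
  have h := integral_sub_rpow_mul_mittagLeffler₂ hβ hβ one_pos ht
  simp only [sub_self, Real.rpow_zero, one_mul, Real.Gamma_one, add_sub_cancel_right] at h
  refine ⟨h.1, ?_⟩
  have h2 := mul_mittagLeffler₂_add hβ one_pos (-t ^ β)
  rw [Real.Gamma_one, inv_one, ← mittagLeffler_eq, add_comm 1 β] at h2
  rw [h.2]
  linarith

lemma hasDerivAt_mittagLeffler_neg_rpow {β : ℝ} (hβ : 0 < β) {t : ℝ} (ht : 0 < t) :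
    HasDerivAt (fun t => mittagLeffler β (-t ^ β))
      (-(t ^ (β - 1) * mittagLeffler₂ β β (-t ^ β))) t := by
  have hcont : ContinuousAt (fun τ : ℝ => τ ^ (β - 1) * mittagLeffler₂ β β (-τ ^ β)) t :=
    (Real.continuousAt_rpow_const _ _ (Or.inl ht.ne')).mul
      ((differentiable_mittagLeffler₂ hβ hβ).continuous.comp
        (Real.continuous_rpow_const hβ.le).neg).continuousAt
  have hmeas : StronglyMeasurableAtFilter
      (fun τ : ℝ => τ ^ (β - 1) * mittagLeffler₂ β β (-τ ^ β)) (𝓝 t) volume := by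
    refine (Measurable.stronglyMeasurable ?_).stronglyMeasurableAtFilter
    have := (differentiable_mittagLeffler₂ hβ hβ).continuous.measurable
    fun_prop
  have h := intervalIntegral.integral_hasDerivAt_right
    (integral_mittagLeffler₂_self hβ ht).1 hmeas hcont
  refine (h.const_sub 1).congr_of_eventuallyEq ?_
  filter_upwards [lt_mem_nhds ht] with s hs
  rw [(integral_mittagLeffler₂_self hβ hs).2]
  ring

/-- Put `h(τ) = τ^(β-1) E_{β,β}(-τ^β)`. Its fractional integral of order `1 - β` is `E_β(-t^β)`, and
the derivative of the latter is `-h(t)`. At a first zero of `h` that derivative would vanish, which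
`not_hasDerivAt_zero_of_first_zero` forbids. -/
lemma mittagLeffler₂_self_neg_pos {β : ℝ} (hβ0 : 0 < β) (hβ : β < 1) {s : ℝ} (hs : 0 ≤ s) :
    0 < mittagLeffler₂ β β (-s) := by
  by_contra hneg
  rw [not_lt] at hneg
  have hcont : Continuous fun s => mittagLeffler₂ β β (-s) :=
    (differentiable_mittagLeffler₂ hβ0 hβ0).continuous.comp continuous_neg
  set Z : Set ℝ := {s | 0 ≤ s ∧ mittagLeffler₂ β β (-s) ≤ 0} with hZ
  have hZc : IsClosed Z :=
    (isClosed_le continuous_const continuous_id).inter (isClosed_le hcont continuous_const)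
  have hZb : BddBelow Z := ⟨0, fun x hx => hx.1⟩
  have hmem : sInf Z ∈ Z := hZc.csInf_mem ⟨s, hs, hneg⟩ hZb
  set s₁ := sInf Z with hs₁
  have hG0 : 0 < mittagLeffler₂ β β (-0) := by
    rw [neg_zero, mittagLeffler₂_zero]
    exact inv_pos.2 (Real.Gamma_pos_of_pos hβ0)
  have hs₁pos : 0 < s₁ := by
    rcases hmem.1.lt_or_eq with h | h
    · exact h
    · have := hmem.2
      rw [← h] at this
      linarith
  have hbefore : ∀ x, 0 ≤ x → x < s₁ → 0 < mittagLeffler₂ β β (-x) := by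
    intro x hx0 hx
    by_contra hcon
    exact absurd (csInf_le hZb (show x ∈ Z from ⟨hx0, not_lt.1 hcon⟩)) (not_le.2 hx)
  have hzero : mittagLeffler₂ β β (-s₁) = 0 := by
    refine le_antisymm hmem.2 ?_
    have : Tendsto (fun x => mittagLeffler₂ β β (-x)) (𝓝[<] s₁) (𝓝 (mittagLeffler₂ β β (-s₁))) :=
      (hcont.tendsto s₁).mono_left nhdsWithin_le_nhds
    refine ge_of_tendsto this ?_
    filter_upwards [Ioo_mem_nhdsLT hs₁pos] with x hx
    exact (hbefore x hx.1.le hx.2).le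
  set t₁ := s₁ ^ (1 / β) with ht₁
  have ht₁pos : 0 < t₁ := by positivity
  have ht₁β : t₁ ^ β = s₁ := by
    rw [ht₁, ← Real.rpow_mul hs₁pos.le, one_div_mul_cancel hβ0.ne', Real.rpow_one]
  have hcap := fun (t : ℝ) (ht : 0 < t) =>
    integral_sub_rpow_mul_mittagLeffler₂ hβ0 hβ0 (c := 1 - β) (by linarith) ht
  simp only [show 1 - β - 1 = -β by ring, add_sub_cancel, sub_self, Real.rpow_zero, one_mul,
    ← mittagLeffler_eq] at hcap
  refine not_hasDerivAt_zero_of_first_zero hβ0 hβ ht₁pos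
    (h := fun τ => τ ^ (β - 1) * mittagLeffler₂ β β (-τ ^ β)) ?_ ?_ ?_
    (fun t ht => (integral_mittagLeffler₂_self hβ0 ht).1) (fun t ht => (hcap t ht).1) ?_
  · intro τ hτ
    have h1 := hbefore (τ ^ β) (by have := hτ.1; positivity) (by
      rw [← ht₁β]; exact Real.rpow_lt_rpow hτ.1.le hτ.2 hβ0)
    have := hτ.1
    positivity
  · simp only [ht₁β, hzero, mul_zero]
  · refine (Real.differentiableAt_rpow_const_of_ne _ ht₁pos.ne').mul ?_
    exact (differentiable_mittagLeffler₂ hβ0 hβ0).differentiableAt.comp _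
      (Real.differentiableAt_rpow_const_of_ne _ ht₁pos.ne').neg
  · have h := (hasDerivAt_mittagLeffler_neg_rpow hβ0 ht₁pos).const_mul (Real.Gamma (1 - β))
    rw [ht₁β, hzero, mul_zero, neg_zero, mul_zero] at h
    refine h.congr_of_eventuallyEq ?_
    filter_upwards [lt_mem_nhds ht₁pos] with t ht
    exact (hcap t ht).2

lemma antitoneOn_mittagLeffler {β : ℝ} (hβ0 : 0 < β) (hβ : β < 1) :
    AntitoneOn (fun t : ℝ => mittagLeffler β (-t ^ β)) (Set.Ici 0) := by
  refine antitoneOn_of_deriv_nonpos (convex_Ici 0) ?_ ?_ ?_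
  · exact ((continuous_mittagLeffler hβ0).comp
      (Real.continuous_rpow_const hβ0.le).neg).continuousOn
  · rw [interior_Ici]
    exact fun t ht => (hasDerivAt_mittagLeffler_neg_rpow hβ0 ht).differentiableAt.differentiableWithinAt
  · rw [interior_Ici]
    intro t ht
    have ht : 0 < t := ht
    rw [(hasDerivAt_mittagLeffler_neg_rpow hβ0 ht).deriv, neg_nonpos]
    have := mittagLeffler₂_self_neg_pos hβ0 hβ (s := t ^ β) (by positivity)
    positivity

lemma mittagLeffler_zero (β : ℝ) : mittagLeffler β 0 = 1 := by
  rw [mittagLeffler_eq, mittagLeffler₂_zero, Real.Gamma_one, inv_one]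

/-- Up to the factor `Γ(1-β)`, this is the integral of a nonnegative kernel against a positive
function. -/
lemma mittagLeffler_neg_nonneg {β : ℝ} (hβ0 : 0 < β) (hβ : β < 1) {t : ℝ} (ht : 0 < t) :
    0 ≤ mittagLeffler β (-t ^ β) := by
  have hcap := integral_sub_rpow_mul_mittagLeffler₂ hβ0 hβ0 (c := 1 - β) (by linarith) ht
  simp only [show 1 - β - 1 = -β by ring, add_sub_cancel, sub_self, Real.rpow_zero, one_mul,
    ← mittagLeffler_eq] at hcap
  have hG : 0 < Real.Gamma (1 - β) := Real.Gamma_pos_of_pos (by linarith)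
  have h0 : 0 ≤ ∫ τ in (0 : ℝ)..t, (t - τ) ^ (-β) * (τ ^ (β - 1) * mittagLeffler₂ β β (-τ ^ β)) := by
    refine intervalIntegral.integral_nonneg ht.le fun τ hτ => ?_
    have h1 : 0 ≤ t - τ := by linarith [hτ.2]
    have h2 := hτ.1
    have := mittagLeffler₂_self_neg_pos hβ0 hβ (s := τ ^ β) (by positivity)
    positivity
  rw [hcap.2] at h0
  exact nonneg_of_mul_nonneg_right h0 hG

lemma mittagLeffler_one (s : ℝ) : mittagLeffler 1 s = Real.exp s := by
  rw [mittagLeffler, Real.exp_eq_exp_ℝ, NormedSpace.exp_eq_tsum_div]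
  refine tsum_congr fun k => ?_
  rw [one_mul, add_comm, Real.Gamma_nat_eq_factorial]

/-- The Mittag-Leffler function of order `β ∈ (0, 1]` decays on the negative half-line. -/
lemma exists_abs_mittagLeffler_neg_le {β : ℝ} (hβ : β ∈ Set.Ioc (0 : ℝ) 1) :
    ∃ C : ℝ, 0 < C ∧ ∀ x, 0 ≤ x → |mittagLeffler β (-x)| ≤ C / (1 + x) := by
  obtain ⟨hβ0, hβ1⟩ := hβ
  rcases hβ1.eq_or_lt with rfl | hβ1
  · refine ⟨1, one_pos, fun x hx => ?_⟩
    rw [mittagLeffler_one, abs_of_pos (Real.exp_pos _), Real.exp_neg, one_div]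
    gcongr
    linarith [Real.add_one_le_exp x]
  have hG : 0 < Real.Gamma β := Real.Gamma_pos_of_pos hβ0
  -- The fractional integral of order `β` of `E_β(-τ^β)` equals `1 - E_β(-t^β)`. By monotonicity it
  -- is at least the final value `E_β(-t^β)` times `t^β / (β Γ(β))`.
  have key : ∀ x, 0 < x → 0 ≤ mittagLeffler β (-x) ∧
      mittagLeffler β (-x) * (1 + x / (β * Real.Gamma β)) ≤ 1 := by
    intro x hx
    set t := x ^ (1 / β) with ht
    have ht0 : 0 < t := by positivity
    have htβ : t ^ β = x := by
      rw [ht, ← Real.rpow_mul hx.le, one_div_mul_cancel hβ0.ne', Real.rpow_one]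
    have hn := mittagLeffler_neg_nonneg hβ0 hβ1 ht0
    have hV := integral_sub_rpow_mul_mittagLeffler₂ hβ0 one_pos hβ0 ht0
    simp only [sub_self, Real.rpow_zero, one_mul, ← mittagLeffler_eq, add_sub_cancel_left] at hV
    have h2 := mul_mittagLeffler₂_add hβ0 one_pos (-t ^ β)
    rw [Real.Gamma_one, inv_one, ← mittagLeffler_eq] at h2
    have h3 : t ^ β * mittagLeffler₂ β (1 + β) (-t ^ β) = 1 - mittagLeffler β (-t ^ β) := by
      linarith
    rw [h3] at hV
    have hi : IntervalIntegrable (fun τ => (t - τ) ^ (β - 1)) volume 0 t := by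
      simpa using intervalIntegrable_sub_rpow_mul_rpow (b := 1) one_pos hβ0 ht0
    have hval : ∫ τ in (0 : ℝ)..t, (t - τ) ^ (β - 1) = t ^ β / β := by
      have := integral_sub_rpow_mul_rpow (b := 1) one_pos hβ0 ht0
      simp only [sub_self, Real.rpow_zero, mul_one, add_sub_cancel_left, Real.Gamma_one,
        one_mul] at this
      rw [this, add_comm 1 β, Real.Gamma_add_one hβ0.ne']
      field_simp
    have hle : ∫ τ in (0 : ℝ)..t, (t - τ) ^ (β - 1) * mittagLeffler β (-t ^ β) ≤
        ∫ τ in (0 : ℝ)..t, (t - τ) ^ (β - 1) * mittagLeffler β (-τ ^ β) := by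
      refine intervalIntegral.integral_mono_on ht0.le (hi.mul_const _) hV.1 fun τ hτ => ?_
      have h1 : 0 ≤ t - τ := by linarith [hτ.2]
      exact mul_le_mul_of_nonneg_left
        (antitoneOn_mittagLeffler hβ0 hβ1 hτ.1 ht0.le hτ.2) (by positivity)
    rw [hV.2, intervalIntegral.integral_mul_const, hval, htβ] at hle
    rw [htβ] at hn
    refine ⟨hn, ?_⟩
    have : mittagLeffler β (-x) * (x / (β * Real.Gamma β)) =
        (x / β * mittagLeffler β (-x)) / Real.Gamma β := by field_simp
    rw [mul_add, mul_one, this]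
    have : (x / β * mittagLeffler β (-x)) / Real.Gamma β ≤ 1 - mittagLeffler β (-x) := by
      rw [div_le_iff₀ hG]; linarith
    linarith
  set a := β * Real.Gamma β with ha
  have ha0 : 0 < a := by positivity
  refine ⟨1 + a, by positivity, fun x hx => ?_⟩
  rcases hx.eq_or_lt with rfl | hx
  · rw [neg_zero, mittagLeffler_zero, abs_one, add_zero, div_one]
    linarith
  obtain ⟨h1, h2⟩ := key x hx
  rw [abs_of_nonneg h1, le_div_iff₀ (by positivity)]
  set e := mittagLeffler β (-x)
  have h4 : e * x ≤ a * (1 - e) := by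
    have : e * (x / a) ≤ 1 - e := by linarith
    calc e * x = a * (e * (x / a)) := by field_simp
      _ ≤ _ := by gcongr
  nlinarith

/-! ### Fractional evolution equations with values in a Banach space -/

section Fractional

variable {E : Type*} [NormedAddCommGroup E] [NormedSpace ℝ E]

lemma intervalIntegrable_sub_rpow {c t : ℝ} (hc : 0 < c) (ht : 0 ≤ t) :
    IntervalIntegrable (fun τ => (t - τ) ^ (c - 1)) volume 0 t := by
  rcases ht.eq_or_lt with rfl | ht
  · exact IntervalIntegrable.refl
  · simpa using intervalIntegrable_sub_rpow_mul_rpow (b := 1) one_pos hc ht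

lemma integral_sub_rpow {c t : ℝ} (hc : 0 < c) (ht : 0 ≤ t) :
    ∫ τ in (0 : ℝ)..t, (t - τ) ^ (c - 1) = t ^ c / c := by
  rcases ht.eq_or_lt with rfl | ht
  · simp [Real.zero_rpow hc.ne']
  have := integral_sub_rpow_mul_rpow (b := 1) one_pos hc ht
  have hG := Real.Gamma_pos_of_pos hc
  simp only [sub_self, Real.rpow_zero, mul_one, add_sub_cancel_left, Real.Gamma_one,
    one_mul] at this
  rw [this, add_comm 1 c, Real.Gamma_add_one hc.ne']
  field_simp

lemma intervalIntegrable_sub_rpow_smul {c t : ℝ} (hc : 0 < c) (ht : 0 ≤ t) {f : ℝ → E}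
    (hf : Continuous f) :
    IntervalIntegrable (fun τ => (t - τ) ^ (c - 1) • f τ) volume 0 t :=
  (intervalIntegrable_sub_rpow hc ht).smul_continuousOn hf.continuousOn

/-- The Riemann–Liouville integral `Γ(β)⁻¹ ∫₀ᵗ (t - s)^(β-1) f(s) ds`. -/
noncomputable def fracIntegral (β : ℝ) (f : ℝ → E) (t : ℝ) : E :=
  (Real.Gamma β)⁻¹ • ∫ s in (0 : ℝ)..t, (t - s) ^ (β - 1) • f s

/-- The semigroup law for fractional integrals of orders `β` and `1 - β`: Fubini on the triangle `τ
< s < t`, after which the integral in `s` is the Beta value `Γ(β) Γ(1-β)`, independent of `τ` and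
`t`. -/
lemma integral_sub_rpow_smul_integral [CompleteSpace E] {β t : ℝ} (hβ0 : 0 < β) (hβ : β < 1)
    (ht : 0 < t) {V : ℝ → E} (hV : Continuous V) :
    ∫ s in (0 : ℝ)..t, (t - s) ^ (β - 1) • ∫ τ in (0 : ℝ)..s, (s - τ) ^ (-β) • V τ =
      (Real.Gamma β * Real.Gamma (1 - β)) • ∫ τ in (0 : ℝ)..t, V τ := by
  obtain ⟨C, hC⟩ := isCompact_Icc.exists_bound_of_continuousOn (s := Set.Icc 0 t) hV.continuousOn
  have hC0 : 0 ≤ C := (norm_nonneg _).trans (hC 0 ⟨le_rfl, ht.le⟩)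
  let ν := volume.restrict (Set.Ioc (0 : ℝ) t)
  let F : ℝ → ℝ → E := fun s τ =>
    (Set.Iio s).indicator (fun τ => ((t - s) ^ (β - 1) * (s - τ) ^ (-β)) • V τ) τ
  have h1β : 0 < 1 - β := by linarith
  have hk : ∀ s ∈ Set.Ioc 0 t, ∀ (g : ℝ → E) , ∫ τ, (Set.Iio s).indicator g τ ∂ν =
      ∫ τ in (0 : ℝ)..s, g τ := by
    intro s hs g
    rw [intervalIntegral.integral_of_le hs.1.le, integral_indicator measurableSet_Iio,
      Measure.restrict_restrict measurableSet_Iio, ← restrict_Ioo_eq_restrict_Ioc]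
    congr 2
    ext τ
    simp only [Set.mem_inter_iff, Set.mem_Iio, Set.mem_Ioc, Set.mem_Ioo]
    constructor
    · rintro ⟨h1, h2, h3⟩; exact ⟨h2, h1⟩
    · rintro ⟨h1, h2⟩; exact ⟨h2, h1, by linarith [hs.2]⟩
  have hkI : ∀ s ∈ Set.Ioc 0 t, ∀ (g : ℝ → ℝ) , IntervalIntegrable g volume 0 s →
      Integrable ((Set.Iio s).indicator g) ν := by
    intro s hs g hg
    rw [integrable_indicator_iff measurableSet_Iio, IntegrableOn,
      Measure.restrict_restrict measurableSet_Iio]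
    refine ((intervalIntegrable_iff_integrableOn_Ioc_of_le hs.1.le).1 hg).mono_set ?_
    rintro τ ⟨h1, h2⟩
    exact ⟨h2.1, le_of_lt h1⟩
  have hFmeas : AEStronglyMeasurable (Function.uncurry F) (ν.prod ν) := by
    have h1 : Function.uncurry F = {p : ℝ × ℝ | p.2 < p.1}.indicator
        (fun p => ((t - p.1) ^ (β - 1) * (p.1 - p.2) ^ (-β)) • V p.2) := by
      ext ⟨s, τ⟩
      simp only [Function.uncurry, F, Set.indicator, Set.mem_Iio, Set.mem_ofPred_eq]
    rw [h1]
    refine AEStronglyMeasurable.indicator ?_ (measurableSet_lt measurable_snd measurable_fst)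
    refine AEStronglyMeasurable.smul ?_ ?_
    · exact (Measurable.aestronglyMeasurable (by fun_prop))
    · exact (hV.comp continuous_snd).aestronglyMeasurable
  -- The scalar majorant with `V` replaced by its bound `C`. Integrating out `τ` leaves `(t-s)^(β-1)
  -- s^(1-β) C/(1-β)`, another Beta integrand; the exponent is written `2 - β - 1` to match that
  -- form.
  have hbound : Integrable (fun p : ℝ × ℝ => (Set.Iio p.1).indicator
      (fun τ => ((t - p.1) ^ (β - 1) * (p.1 - τ) ^ (-β)) * C) p.2) (ν.prod ν) := by
    have hm : Measurable (fun p : ℝ × ℝ => (Set.Iio p.1).indicator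
      (fun τ => ((t - p.1) ^ (β - 1) * (p.1 - τ) ^ (-β)) * C) p.2) := by
      have h1 : (fun p : ℝ × ℝ => (Set.Iio p.1).indicator
        (fun τ => ((t - p.1) ^ (β - 1) * (p.1 - τ) ^ (-β)) * C) p.2) =
          {p : ℝ × ℝ | p.2 < p.1}.indicator
        (fun p => ((t - p.1) ^ (β - 1) * (p.1 - p.2) ^ (-β)) * C) := by
        ext ⟨s, τ⟩
        simp only [Set.indicator, Set.mem_Iio, Set.mem_ofPred_eq]
      rw [h1]
      exact Measurable.indicator (by fun_prop) (measurableSet_lt measurable_snd measurable_fst)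
    rw [integrable_prod_iff hm.aestronglyMeasurable]
    constructor
    · filter_upwards [ae_restrict_mem measurableSet_Ioc] with s hs
      refine hkI s hs _ ?_
      have := intervalIntegrable_sub_rpow (c := 1 - β) (t := s) h1β hs.1.le
      rw [show 1 - β - 1 = -β by ring] at this
      exact (this.const_mul _).mul_const _
    · have : IntegrableOn (fun s => (t - s) ^ (β - 1) * s ^ (2 - β - 1) * (C / (1 - β)))
          (Set.Ioc 0 t) := by
        have := intervalIntegrable_sub_rpow_mul_rpow (b := 2 - β) (by linarith) hβ0 ht
        exact ((intervalIntegrable_iff_integrableOn_Ioc_of_le ht.le).1 this).mul_const _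
      refine this.congr ?_
      filter_upwards [ae_restrict_mem measurableSet_Ioc] with s hs
      have h1 : ∫ τ, ‖(Set.Iio s).indicator
          (fun τ => ((t - s) ^ (β - 1) * (s - τ) ^ (-β)) * C) τ‖ ∂ν =
          ∫ τ, (Set.Iio s).indicator (fun τ => ((t - s) ^ (β - 1) * C) * (s - τ) ^ (1 - β - 1)) τ ∂ν := by
        refine integral_congr_ae (.of_forall fun τ => ?_)
        simp only [Set.indicator, Set.mem_Iio]
        split_ifs with h
        · have h2 : 0 ≤ t - s := by linarith [hs.2]
          have h3 : 0 ≤ s - τ := by linarith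
          rw [Real.norm_of_nonneg (by positivity), show 1 - β - 1 = -β by ring]
          ring
        · simp
      rw [h1, integral_indicator measurableSet_Iio, Measure.restrict_restrict measurableSet_Iio]
      have h2 : Set.Iio s ∩ Set.Ioc 0 t = Set.Ioo 0 s := by
        ext τ
        simp only [Set.mem_inter_iff, Set.mem_Iio, Set.mem_Ioc, Set.mem_Ioo]
        constructor
        · rintro ⟨h1, h2, h3⟩; exact ⟨h2, h1⟩
        · rintro ⟨h1, h2⟩; exact ⟨h2, h1, by linarith [hs.2]⟩
      rw [h2, restrict_Ioo_eq_restrict_Ioc, ← intervalIntegral.integral_of_le hs.1.le,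
        intervalIntegral.integral_const_mul, integral_sub_rpow h1β hs.1.le,
        show 2 - β - 1 = 1 - β by ring]
      ring
  have hFint : Integrable (Function.uncurry F) (ν.prod ν) := by
    refine hbound.mono' hFmeas ?_
    have hmem : ∀ᵐ p ∂(ν.prod ν), p ∈ Set.Ioc 0 t ×ˢ Set.Ioc 0 t := by
      rw [Measure.prod_restrict]
      exact ae_restrict_mem (measurableSet_Ioc.prod measurableSet_Ioc)
    filter_upwards [hmem] with p hp
    obtain ⟨s, τ⟩ := p
    simp only [Function.uncurry, F, Set.indicator, Set.mem_Iio]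
    split_ifs with h
    · have h2 : 0 ≤ t - s := by linarith [hp.1.2]
      have h3 : 0 ≤ s - τ := by linarith
      rw [norm_smul, Real.norm_of_nonneg (by positivity)]
      gcongr
      exact hC τ ⟨hp.2.1.le, hp.2.2⟩
    · simp
  have hswap := integral_integral_swap hFint
  have hL : ∫ s, ∫ τ, F s τ ∂ν ∂ν =
      ∫ s in (0 : ℝ)..t, (t - s) ^ (β - 1) • ∫ τ in (0 : ℝ)..s, (s - τ) ^ (-β) • V τ := by
    rw [intervalIntegral.integral_of_le ht.le]
    refine setIntegral_congr_fun measurableSet_Ioc fun s hs => ?_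
    simp only [F]
    rw [hk s hs, ← intervalIntegral.integral_smul]
    simp only [mul_smul]
  have hR : ∫ τ, ∫ s, F s τ ∂ν ∂ν =
      (Real.Gamma β * Real.Gamma (1 - β)) • ∫ τ in (0 : ℝ)..t, V τ := by
    have hν : ν = volume.restrict (Set.Ioo 0 t) := restrict_Ioo_eq_restrict_Ioc.symm
    rw [hν, intervalIntegral.integral_of_le ht.le, ← integral_smul, integral_Ioc_eq_integral_Ioo]
    refine setIntegral_congr_fun (s := Set.Ioo 0 t) measurableSet_Ioo fun τ hτ => ?_
    have h1 : ∀ s, F s τ = (Set.Ioi τ).indicator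
        (fun s => ((t - s) ^ (β - 1) * (s - τ) ^ (-β)) • V τ) s := fun s => by
      simp only [F, Set.indicator, Set.mem_Iio, Set.mem_Ioi]
    have h2 : Set.Ioi τ ∩ Set.Ioo 0 t = Set.Ioo τ t := by
      ext s
      simp only [Set.mem_inter_iff, Set.mem_Ioi, Set.mem_Ioo]
      constructor
      · rintro ⟨h1, h2, h3⟩; exact ⟨h1, h3⟩
      · rintro ⟨h1, h2⟩; exact ⟨h1, by linarith [hτ.1], h2⟩
    have h3 : ∫ s in τ..t, (t - s) ^ (β - 1) * (s - τ) ^ (-β) =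
        Real.Gamma β * Real.Gamma (1 - β) := by
      have h4 := intervalIntegral.integral_comp_add_right (a := 0) (b := t - τ)
        (fun s => (t - s) ^ (β - 1) * (s - τ) ^ (-β)) τ
      rw [zero_add, sub_add_cancel] at h4
      rw [← h4]
      have h5 := integral_sub_rpow_mul_rpow (b := 1 - β) (c := β) (t := t - τ) h1β hβ0
        (by linarith [hτ.2])
      simp only [sub_add_cancel, sub_self, Real.rpow_zero, Real.Gamma_one, div_one, one_mul,
        show 1 - β - 1 = -β by ring] at h5
      rw [mul_comm (Real.Gamma β), ← h5]
      refine intervalIntegral.integral_congr fun σ _ => ?_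
      simp only [add_sub_cancel_right]
      rw [show t - (σ + τ) = t - τ - σ by ring]
    simp only [h1]
    rw [integral_indicator measurableSet_Ioi, Measure.restrict_restrict measurableSet_Ioi, h2,
      restrict_Ioo_eq_restrict_Ioc, ← intervalIntegral.integral_of_le hτ.2.le,
      intervalIntegral.integral_smul_const, h3]
  rw [← hL, ← hR, hswap]

lemma norm_integral_sub_rpow_smul_le {c t C : ℝ} (hc : 0 < c) (ht : 0 ≤ t) {f : ℝ → E}
    (hf : ∀ s ∈ Set.Icc 0 t, ‖f s‖ ≤ C) :
    ‖∫ s in (0 : ℝ)..t, (t - s) ^ (c - 1) • f s‖ ≤ t ^ c / c * C := by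
  rw [← integral_sub_rpow hc ht, ← intervalIntegral.integral_mul_const]
  refine intervalIntegral.norm_integral_le_of_norm_le ht (.of_forall fun s hs => ?_)
    ((intervalIntegrable_sub_rpow hc ht).mul_const _)
  have : 0 ≤ t - s := by linarith [hs.2]
  rw [norm_smul, Real.norm_of_nonneg (by positivity)]
  gcongr
  exact hf s ⟨hs.1.le, hs.2⟩

lemma tendsto_integral_sub_rpow_smul {c : ℝ} (hc : 0 < c) {f : ℝ → E} (hf : Continuous f) :
    Tendsto (fun t => ∫ s in (0 : ℝ)..t, (t - s) ^ (c - 1) • f s) (𝓝[≥] 0) (𝓝 0) := by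
  obtain ⟨C, hC⟩ := isCompact_Icc.exists_bound_of_continuousOn (s := Set.Icc 0 1) hf.continuousOn
  have h : Tendsto (fun t : ℝ => t ^ c / c * C) (𝓝[≥] 0) (𝓝 0) := by
    have : Tendsto (fun t : ℝ => t ^ c / c * C) (𝓝 0) (𝓝 (0 ^ c / c * C)) :=
      (((Real.continuous_rpow_const hc.le).div_const c).mul_const C).tendsto 0
    rw [Real.zero_rpow hc.ne', zero_div, zero_mul] at this
    exact this.mono_left nhdsWithin_le_nhds
  refine squeeze_zero_norm' ?_ h
  filter_upwards [Icc_mem_nhdsGE one_pos] with t ht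
  exact norm_integral_sub_rpow_smul_le hc ht.1 fun s hs => hC s ⟨hs.1, hs.2.trans ht.2⟩

/-- An equation of order `β` in integrated form. -/
lemma integral_eq_of_hasTimeDerivAt [CompleteSpace E] {β : ℝ} (hβ : β ∈ Set.Ioc (0 : ℝ) 1)
    {V G : ℝ → E} (hV : Continuous V) (hG : Continuous G)
    (hder : ∀ t, 0 < t → HasTimeDerivAt β V (G t) t) {t : ℝ} (ht : 0 < t) :
    ∫ s in (0 : ℝ)..t, V s =
      t • V 0 + fracIntegral β (fun s => ∫ τ in (0 : ℝ)..s, G τ) t := by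
  obtain ⟨hβ0, hβ1⟩ := hβ
  have hGc : Continuous fun s => ∫ τ in (0 : ℝ)..s, G τ :=
    intervalIntegral.continuous_primitive (fun a b => hG.intervalIntegrable a b) 0
  rcases hβ1.eq_or_lt with rfl | hβ1
  · have hd : ∀ t, 0 < t → HasDerivAt V (G t) t := fun t ht => by
      rcases hder t ht with h | h
      · exact h.2
      · exact absurd h.1 (lt_irrefl _)
    have h1 : ∀ s, 0 ≤ s → V s = V 0 + ∫ τ in (0 : ℝ)..s, G τ := fun s hs => by
      rw [intervalIntegral.integral_eq_sub_of_hasDerivAt_of_le hs hV.continuousOn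
        (fun x hx => hd x hx.1) (hG.intervalIntegrable _ _)]
      abel
    have h2 : ∫ s in (0 : ℝ)..t, V s = ∫ s in (0 : ℝ)..t, (V 0 + ∫ τ in (0 : ℝ)..s, G τ) :=
      intervalIntegral.integral_congr fun s hs => h1 s (by
        rw [Set.uIcc_of_le ht.le] at hs; exact hs.1)
    rw [h2, intervalIntegral.integral_add (intervalIntegrable_const)
      (hGc.intervalIntegrable _ _), intervalIntegral.integral_const, fracIntegral]
    simp
  have hΓ : 0 < Real.Gamma (1 - β) := Real.Gamma_pos_of_pos (by linarith)
  have hΓ' : 0 < Real.Gamma β := Real.Gamma_pos_of_pos hβ0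
  have h1β : 0 < 1 - β := by linarith
  set J : ℝ → E := fun s => ∫ τ in (0 : ℝ)..s, ((s - τ) ^ (-β)) • V τ with hJ
  have hd : ∀ t, 0 < t → HasDerivAt J (t ^ (-β) • V 0 + Real.Gamma (1 - β) • G t) t := by
    intro t ht
    rcases hder t ht with h | ⟨_, D, hD, h⟩
    · linarith [h.1]
    · convert hD using 1
      rw [h, smul_inv_smul₀ hΓ.ne']
      abel
  have hJt : Tendsto J (𝓝[≥] 0) (𝓝 0) := by
    have := tendsto_integral_sub_rpow_smul h1β hV
    rwa [show 1 - β - 1 = -β by ring] at this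
  have hJ0 : J 0 = 0 := by simp [hJ]
  have hpow : ∀ s, 0 ≤ s → IntervalIntegrable (fun τ : ℝ => τ ^ (-β)) volume 0 s := fun s _ =>
    intervalIntegral.intervalIntegrable_rpow' (by linarith)
  -- The derivative of `J` is known only for positive times; continuity at 0 with `J 0 = 0` lets the
  -- fundamental theorem of calculus start from 0.
  have hJs : ∀ s, 0 ≤ s → J s = (s ^ (1 - β) / (1 - β)) • V 0 +
      Real.Gamma (1 - β) • ∫ τ in (0 : ℝ)..s, G τ := by
    intro s hs
    have hc : ContinuousOn J (Set.Icc 0 s) := by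
      intro x hx
      rcases hx.1.eq_or_lt with rfl | hx0
      · refine ContinuousWithinAt.mono ?_ Set.Icc_subset_Ici_self
        rw [ContinuousWithinAt, hJ0]
        exact hJt
      · exact (hd x hx0).continuousAt.continuousWithinAt
    have h1 : IntervalIntegrable (fun τ : ℝ => τ ^ (-β) • V 0) volume 0 s :=
      (hpow s hs).smul_continuousOn continuousOn_const
    have h2 : IntervalIntegrable (fun τ : ℝ => Real.Gamma (1 - β) • G τ) volume 0 s :=
      (hG.const_smul _).intervalIntegrable _ _
    have := intervalIntegral.integral_eq_sub_of_hasDerivAt_of_le hs hc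
      (fun x hx => hd x hx.1) (h1.add h2)
    rw [hJ0, sub_zero, intervalIntegral.integral_add h1 h2, intervalIntegral.integral_smul_const,
      intervalIntegral.integral_smul, integral_rpow (Or.inl (by linarith))] at this
    rw [← this, show -β + 1 = 1 - β by ring, Real.zero_rpow h1β.ne', sub_zero]
  -- Fractional integration of order `β` is now applied to both sides of `hJs`. It turns `J` into a
  -- multiple of the primitive of `V`, which is why the conclusion concerns that primitive and not
  -- `V` itself.
  have key := integral_sub_rpow_smul_integral hβ0 hβ1 ht hV
  have h3 : ∫ s in (0 : ℝ)..t, (t - s) ^ (β - 1) • ∫ τ in (0 : ℝ)..s, (s - τ) ^ (-β) • V τ =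
      ∫ s in (0 : ℝ)..t, (((t - s) ^ (β - 1) * s ^ (2 - β - 1)) • ((1 - β)⁻¹ • V 0) +
        Real.Gamma (1 - β) • ((t - s) ^ (β - 1) • ∫ τ in (0 : ℝ)..s, G τ)) := by
    refine intervalIntegral.integral_congr fun s hs => ?_
    rw [Set.uIcc_of_le ht.le] at hs
    have := hJs s hs.1
    simp only [hJ] at this
    rw [this, smul_add, smul_comm (Real.Gamma (1 - β)), smul_smul _ (1 - β)⁻¹, smul_smul _ _ (V 0),
      show 2 - β - 1 = 1 - β by ring, div_eq_mul_inv, mul_assoc]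
  have h4 := integral_sub_rpow_mul_rpow (b := 2 - β) (by linarith) hβ0 ht
  rw [h3, intervalIntegral.integral_add
    ((intervalIntegrable_sub_rpow_mul_rpow (by linarith) hβ0 ht).smul_continuousOn continuousOn_const)
    (show IntervalIntegrable (fun s => Real.Gamma (1 - β) • ((t - s) ^ (β - 1) •
      ∫ τ in (0 : ℝ)..s, G τ)) volume 0 t from
      (intervalIntegrable_sub_rpow_smul hβ0 ht.le hGc).smul _),
    intervalIntegral.integral_smul_const, intervalIntegral.integral_smul, h4,
    show 2 - β + β - 1 = (1 : ℝ) by ring, show 2 - β + β = (2 : ℝ) by ring, Real.Gamma_two,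
    Real.rpow_one, show 2 - β = (1 - β) + 1 by ring, Real.Gamma_add_one h1β.ne', div_one,
    smul_smul] at key
  have h5 : (t * ((1 - β) * Real.Gamma (1 - β) * Real.Gamma β)) * (1 - β)⁻¹ =
      (Real.Gamma β * Real.Gamma (1 - β)) * t := by
    field_simp
  rw [h5] at key
  have h6 : Real.Gamma (1 - β) • ∫ s in (0 : ℝ)..t, (t - s) ^ (β - 1) • ∫ τ in (0 : ℝ)..s, G τ =
      (Real.Gamma β * Real.Gamma (1 - β)) •
        fracIntegral β (fun s => ∫ τ in (0 : ℝ)..s, G τ) t := by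
    rw [fracIntegral, smul_smul]
    congr 1
    field_simp
  rw [h6, mul_smul, ← smul_add] at key
  exact (smul_right_injective E (mul_pos hΓ' hΓ).ne' key).symm

lemma fracIntegral_rpow_smul [CompleteSpace E] {β b t : ℝ} (hβ : 0 < β) (hb : 0 < b) (ht : 0 < t)
    (v : E) :
    fracIntegral β (fun s => (s ^ (b - 1) / Real.Gamma b) • v) t =
      (t ^ (b + β - 1) / Real.Gamma (b + β)) • v := by
  have hG := Real.Gamma_pos_of_pos hβ
  have hG' := Real.Gamma_pos_of_pos hb
  rw [fracIntegral]
  simp only [smul_smul, mul_div_assoc', intervalIntegral.integral_smul_const]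
  rw [intervalIntegral.integral_div, integral_sub_rpow_mul_rpow hb hβ ht]
  congr 1
  field_simp

/-- With the normalisation `s^(b-1) / Γ(b)`, fractional integration moves `b` to `b + β` and leaves
`C` unchanged, so iterating it `N` times accumulates no constants. -/
lemma norm_fracIntegral_le {β b t C : ℝ} (hβ : 0 < β) (hb : 0 < b) (ht : 0 < t) {f : ℝ → E}
    (hf : ∀ s ∈ Set.Ioc 0 t, ‖f s‖ ≤ C * (s ^ (b - 1) / Real.Gamma b)) :
    ‖fracIntegral β f t‖ ≤ C * (t ^ (b + β - 1) / Real.Gamma (b + β)) := by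
  have hG := Real.Gamma_pos_of_pos hβ
  have hG' := Real.Gamma_pos_of_pos hb
  have h1 : ‖∫ s in (0 : ℝ)..t, (t - s) ^ (β - 1) • f s‖ ≤
      ∫ s in (0 : ℝ)..t, (C / Real.Gamma b) * ((t - s) ^ (β - 1) * s ^ (b - 1)) := by
    refine intervalIntegral.norm_integral_le_of_norm_le ht.le (.of_forall fun s hs => ?_)
      ((intervalIntegrable_sub_rpow_mul_rpow hb hβ ht).const_mul _)
    have : 0 ≤ t - s := by linarith [hs.2]
    rw [norm_smul, Real.norm_of_nonneg (by positivity)]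
    calc (t - s) ^ (β - 1) * ‖f s‖ ≤ (t - s) ^ (β - 1) * (C * (s ^ (b - 1) / Real.Gamma b)) := by
          gcongr; exact hf s hs
      _ = _ := by ring
  rw [intervalIntegral.integral_const_mul, integral_sub_rpow_mul_rpow hb hβ ht] at h1
  rw [fracIntegral, norm_smul, norm_inv, Real.norm_of_nonneg hG.le]
  calc (Real.Gamma β)⁻¹ * ‖∫ s in (0 : ℝ)..t, (t - s) ^ (β - 1) • f s‖ ≤ (Real.Gamma β)⁻¹ *
      (C / Real.Gamma b * (t ^ (b + β - 1) * (Real.Gamma b * Real.Gamma β / Real.Gamma (b + β)))) := by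
        gcongr
    _ = _ := by field_simp

/-- The solution of a chain of equations of order `β` is given by its Mittag-Leffler series;
version for functions continuous on the whole line. -/
lemma hasSum_of_hasTimeDerivAt_of_continuous [CompleteSpace E] {β μ : ℝ}
    (hβ : β ∈ Set.Ioc (0 : ℝ) 1) {V : ℕ → ℝ → E} (hV : ∀ k, Continuous (V k))
    (hder : ∀ k t, 0 < t → HasTimeDerivAt β (V k) (-μ • V (k + 1) t) t) {T C M : ℝ}
    (hC : 0 ≤ C) (hM : 0 ≤ M) (hbd : ∀ k, ∀ t ∈ Set.Icc 0 T, ‖V k t‖ ≤ C * M ^ k)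
    {t : ℝ} (ht : t ∈ Set.Ioo 0 T) :
    HasSum (fun k : ℕ => ((-μ * t ^ β) ^ k / Real.Gamma (1 + β * k)) • V k 0) (V 0 t) := by
  have hβ0 := hβ.1
  have hT : 0 < T := ht.1.trans ht.2
  have hWc : ∀ k, Continuous fun s => ∫ τ in (0 : ℝ)..s, V k τ := fun k =>
    intervalIntegral.continuous_primitive (fun a b => (hV k).intervalIntegrable a b) 0
  -- the recurrence for the primitives
  have hrec : ∀ k t, 0 < t → ∫ s in (0 : ℝ)..t, V k s =
      t • V k 0 + (-μ) • fracIntegral β (fun s => ∫ τ in (0 : ℝ)..s, V (k + 1) τ) t := by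
    intro k t ht
    rw [integral_eq_of_hasTimeDerivAt hβ (hV k) ((hV (k + 1)).const_smul (-μ)) (hder k) ht]
    congr 1
    simp only [fracIntegral, Pi.smul_apply, intervalIntegral.integral_smul]
    rw [smul_comm (-μ), ← intervalIntegral.integral_smul (-μ)]
    congr 1
    exact intervalIntegral.integral_congr fun s _ => smul_comm _ _ _
  -- The first `N` terms of the primitive of the Mittag-Leffler series started at `V k`. Passing to
  -- primitives replaces the `1 + β j` of the series by `2 + β j`.
  let P : ℕ → ℕ → ℝ → E := fun N k t => ∑ j ∈ Finset.range N,
    (-μ) ^ j • (t ^ (2 + β * j - 1) / Real.Gamma (2 + β * j)) • V (k + j) 0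
  -- Each use of the recurrence peels off one term and moves the error to `V (k + 1)` under one more
  -- fractional integral, hence the induction on `N` with `k` arbitrary. The factor `T` comes from
  -- the crude bound on the primitive when `N = 0`.
  have hest : ∀ N k, ∀ t ∈ Set.Ioc 0 T, ‖(∫ s in (0 : ℝ)..t, V k s) - P N k t‖ ≤
      (T * C * M ^ (k + N) * |μ| ^ N) * (t ^ (1 + β * N - 1) / Real.Gamma (1 + β * N)) := by
    intro N
    induction N with
    | zero =>
      intro k t ht
      have h1 : ‖∫ s in (0 : ℝ)..t, V k s‖ ≤ (C * M ^ k) * |t - 0| :=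
        intervalIntegral.norm_integral_le_of_norm_le_const fun s hs => by
          rw [Set.uIoc_of_le ht.1.le] at hs
          exact hbd k s ⟨hs.1.le, hs.2.trans ht.2⟩
      simp only [P, Finset.range_zero, Finset.sum_empty, sub_zero, add_zero, pow_zero, mul_one,
        CharP.cast_eq_zero, mul_zero, sub_self, Real.rpow_zero, Real.Gamma_one, div_one]
      rw [sub_zero, abs_of_pos ht.1] at h1
      refine h1.trans ?_
      rw [mul_comm, ← mul_assoc]
      gcongr
      exact ht.2
    | succ N ih =>
      intro k t ht
      have hPc : ∀ j : ℕ, Continuous fun s : ℝ =>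
          (-μ) ^ j • (s ^ (2 + β * j - 1) / Real.Gamma (2 + β * j)) • V (k + 1 + j) 0 := by
        intro j
        have : 0 ≤ 2 + β * j - 1 := by
          have : 0 ≤ β * j := by positivity
          linarith
        exact (((Real.continuous_rpow_const this).div_const _).smul continuous_const).const_smul _
      have hP : P (N + 1) k t = t • V k 0 + (-μ) • fracIntegral β (P N (k + 1)) t := by
        have h1 : fracIntegral β (P N (k + 1)) t = ∑ j ∈ Finset.range N,
            (-μ) ^ j • (t ^ (2 + β * j + β - 1) / Real.Gamma (2 + β * j + β)) •
              V (k + 1 + j) 0 := by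
          simp only [fracIntegral, P, Finset.smul_sum]
          rw [intervalIntegral.integral_finsetSum fun j _ =>
            intervalIntegrable_sub_rpow_smul hβ0 ht.1.le (hPc j), Finset.smul_sum]
          refine Finset.sum_congr rfl fun j _ => ?_
          rw [← fracIntegral_rpow_smul hβ0 (by positivity) ht.1, fracIntegral,
            smul_comm ((-μ) ^ j), ← intervalIntegral.integral_smul ((-μ) ^ j)]
          simp only [smul_comm ((-μ) ^ j)]
        rw [h1]
        simp only [P]
        rw [Finset.sum_range_succ', Finset.smul_sum, add_comm]
        congr 1
        · simp only [pow_zero, CharP.cast_eq_zero, mul_zero, add_zero, one_smul, Real.Gamma_two,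
            div_one, show (2 : ℝ) - 1 = 1 by norm_num, Real.rpow_one]
        · refine Finset.sum_congr rfl fun j _ => ?_
          rw [smul_smul (-μ), ← pow_succ']
          push_cast
          rw [show 2 + β * ((j : ℝ) + 1) = 2 + β * j + β by ring, add_assoc k 1 j, add_comm 1 j]
      have hsub : (∫ s in (0 : ℝ)..t, V k s) - P (N + 1) k t =
          (-μ) • fracIntegral β (fun s => (∫ τ in (0 : ℝ)..s, V (k + 1) τ) - P N (k + 1) s) t := by
        rw [hrec k t ht.1, hP, add_sub_add_left_eq_sub, ← smul_sub]
        congr 1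
        simp only [fracIntegral, ← smul_sub]
        rw [← intervalIntegral.integral_sub
          (intervalIntegrable_sub_rpow_smul hβ0 ht.1.le (hWc (k + 1)))
          (intervalIntegrable_sub_rpow_smul hβ0 ht.1.le
            (continuous_finsetSum _ fun j _ => hPc j))]
        simp only [smul_sub, P]
      rw [hsub, norm_smul, norm_neg, Real.norm_eq_abs]
      have h2 := norm_fracIntegral_le hβ0 (b := 1 + β * N) (by positivity) ht.1
        (f := fun s => (∫ τ in (0 : ℝ)..s, V (k + 1) τ) - P N (k + 1) s)
        (C := T * C * M ^ (k + 1 + N) * |μ| ^ N)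
        (fun s hs => ih (k + 1) s ⟨hs.1, hs.2.trans ht.2⟩)
      calc |μ| * ‖fracIntegral β
            (fun s => (∫ τ in (0 : ℝ)..s, V (k + 1) τ) - P N (k + 1) s) t‖
          ≤ |μ| * (T * C * M ^ (k + 1 + N) * |μ| ^ N *
            (t ^ (1 + β * N + β - 1) / Real.Gamma (1 + β * N + β))) := by gcongr
        _ = _ := by
          push_cast
          rw [show 1 + β * ((N : ℝ) + 1) = 1 + β * N + β by ring,
            show k + (N + 1) = k + 1 + N by ring]
          ring
  -- The error is `T C` times the `N`-th term of the convergent series `E_β(M |μ| t^β)`.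
  have hlim : ∀ t ∈ Set.Ioo 0 T,
      Tendsto (fun N => P N 0 t) atTop (𝓝 (∫ s in (0 : ℝ)..t, V 0 s)) := by
    intro t ht
    rw [tendsto_iff_norm_sub_tendsto_zero]
    have hs := ((summable_mittagLeffler₂ hβ0 one_pos (M * |μ| * t ^ β)).mul_left
      (T * C)).tendsto_atTop_zero
    refine squeeze_zero (fun _ => norm_nonneg _) (fun N => ?_) hs
    rw [norm_sub_rev]
    refine (hest N 0 t ⟨ht.1, ht.2.le⟩).trans (le_of_eq ?_)
    rw [zero_add, add_sub_cancel_left, Real.rpow_mul ht.1.le, Real.rpow_natCast, mul_pow, mul_pow]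
    ring
  -- the series itself
  let f : ℕ → ℝ → E := fun k s => ((-μ * s ^ β) ^ k / Real.Gamma (1 + β * k)) • V k 0
  have hfc : ∀ k, Continuous (f k) := fun k =>
    (((continuous_const.mul (Real.continuous_rpow_const hβ0.le)).pow k).div_const _).smul
      continuous_const
  have hfb : ∀ k, ∀ s ∈ Set.Icc 0 T, ‖f k s‖ ≤
      C * ((M * |μ| * T ^ β) ^ k / Real.Gamma (1 + β * k)) := by
    intro k s hs
    have hG := Gamma_add_mul_pos hβ0 one_pos k
    have hs0 := hs.1
    rw [norm_smul, norm_div, norm_pow, norm_mul, norm_neg, Real.norm_of_nonneg hG.le,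
      Real.norm_eq_abs, Real.norm_of_nonneg (by positivity)]
    calc (|μ| * s ^ β) ^ k / Real.Gamma (1 + β * k) * ‖V k 0‖
        ≤ (|μ| * T ^ β) ^ k / Real.Gamma (1 + β * k) * (C * M ^ k) := by
          gcongr
          · exact hs.2
          · exact hbd k 0 ⟨le_rfl, hT.le⟩
      _ = _ := by rw [mul_pow, mul_pow, mul_pow]; ring
  have hsumb : Summable fun k : ℕ => C * ((M * |μ| * T ^ β) ^ k / Real.Gamma (1 + β * k)) :=
    (summable_mittagLeffler₂ hβ0 one_pos _).mul_left _
  have hSc : ContinuousOn (fun s => ∑' k, f k s) (Set.Icc 0 T) :=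
    continuousOn_tsum (fun k => (hfc k).continuousOn) hsumb hfb
  have hint : ∀ t ∈ Set.Ioo 0 T, ∫ s in (0 : ℝ)..t, V 0 s = ∫ s in (0 : ℝ)..t, ∑' k, f k s := by
    intro t ht
    have hIcc : Set.Icc 0 t ⊆ Set.Icc 0 T := Set.Icc_subset_Icc_right ht.2.le
    have h1 : HasSum (fun k => ∫ s in (0 : ℝ)..t, f k s) (∫ s in (0 : ℝ)..t, ∑' k, f k s) := by
      refine intervalIntegral.hasSum_integral_of_dominated_convergence
        (fun k _ => C * ((M * |μ| * T ^ β) ^ k / Real.Gamma (1 + β * k)))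
        (fun k => (hfc k).aestronglyMeasurable) (fun k => .of_forall fun s hs => ?_)
        (.of_forall fun _ _ => hsumb) intervalIntegrable_const (.of_forall fun s hs => ?_)
      · rw [Set.uIoc_of_le ht.1.le] at hs
        exact hfb k s (hIcc ⟨hs.1.le, hs.2⟩)
      · rw [Set.uIoc_of_le ht.1.le] at hs
        exact (Summable.of_norm_bounded hsumb
          fun k => hfb k s (hIcc ⟨hs.1.le, hs.2⟩)).hasSum
    refine tendsto_nhds_unique (hlim t ht) (h1.tendsto_sum_nat.congr fun N => ?_)
    refine Finset.sum_congr rfl fun k _ => ?_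
    have h0 : 0 ≤ β * k := by positivity
    have hG := Real.Gamma_add_one (s := 1 + β * k) (by positivity)
    rw [show 1 + β * k + 1 = 2 + β * (k : ℝ) by ring] at hG
    have hGp := Gamma_add_mul_pos hβ0 one_pos k
    simp only [f, zero_add, intervalIntegral.integral_smul_const, mul_pow]
    rw [smul_smul, intervalIntegral.integral_div, intervalIntegral.integral_const_mul]
    have h3 : ∫ s in (0 : ℝ)..t, (s ^ β) ^ k = t ^ (2 + β * k - 1) / (1 + β * k) := by
      have : ∀ s ∈ Set.uIcc 0 t, (s ^ β) ^ k = s ^ (β * k) := fun s hs => by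
        rw [Set.uIcc_of_le ht.1.le] at hs
        rw [Real.rpow_mul hs.1, Real.rpow_natCast]
      rw [intervalIntegral.integral_congr this, integral_rpow (Or.inl (by linarith)),
        Real.zero_rpow (by positivity), sub_zero]
      rw [show 2 + β * (k : ℝ) - 1 = β * k + 1 by ring, add_comm 1]
    rw [h3, hG]
    congr 1
    field_simp
  -- The primitives of `V 0` and of the series agree near `t`, and both integrands are continuous at
  -- `t`; differentiating identifies them there.
  have hd1 : HasDerivAt (fun t => ∫ s in (0 : ℝ)..t, V 0 s) (V 0 t) t :=
    (hV 0).integral_hasStrictDerivAt 0 t |>.hasDerivAt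
  have hnhds : Set.Icc 0 T ∈ 𝓝 t := Icc_mem_nhds ht.1 ht.2
  have hd2 : HasDerivAt (fun t => ∫ s in (0 : ℝ)..t, ∑' k, f k s) (∑' k, f k t) t := by
    refine intervalIntegral.integral_hasDerivAt_right ?_ ?_ (hSc.continuousAt hnhds)
    · refine (hSc.mono ?_).intervalIntegrable
      rw [Set.uIcc_of_le ht.1.le]
      exact Set.Icc_subset_Icc_right ht.2.le
    · exact ⟨Set.Icc 0 T, hnhds, hSc.aestronglyMeasurable measurableSet_Icc⟩
  have heq : (fun t => ∫ s in (0 : ℝ)..t, V 0 s) =ᶠ[𝓝 t]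
      fun t => ∫ s in (0 : ℝ)..t, ∑' k, f k s := by
    filter_upwards [Ioo_mem_nhds ht.1 ht.2] with s hs using hint s hs
  have hfin := hd1.unique (hd2.congr_of_eventuallyEq heq)
  rw [hfin]
  exact (Summable.of_norm_bounded hsumb fun k => hfb k t ⟨ht.1.le, ht.2.le⟩).hasSum

/-- The solution of a chain of equations of order `β` is given by its Mittag-Leffler series. -/
theorem hasSum_of_hasTimeDerivAt [CompleteSpace E] {β μ : ℝ}
    (hβ : β ∈ Set.Ioc (0 : ℝ) 1) {V : ℕ → ℝ → E} (hV : ∀ k, ContinuousOn (V k) (Set.Ici 0))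
    (hder : ∀ k t, 0 < t → HasTimeDerivAt β (V k) (-μ • V (k + 1) t) t) {T C M : ℝ}
    (hC : 0 ≤ C) (hM : 0 ≤ M) (hbd : ∀ k, ∀ t ∈ Set.Icc 0 T, ‖V k t‖ ≤ C * M ^ k)
    {t : ℝ} (ht : t ∈ Set.Ioo 0 T) :
    HasSum (fun k : ℕ => ((-μ * t ^ β) ^ k / Real.Gamma (1 + β * k)) • V k 0) (V 0 t) := by
  -- Extension by a constant to negative times. The equation is unaffected, since it only involves
  -- values on `[0, s]` and neighbourhoods of positive times.
  let V' : ℕ → ℝ → E := fun k s => V k (max s 0)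
  have hV' : ∀ k s, 0 ≤ s → V' k s = V k s := fun k s hs => by simp only [V', max_eq_left hs]
  have hc : ∀ k, Continuous (V' k) := fun k =>
    (hV k).comp_continuous (continuous_id.max continuous_const) fun s => Set.mem_Ici.2 (le_max_right _ _)
  have hd : ∀ k t, 0 < t → HasTimeDerivAt β (V' k) (-μ • V' (k + 1) t) t := by
    intro k t ht
    rw [hV' _ t ht.le]
    rcases hder k t ht with ⟨h1, h2⟩ | ⟨h1, D, h2, h3⟩
    · refine Or.inl ⟨h1, h2.congr_of_eventuallyEq ?_⟩
      filter_upwards [lt_mem_nhds ht] with s hs using hV' k s hs.le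
    · refine Or.inr ⟨h1, D, h2.congr_of_eventuallyEq ?_, ?_⟩
      · filter_upwards [lt_mem_nhds ht] with s hs
        refine intervalIntegral.integral_congr fun τ hτ => ?_
        rw [Set.uIcc_of_le hs.le] at hτ
        simp only [hV' k τ hτ.1]
      · rw [hV' k 0 le_rfl, h3]
  have := hasSum_of_hasTimeDerivAt_of_continuous hβ hc hd hC hM
    (fun k s hs => by rw [hV' k s hs.1]; exact hbd k s hs) ht
  simpa only [hV' _ t ht.1.le, hV' _ 0 le_rfl] using this

end Fractional

section FourierTransform

open scoped SchwartzMap ContDiff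

/-! ### Plancherel's identity for integrable square-integrable functions -/

lemma continuous_fourier {h : ℝ → ℂ} (h1 : Integrable h) : Continuous (𝓕 h) :=
  VectorFourier.fourierIntegral_continuous Real.continuous_fourierChar
    (by exact continuous_inner) h1

lemma integral_fourier_mul {f g : ℝ → ℂ} (hf : Integrable f) (hg : Integrable g) :
    ∫ ξ, 𝓕 f ξ * g ξ = ∫ x, f x * 𝓕 g x := by
  have := VectorFourier.integral_fourierIntegral_smul_eq_flip (L := innerₗ ℝ)
    (μ := (volume : Measure ℝ)) (ν := (volume : Measure ℝ))
    Real.continuous_fourierChar (by exact continuous_inner) hf hg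
  rw [flip_innerₗ] at this
  exact this

/-- The `L²` transform and the integral transform define the same distribution: against a smooth
compactly supported function both reduce to the transform of the test function paired with `h`. -/
lemma fourier_toLp_ae_eq {h : ℝ → ℂ} (h1 : Integrable h) (h2 : MemLp h 2) :
    (𝓕 (h2.toLp h) : Lp ℂ 2 (volume : Measure ℝ)) =ᵐ[volume] 𝓕 h := by
  have hc : Continuous (𝓕 h) := continuous_fourier h1
  refine ae_eq_of_integral_contDiff_smul_eq ?_ hc.locallyIntegrable ?_
  · exact ((Lp.memLp _).locallyIntegrable (by norm_num))
  intro g hg hgc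
  let G : 𝓢(ℝ, ℂ) := HasCompactSupport.toSchwartzMap (f := fun x => (g x : ℂ))
    (hgc.comp_left (g := fun x : ℝ => (x : ℂ)) (by simp)) (Complex.ofRealCLM.contDiff.comp hg)
  have h3 := congrArg (fun T : 𝓢'(ℝ, ℂ) => T G)
    (Lp.fourier_toTemperedDistribution_eq (h2.toLp h))
  simp only [TemperedDistribution.fourier_apply, Lp.toTemperedDistribution_apply] at h3
  have hG : ∀ x, G x = (g x : ℂ) := fun x => rfl
  calc ∫ x, g x • (𝓕 (h2.toLp h) : Lp ℂ 2 (volume : Measure ℝ)) x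
      = ∫ x, G x • (𝓕 (h2.toLp h) : Lp ℂ 2 (volume : Measure ℝ)) x := by
        simp only [hG, Complex.real_smul, smul_eq_mul]
    _ = ∫ x, (𝓕 G) x • (h2.toLp h) x := h3.symm
    _ = ∫ x, 𝓕 (G : ℝ → ℂ) x * h x := by
        refine integral_congr_ae ?_
        filter_upwards [h2.coeFn_toLp] with x hx
        rw [hx, smul_eq_mul, SchwartzMap.fourier_coe]
    _ = ∫ x, G x * 𝓕 h x := integral_fourier_mul G.integrable h1
    _ = ∫ x, g x • 𝓕 h x := by simp only [hG, Complex.real_smul]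

lemma memLp_fourier {h : ℝ → ℂ} (h1 : Integrable h) (h2 : MemLp h 2) : MemLp (𝓕 h) 2 :=
  (memLp_congr_ae (fourier_toLp_ae_eq h1 h2)).1 (Lp.memLp _)

lemma integral_norm_sq_eq_norm_toLp {h : ℝ → ℂ} (h2 : MemLp h 2) :
    ∫ x, ‖h x‖ ^ 2 = ‖h2.toLp h‖ ^ 2 := by
  rw [← inner_self_eq_norm_sq (𝕜 := ℂ), L2.inner_def, ← integral_re]
  · refine integral_congr_ae ?_
    filter_upwards [h2.coeFn_toLp] with x hx
    rw [hx, inner_self_eq_norm_sq (𝕜 := ℂ)]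
  · exact L2.integrable_inner _ _

lemma integral_norm_sq_fourier {h : ℝ → ℂ} (h1 : Integrable h) (h2 : MemLp h 2) :
    ∫ x, ‖𝓕 h x‖ ^ 2 = ∫ x, ‖h x‖ ^ 2 := by
  rw [integral_norm_sq_eq_norm_toLp h2, integral_norm_sq_eq_norm_toLp (memLp_fourier h1 h2),
    ← Lp.norm_fourier_eq (h2.toLp h)]
  congr 2
  refine Lp.ext ?_
  exact ((memLp_fourier h1 h2).coeFn_toLp).trans (fourier_toLp_ae_eq h1 h2).symm

/-! ### Integrability of inverse Fourier transforms of even multipliers -/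

/-- The Fourier transform of an even function as a cosine integral. -/
lemma fourier_even {m : ℝ → ℝ} (hm : ∀ x, m (-x) = m x) (hmi : Integrable m) (y : ℝ) :
    𝓕 (fun x => (m x : ℂ)) y =
      ((2 * ∫ x in Set.Ioi (0 : ℝ), m x * Real.cos (2 * Real.pi * x * y) : ℝ) : ℂ) := by
  have hI1 : Integrable fun x : ℝ => m x * Real.cos (2 * Real.pi * x * y) :=
    hmi.mul_bdd (c := 1) (Continuous.aestronglyMeasurable (by fun_prop))
      (.of_forall fun x => Real.abs_cos_le_one _)
  have hI2 : Integrable fun x : ℝ => m x * Real.sin (2 * Real.pi * x * y) :=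
    hmi.mul_bdd (c := 1) (Continuous.aestronglyMeasurable (by fun_prop))
      (.of_forall fun x => Real.abs_sin_le_one _)
  have hodd : ∫ x : ℝ, m x * Real.sin (2 * Real.pi * x * y) = 0 := by
    have h := integral_neg_eq_self (fun x : ℝ => m x * Real.sin (2 * Real.pi * x * y)) volume
    have h' : ∀ x : ℝ, m (-x) * Real.sin (2 * Real.pi * (-x) * y) =
        -(m x * Real.sin (2 * Real.pi * x * y)) := fun x => by
      rw [hm, show 2 * Real.pi * (-x) * y = -(2 * Real.pi * x * y) by ring, Real.sin_neg]; ring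
    simp only [h', integral_neg] at h
    linarith
  have heven : ∫ x : ℝ, m x * Real.cos (2 * Real.pi * x * y) =
      2 * ∫ x in Set.Ioi (0 : ℝ), m x * Real.cos (2 * Real.pi * x * y) := by
    rw [← integral_comp_abs (f := fun x => m x * Real.cos (2 * Real.pi * x * y))]
    refine integral_congr_ae (.of_forall fun x => ?_)
    rcases abs_choice x with h | h
    · simp only [h]
    · simp only [h, hm]
      rw [show 2 * Real.pi * (-x) * y = -(2 * Real.pi * x * y) by ring, Real.cos_neg]
  rw [Real.fourier_real_eq_integral_exp_smul, ← heven]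
  have h3 : ∀ x : ℝ, Complex.exp (↑(-2 * Real.pi * x * y) * Complex.I) • (m x : ℂ) =
      ((m x * Real.cos (2 * Real.pi * x * y) : ℝ) : ℂ) -
        ((m x * Real.sin (2 * Real.pi * x * y) : ℝ) : ℂ) * Complex.I := fun x => by
    rw [Complex.exp_mul_I, ← Complex.ofReal_cos, ← Complex.ofReal_sin,
      show -2 * Real.pi * x * y = -(2 * Real.pi * x * y) by ring, Real.cos_neg, Real.sin_neg]
    push_cast
    rw [smul_eq_mul]
    ring
  simp only [h3]
  rw [integral_sub hI1.ofReal (hI2.ofReal.mul_const _), integral_mul_const, integral_complex_ofReal,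
    integral_complex_ofReal, hodd]
  simp

/-- Bernstein's theorem for even functions supported in `[-R, R]` whose derivative is dominated
by `1 + x ^ (a - 1)` on `(0, R)`, with `a > 1 / 2`. -/
lemma integrable_fourier_even {a R : ℝ} (ha : 1 / 2 < a) (hR : 0 < R) :
    ∃ K : ℝ, 0 ≤ K ∧ ∀ (m m' : ℝ → ℝ) (B : ℝ), 0 < B → Continuous m → (∀ x, m (-x) = m x) →
      (∀ x, R ≤ x → m x = 0) → (∀ x ∈ Set.Icc 0 R, |m x| ≤ B) →
      (∀ x ∈ Set.Ioo 0 R, HasDerivAt m (m' x) x) → Measurable m' →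
      (∀ x ∈ Set.Ioo 0 R, |m' x| ≤ B * (1 + x ^ (a - 1))) →
      Integrable m ∧ Integrable (𝓕 (fun x => (m x : ℂ))) ∧
      ∫ y, ‖𝓕 (fun x => (m x : ℂ)) y‖ ≤ K * B := by
  -- The square of the derivative bound. It is integrable at 0 exactly because `2a - 2 > -1`.
  set q : ℝ → ℝ := fun x => (1 + x ^ (a - 1)) ^ 2 with hq
  have hq0 : ∀ x, 0 ≤ q x := fun x => sq_nonneg _
  have hqi : IntegrableOn q (Set.Ioo 0 R) := by
    have h1 : IntegrableOn (fun x : ℝ => 1 + 2 * x ^ (a - 1) + x ^ (2 * a - 2)) (Set.Ioo 0 R) := by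
      have e1 := (intervalIntegral.intervalIntegrable_rpow' (a := 0) (b := R) (r := a - 1)
        (by linarith))
      have e2 := (intervalIntegral.intervalIntegrable_rpow' (a := 0) (b := R) (r := 2 * a - 2)
        (by linarith))
      have := ((intervalIntegrable_const (c := (1 : ℝ))).add (e1.const_mul 2)).add e2
      rw [intervalIntegrable_iff_integrableOn_Ioo_of_le hR.le] at this
      exact this
    refine h1.congr_fun (fun x hx => ?_) measurableSet_Ioo
    simp only [hq]
    rw [show 2 * a - 2 = (a - 1) * (2 : ℕ) by push_cast; ring, Real.rpow_mul hx.1.le,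
      Real.rpow_natCast]
    ring
  set Q : ℝ := ∫ x in Set.Ioo 0 R, q x with hQ
  have hQ0 : 0 ≤ Q := integral_nonneg hq0
  -- Here `π` is the integral of `1/(1+y²)`, while `4R` and `Q` bound the squared `L²` norms of `2m`
  -- and `m'` on `(0, R)`, each divided by `B²`.
  refine ⟨(Real.pi + (4 * R + Q)) / 2, by positivity, ?_⟩
  intro m m' B hB hmc hme hmR hmB hmd hm'meas hm'B
  have hsupp : ∀ x, R ≤ |x| → m x = 0 := fun x hx => by
    rcases abs_choice x with h | h
    · exact hmR x (h ▸ hx)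
    · rw [← hme]; exact hmR _ (h ▸ hx)
  have hmi : Integrable m := hmc.integrable_of_hasCompactSupport
    (HasCompactSupport.of_support_subset_isCompact (isCompact_Icc (a := -R) (b := R)) fun x hx => by
      by_contra hcon
      refine hx (hsupp x ?_)
      by_contra h
      rw [not_le, abs_lt] at h
      exact hcon ⟨h.1.le, h.2.le⟩)
  -- the two auxiliary functions
  set g : ℝ → ℂ := (Set.Ioo 0 R).indicator fun x => ((2 * m x : ℝ) : ℂ) with hg
  set h : ℝ → ℂ := (Set.Ioo 0 R).indicator fun x => ((m' x : ℝ) : ℂ) with hh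
  have hgmeas : AEStronglyMeasurable g :=
    (Continuous.aestronglyMeasurable (by fun_prop)).indicator measurableSet_Ioo
  have hhmeas : AEStronglyMeasurable h :=
    (Measurable.aestronglyMeasurable (by fun_prop)).indicator measurableSet_Ioo
  have hgsq : ∀ x, ‖g x‖ ^ 2 ≤ (Set.Ioo 0 R).indicator (fun _ => 4 * B ^ 2) x := fun x => by
    by_cases hx : x ∈ Set.Ioo 0 R
    · simp only [hg, Set.indicator_of_mem hx]
      rw [Complex.norm_real, Real.norm_eq_abs, sq_abs, mul_pow]
      have := hmB x ⟨hx.1.le, hx.2.le⟩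
      have : m x ^ 2 ≤ B ^ 2 := by rw [← sq_abs]; gcongr
      linarith
    · simp [hg, Set.indicator_of_notMem hx]
  have hhsq : ∀ x, ‖h x‖ ^ 2 ≤ (Set.Ioo 0 R).indicator (fun x => B ^ 2 * q x) x := fun x => by
    by_cases hx : x ∈ Set.Ioo 0 R
    · simp only [hh, Set.indicator_of_mem hx, hq]
      rw [Complex.norm_real, Real.norm_eq_abs, ← mul_pow]
      gcongr
      exact hm'B x hx
    · simp [hh, Set.indicator_of_notMem hx]
  have hBint : Integrable ((Set.Ioo 0 R).indicator fun _ : ℝ => 4 * B ^ 2) := by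
    rw [integrable_indicator_iff measurableSet_Ioo]
    exact integrableOn_const (by simp)
  have hqint : Integrable ((Set.Ioo 0 R).indicator fun x : ℝ => B ^ 2 * q x) := by
    rw [integrable_indicator_iff measurableSet_Ioo]
    exact hqi.const_mul _
  have hg2 : MemLp g 2 := by
    rw [memLp_two_iff_integrable_sq_norm hgmeas]
    exact hBint.mono' (hgmeas.norm.pow 2) (.of_forall fun x => by
      rw [Real.norm_of_nonneg (by positivity)]; exact hgsq x)
  have hh2 : MemLp h 2 := by
    rw [memLp_two_iff_integrable_sq_norm hhmeas]
    exact hqint.mono' (hhmeas.norm.pow 2) (.of_forall fun x => by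
      rw [Real.norm_of_nonneg (by positivity)]; exact hhsq x)
  have hL1 : ∀ f : ℝ → ℂ, MemLp ((Set.Ioo 0 R).indicator f) 2 →
      Integrable ((Set.Ioo 0 R).indicator f) := fun f hf => by
    rw [memLp_indicator_iff_restrict measurableSet_Ioo] at hf
    rw [integrable_indicator_iff measurableSet_Ioo]
    have : IsFiniteMeasure (volume.restrict (Set.Ioo 0 R)) := ⟨by simp⟩
    exact hf.integrable (by norm_num)
  have hg1 : Integrable g := hL1 _ hg2
  have hh1 : Integrable h := hL1 _ hh2
  have hm'i : IntervalIntegrable m' volume 0 R := by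
    rw [intervalIntegrable_iff_integrableOn_Ioo_of_le hR.le]
    rw [hh, integrable_indicator_iff measurableSet_Ioo] at hh1
    have := hh1.re
    simp only [RCLike.re_eq_complex_re, Complex.ofReal_re] at this
    exact this
  -- representation through a cosine integral on `[0, R]`
  set φ : ℝ → ℝ := fun y => 2 * ∫ x in (0 : ℝ)..R, m x * Real.cos (2 * Real.pi * x * y) with hφ
  have hF : ∀ y, 𝓕 (fun x => (m x : ℂ)) y = (φ y : ℂ) := fun y => by
    rw [fourier_even hme hmi, show φ y = 2 * ∫ x in (0 : ℝ)..R, m x * Real.cos (2 * Real.pi * x * y)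
      from rfl, intervalIntegral.integral_of_le hR.le]
    have : ∫ x in Set.Ioi (0 : ℝ), m x * Real.cos (2 * Real.pi * x * y) =
        ∫ x in Set.Ioc 0 R, m x * Real.cos (2 * Real.pi * x * y) := by
      refine setIntegral_eq_of_subset_of_forall_sdiff_eq_zero measurableSet_Ioi
        Set.Ioc_subset_Ioi_self fun x hx => ?_
      rw [hmR x, zero_mul]
      by_contra hcon
      exact hx.2 ⟨hx.1, (not_le.1 hcon).le⟩
    rw [this]
  have hFourier : ∀ (f : ℝ → ℝ) (y : ℝ), 𝓕 ((Set.Ioo 0 R).indicator fun x => ((f x : ℝ) : ℂ)) y =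
      ∫ x in Set.Ioo 0 R, Complex.exp (↑(-2 * Real.pi * x * y) * Complex.I) • ((f x : ℝ) : ℂ) := by
    intro f y
    rw [Real.fourier_real_eq_integral_exp_smul, ← integral_indicator measurableSet_Ioo]
    refine integral_congr_ae (.of_forall fun x => ?_)
    by_cases hx : x ∈ Set.Ioo 0 R
    · simp [Set.indicator_of_mem hx]
    · simp [Set.indicator_of_notMem hx]
  have hmulE : ∀ (f : ℝ → ℝ) (y : ℝ), IntegrableOn f (Set.Ioo 0 R) →
      IntegrableOn (fun x => Complex.exp (↑(-2 * Real.pi * x * y) * Complex.I) • ((f x : ℝ) : ℂ))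
        (Set.Ioo 0 R) := fun f y hf => by
    refine Integrable.bdd_mul (c := 1) hf.ofReal (Continuous.aestronglyMeasurable (by fun_prop))
      (.of_forall fun x => ?_)
    rw [Complex.norm_exp_ofReal_mul_I]
  have hgre : ∀ y, |φ y| ≤ ‖𝓕 g y‖ := fun y => by
    have : φ y = (𝓕 g y).re := by
      rw [hg, hFourier, ← RCLike.re_eq_complex_re, ← integral_re (hmulE _ y
        ((hmc.integrableOn_Icc.mono_set Set.Ioo_subset_Icc_self).const_mul 2)), hφ]
      simp only
      rw [intervalIntegral.integral_of_le hR.le, integral_Ioc_eq_integral_Ioo,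
        ← integral_const_mul]
      refine integral_congr_ae (.of_forall fun x => ?_)
      simp only [smul_eq_mul, RCLike.re_eq_complex_re, Complex.re_mul_ofReal,
        Complex.exp_ofReal_mul_I_re]
      rw [show -2 * Real.pi * x * y = -(2 * Real.pi * x * y) by ring, Real.cos_neg]
      ring
    rw [this]
    exact Complex.abs_re_le_norm _
  -- Integration by parts against the sine. The boundary terms vanish since `m R = 0` and `sin 0 =
  -- 0`, and the surplus factor `π > 1` is dropped.
  have hhim : ∀ y, |y * φ y| ≤ ‖𝓕 h y‖ := fun y => by
    have him : (𝓕 h y).im = -∫ x in (0 : ℝ)..R, m' x * Real.sin (2 * Real.pi * x * y) := by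
      rw [hh, hFourier, ← RCLike.im_eq_complex_im, ← integral_im (hmulE _ y
        ((intervalIntegrable_iff_integrableOn_Ioo_of_le hR.le).1 hm'i)),
        intervalIntegral.integral_of_le hR.le, integral_Ioc_eq_integral_Ioo, ← integral_neg]
      refine integral_congr_ae (.of_forall fun x => ?_)
      simp only [smul_eq_mul, RCLike.im_eq_complex_im, Complex.im_mul_ofReal,
        Complex.exp_ofReal_mul_I_im]
      rw [show -2 * Real.pi * x * y = -(2 * Real.pi * x * y) by ring, Real.sin_neg]
      ring
    have hparts := intervalIntegral.integral_mul_deriv_eq_deriv_mul_of_hasDerivAt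
      (a := 0) (b := R) (u := m) (u' := m') (v := fun x => Real.sin (2 * Real.pi * x * y))
      (v' := fun x => Real.cos (2 * Real.pi * x * y) * (2 * Real.pi * y))
      hmc.continuousOn (by fun_prop)
      (fun x hx => hmd x (by simpa [hR.le] using hx))
      (fun x _ => by
        have : HasDerivAt (fun x : ℝ => 2 * Real.pi * x * y) (2 * Real.pi * y) x := by
          simpa using ((hasDerivAt_id x).const_mul (2 * Real.pi)).mul_const y
        exact this.sin) hm'i
      (Continuous.intervalIntegrable (by fun_prop) _ _)
    rw [hmR R le_rfl, zero_mul, mul_zero, zero_mul, Real.sin_zero, mul_zero, sub_zero, zero_sub,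
      ← him] at hparts
    have h5 : ∫ x in (0 : ℝ)..R, m x * (Real.cos (2 * Real.pi * x * y) * (2 * Real.pi * y)) =
        Real.pi * (y * φ y) := by
      simp only [hφ, ← mul_assoc]
      rw [intervalIntegral.integral_mul_const, intervalIntegral.integral_mul_const,
        intervalIntegral.integral_mul_const]
      ring
    rw [h5] at hparts
    calc |y * φ y| ≤ Real.pi * |y * φ y| :=
          le_mul_of_one_le_left (abs_nonneg _) (by linarith [Real.pi_gt_three])
      _ = |(𝓕 h y).im| := by rw [← hparts, abs_mul Real.pi, abs_of_pos Real.pi_pos]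
      _ ≤ ‖𝓕 h y‖ := Complex.abs_im_le_norm _
  have hGi : Integrable fun y => ‖𝓕 g y‖ ^ 2 :=
    (memLp_two_iff_integrable_sq_norm (memLp_fourier hg1 hg2).1).1 (memLp_fourier hg1 hg2)
  have hHi : Integrable fun y => ‖𝓕 h y‖ ^ 2 :=
    (memLp_two_iff_integrable_sq_norm (memLp_fourier hh1 hh2).1).1 (memLp_fourier hh1 hh2)
  have hGH : Integrable fun y => ‖𝓕 g y‖ ^ 2 + ‖𝓕 h y‖ ^ 2 := hGi.add hHi
  -- The arithmetic-geometric mean inequality for `(1+y²)^(-1/2)` and `(1+y²)^(1/2) |φ|`, weighted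
  -- by `B`. The weight keeps the final bound linear in `B`, since the squared norms are of order
  -- `B²`.
  have hbd : ∀ y, |φ y| ≤ (B * (1 + y ^ 2)⁻¹ + (‖𝓕 g y‖ ^ 2 + ‖𝓕 h y‖ ^ 2) * B⁻¹) / 2 := by
    intro y
    have e1 : φ y ^ 2 ≤ ‖𝓕 g y‖ ^ 2 := by rw [← sq_abs]; gcongr; exact hgre y
    have e2 : (y * φ y) ^ 2 ≤ ‖𝓕 h y‖ ^ 2 := by rw [← sq_abs]; gcongr; exact hhim y
    have e3 : (1 + y ^ 2) * φ y ^ 2 ≤ ‖𝓕 g y‖ ^ 2 + ‖𝓕 h y‖ ^ 2 := by nlinarith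
    have hp : 0 < 1 + y ^ 2 := by positivity
    have e4 : 2 * |φ y| ≤ B * (1 + y ^ 2)⁻¹ + ((1 + y ^ 2) * φ y ^ 2) * B⁻¹ := by
      have e5 : B * (1 + y ^ 2)⁻¹ + ((1 + y ^ 2) * φ y ^ 2) * B⁻¹ - 2 * |φ y| =
          (B - (1 + y ^ 2) * |φ y|) ^ 2 * ((1 + y ^ 2)⁻¹ * B⁻¹) := by
        rw [← sq_abs (φ y)]
        field_simp
        ring
      have : 0 ≤ (B - (1 + y ^ 2) * |φ y|) ^ 2 * ((1 + y ^ 2)⁻¹ * B⁻¹) := by positivity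
      linarith
    have e6 : ((1 + y ^ 2) * φ y ^ 2) * B⁻¹ ≤ (‖𝓕 g y‖ ^ 2 + ‖𝓕 h y‖ ^ 2) * B⁻¹ := by gcongr
    linarith
  have hI := (((integrable_inv_one_add_sq).const_mul B).add
    (hGH.mul_const B⁻¹)).div_const 2
  have hFi : Integrable (𝓕 (fun x => (m x : ℂ))) := by
    refine hI.mono' (continuous_fourier hmi.ofReal).aestronglyMeasurable (.of_forall fun y => ?_)
    rw [hF, Complex.norm_real]
    exact hbd y
  refine ⟨hmi, hFi, ?_⟩
  calc ∫ y, ‖𝓕 (fun x => (m x : ℂ)) y‖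
      ≤ ∫ y, (B * (1 + y ^ 2)⁻¹ + (‖𝓕 g y‖ ^ 2 + ‖𝓕 h y‖ ^ 2) * B⁻¹) / 2 := by
        refine integral_mono hFi.norm hI fun y => ?_
        simp only
        rw [hF, Complex.norm_real]
        exact hbd y
    _ = (B * Real.pi + ((∫ x, ‖g x‖ ^ 2) + ∫ x, ‖h x‖ ^ 2) * B⁻¹) / 2 := by
        rw [integral_div, integral_add ((integrable_inv_one_add_sq).const_mul B)
          (hGH.mul_const B⁻¹), integral_const_mul, integral_univ_inv_one_add_sq,
          integral_mul_const, integral_add hGi hHi, integral_norm_sq_fourier hg1 hg2,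
          integral_norm_sq_fourier hh1 hh2]
    _ ≤ (B * Real.pi + (R * (4 * B ^ 2) + B ^ 2 * Q) * B⁻¹) / 2 := by
        have i1 : ∫ x, ‖g x‖ ^ 2 ≤ R * (4 * B ^ 2) := by
          refine (integral_mono_of_nonneg (.of_forall fun _ => by positivity) hBint
            (.of_forall hgsq)).trans (le_of_eq ?_)
          rw [integral_indicator measurableSet_Ioo, setIntegral_const]
          simp [hR.le]
        have i2 : ∫ x, ‖h x‖ ^ 2 ≤ B ^ 2 * Q := by
          refine (integral_mono_of_nonneg (.of_forall fun _ => by positivity) hqint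
            (.of_forall hhsq)).trans (le_of_eq ?_)
          rw [integral_indicator measurableSet_Ioo, integral_const_mul]
        gcongr
    _ = (Real.pi + (4 * R + Q)) / 2 * B := by
        field_simp

end FourierTransform

/-! ### Band-limited test functions -/

/-- The symbol `|l|^α (1 + l²)^(γ/2)` at `l = 2πξ`. -/
noncomputable def symbol (α γ ξ : ℝ) : ℝ :=
  |2 * Real.pi * ξ| ^ α * (1 + |2 * Real.pi * ξ| ^ 2) ^ (γ / 2)

/-- The triangular cutoff `(1 - |ξ| / R)₊`. -/
noncomputable def cutoff (R ξ : ℝ) : ℝ := max 0 (1 - |ξ| / R)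

/-- The cutoff times a power of the symbol. -/
noncomputable def multiplier (α γ R : ℝ) (k : ℕ) (ξ : ℝ) : ℝ := cutoff R ξ * symbol α γ ξ ^ k

/-- The test function with Fourier transform `multiplier α γ R k`. -/
noncomputable def testKernel (α γ R : ℝ) (k : ℕ) (y : ℝ) : ℝ :=
  (𝓕 (fun ξ => (multiplier α γ R k ξ : ℂ)) y).re

lemma symbol_neg (α γ ξ : ℝ) : symbol α γ (-ξ) = symbol α γ ξ := by
  simp only [symbol, mul_neg, abs_neg]

lemma symbol_nonneg (α γ ξ : ℝ) : 0 ≤ symbol α γ ξ := by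
  unfold symbol; positivity

lemma continuous_symbol {α γ : ℝ} (hα : 0 ≤ α) : Continuous (symbol α γ) := by
  unfold symbol
  refine Continuous.mul ?_ ?_
  · exact (Real.continuous_rpow_const hα).comp (by fun_prop)
  · refine Continuous.rpow_const (by fun_prop) fun x => Or.inl ?_
    positivity

lemma cutoff_neg (R ξ : ℝ) : cutoff R (-ξ) = cutoff R ξ := by
  simp only [cutoff, abs_neg]

lemma cutoff_nonneg (R ξ : ℝ) : 0 ≤ cutoff R ξ := le_max_left _ _

lemma cutoff_le_one {R : ℝ} (hR : 0 < R) (ξ : ℝ) : cutoff R ξ ≤ 1 := by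
  refine max_le zero_le_one ?_
  have : 0 ≤ |ξ| / R := by positivity
  linarith

lemma continuous_cutoff (R : ℝ) : Continuous (cutoff R) := by
  unfold cutoff; fun_prop

lemma cutoff_eq_zero {R ξ : ℝ} (hR : 0 < R) (h : R ≤ |ξ|) : cutoff R ξ = 0 := by
  refine max_eq_left ?_
  rw [sub_nonpos, one_le_div hR]
  exact h

lemma cutoff_of_mem {R ξ : ℝ} (hξ : ξ ∈ Set.Icc 0 R) : cutoff R ξ = 1 - ξ / R := by
  rw [cutoff, abs_of_nonneg hξ.1]
  refine max_eq_right ?_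
  rw [sub_nonneg]
  exact div_le_one_of_le₀ hξ.2 (hξ.1.trans hξ.2)

lemma tendsto_cutoff (ξ : ℝ) : Tendsto (fun R => cutoff R ξ) atTop (𝓝 1) := by
  have h : Tendsto (fun R : ℝ => 1 - |ξ| / R) atTop (𝓝 (1 - 0)) :=
    tendsto_const_nhds.sub (tendsto_const_nhds.div_atTop tendsto_id)
  have h2 := (tendsto_const_nhds (x := (0 : ℝ))).max h
  simp only [sub_zero, zero_le_one, max_eq_right] at h2
  exact h2

lemma multiplier_neg (α γ R : ℝ) (k : ℕ) (ξ : ℝ) :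
    multiplier α γ R k (-ξ) = multiplier α γ R k ξ := by
  simp only [multiplier, cutoff_neg, symbol_neg]

lemma continuous_multiplier {α γ : ℝ} (hα : 0 ≤ α) (R : ℝ) (k : ℕ) :
    Continuous (multiplier α γ R k) :=
  (continuous_cutoff R).mul ((continuous_symbol hα).pow k)

lemma multiplier_succ (α γ R : ℝ) (k : ℕ) (ξ : ℝ) :
    multiplier α γ R (k + 1) ξ = symbol α γ ξ * multiplier α γ R k ξ := by
  simp only [multiplier]; ring

/-- The symbol and its derivative on `(0, R)`. -/
lemma exists_symbol_bound {α γ R : ℝ} (hα : 0 < α) (hR : 0 < R) :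
    ∃ (s' : ℝ → ℝ) (M D : ℝ), 1 ≤ M ∧ 0 ≤ D ∧ Measurable s' ∧
      (∀ x ∈ Set.Icc 0 R, symbol α γ x ≤ M) ∧
      (∀ x ∈ Set.Ioo 0 R, HasDerivAt (symbol α γ) (s' x) x) ∧
      ∀ x ∈ Set.Ioo 0 R, |s' x| ≤ D * x ^ (α - 1) := by
  -- On the positive axis the symbol is `x^α` times this smooth factor, so the only singularity of
  -- its derivative is `x^(α-1)` at 0.
  let b : ℝ → ℝ := fun x => (2 * Real.pi) ^ α * (1 + (2 * Real.pi * x) ^ 2) ^ (γ / 2)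
  have hbd : ContDiff ℝ 1 b := by
    refine contDiff_const.mul (ContDiff.rpow_const_of_ne (by fun_prop) fun x => ?_)
    positivity
  have hb' : Continuous (deriv b) := hbd.continuous_deriv le_rfl
  obtain ⟨B0, hB0⟩ := isCompact_Icc.exists_bound_of_continuousOn (s := Set.Icc 0 R)
    hbd.continuous.continuousOn
  obtain ⟨B1, hB1⟩ := isCompact_Icc.exists_bound_of_continuousOn (s := Set.Icc 0 R)
    hb'.continuousOn
  have hB0' : 0 ≤ B0 := (norm_nonneg _).trans (hB0 0 ⟨le_rfl, hR.le⟩)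
  have hB1' : 0 ≤ B1 := (norm_nonneg _).trans (hB1 0 ⟨le_rfl, hR.le⟩)
  have hsym : ∀ x, 0 ≤ x → symbol α γ x = x ^ α * b x := fun x hx => by
    simp only [symbol, b]
    rw [abs_of_nonneg (by positivity), Real.mul_rpow (by positivity) hx]
    ring
  refine ⟨fun x => α * x ^ (α - 1) * b x + x ^ α * deriv b x, max 1 (R ^ α * B0),
    α * B0 + R * B1, le_max_left _ _, by positivity, ?_, ?_, ?_, ?_⟩
  · have h1 := hbd.continuous.measurable
    have h2 := hb'.measurable
    fun_prop
  · intro x hx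
    refine le_trans ?_ (le_max_right _ _)
    rw [hsym x hx.1]
    have := (le_abs_self _).trans (hB0 x hx)
    have := hx.1
    have := hx.2
    gcongr
  · intro x hx
    have h1 := (Real.hasDerivAt_rpow_const (p := α) (Or.inl hx.1.ne')).mul
      ((hbd.differentiable one_ne_zero).differentiableAt (x := x)).hasDerivAt
    refine h1.congr_of_eventuallyEq ?_
    filter_upwards [lt_mem_nhds hx.1] with y hy using hsym y hy.le
  · intro x hx
    have hx' : x ∈ Set.Icc 0 R := ⟨hx.1.le, hx.2.le⟩
    have hx0 := hx.1
    have h1 : |b x| ≤ B0 := hB0 x hx'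
    have h2 : |deriv b x| ≤ B1 := hB1 x hx'
    have h3 : x ^ α = x ^ (α - 1) * x := by
      rw [← Real.rpow_add_one hx0.ne', sub_add_cancel]
    calc |α * x ^ (α - 1) * b x + x ^ α * deriv b x|
        ≤ |α * x ^ (α - 1) * b x| + |x ^ α * deriv b x| := abs_add_le _ _
      _ = α * x ^ (α - 1) * |b x| + x ^ (α - 1) * x * |deriv b x| := by
          rw [abs_mul (α * x ^ (α - 1)), abs_mul (x ^ α), abs_of_nonneg (show 0 ≤ α * x ^ (α - 1) by positivity),
            abs_of_nonneg (show 0 ≤ x ^ α by positivity), h3]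
      _ ≤ α * x ^ (α - 1) * B0 + x ^ (α - 1) * R * B1 := by
          have := hx.2.le
          gcongr
      _ = (α * B0 + R * B1) * x ^ (α - 1) := by ring

/-- Bernstein's estimate applies with `a = α`. Differentiating the `k`-th power costs a factor `k`,
absorbed into `2^k`, so the growth in `k` remains geometric; the Mittag-Leffler iteration needs
precisely this. -/
lemma fourier_multiplier_bound {α γ R : ℝ} (hα : 1 / 2 < α) (hR : 0 < R) :
    ∃ K M : ℝ, 0 ≤ K ∧ 0 ≤ M ∧ ∀ k, Integrable (multiplier α γ R k) ∧
      Integrable (𝓕 (fun ξ => (multiplier α γ R k ξ : ℂ))) ∧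
      ∫ y, ‖𝓕 (fun ξ => (multiplier α γ R k ξ : ℂ)) y‖ ≤ K * M ^ k := by
  obtain ⟨K, hK0, hK⟩ := integrable_fourier_even hα hR
  obtain ⟨s', M, D, hM1, hD0, hs'm, hsM, hsd, hs'D⟩ :=
    exists_symbol_bound (γ := γ) (show 0 < α by linarith) hR
  have hα0 : 0 ≤ α := by linarith
  refine ⟨K * (1 + 1 / R + D), 2 * M, by positivity, by positivity, fun k => ?_⟩
  have h2k : (k : ℝ) ≤ 2 ^ k := by exact_mod_cast Nat.lt_two_pow_self.le
  have h12k : (1 : ℝ) ≤ 2 ^ k := one_le_pow₀ (by norm_num)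
  have h := hK (multiplier α γ R k)
    (fun x => -(1 / R) * symbol α γ x ^ k + (1 - x / R) * (k * symbol α γ x ^ (k - 1) * s' x))
    ((1 + 1 / R + D) * (2 * M) ^ k) (by positivity) (continuous_multiplier hα0 R k)
    (multiplier_neg α γ R k)
    (fun x hx => by rw [multiplier, cutoff_eq_zero hR (hx.trans (le_abs_self x)), zero_mul])
    ?_ ?_ ?_ ?_
  · rw [mul_assoc]
    exact h
  · intro x hx
    have h0 := symbol_nonneg α γ x
    rw [multiplier, abs_of_nonneg (mul_nonneg (cutoff_nonneg R x) (by positivity))]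
    calc cutoff R x * symbol α γ x ^ k ≤ 1 * M ^ k := by
          gcongr
          · exact cutoff_le_one hR x
          · exact hsM x hx
      _ ≤ (1 + 1 / R + D) * (2 * M) ^ k := by
          have h1 : (1 : ℝ) ≤ 1 + 1 / R + D := by
            have : 0 < 1 / R := by positivity
            linarith
          have h2 : M ^ k ≤ (2 * M) ^ k := by gcongr; linarith
          gcongr
  · intro x hx
    have h1 : HasDerivAt (fun x => 1 - x / R) (-(1 / R)) x := by
      simpa using ((hasDerivAt_id x).div_const R).const_sub 1
    refine (h1.mul ((hsd x hx).pow k)).congr_of_eventuallyEq ?_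
    filter_upwards [Ioo_mem_nhds hx.1 hx.2] with y hy
    simp only [multiplier, Pi.mul_apply, Pi.pow_apply]
    rw [cutoff_of_mem ⟨hy.1.le, hy.2.le⟩]
  · have := (continuous_symbol (γ := γ) hα0).measurable
    fun_prop
  · intro x hx
    have hx' : x ∈ Set.Icc 0 R := ⟨hx.1.le, hx.2.le⟩
    have h0 := symbol_nonneg α γ x
    have hx0 := hx.1
    have hc0 : 0 ≤ 1 - x / R := by
      rw [sub_nonneg]; exact div_le_one_of_le₀ hx.2.le hR.le
    have hc1 : 1 - x / R ≤ 1 := by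
      have : 0 ≤ x / R := by positivity
      linarith
    have e1 : symbol α γ x ^ k ≤ M ^ k := by gcongr; exact hsM x hx'
    have e2 : symbol α γ x ^ (k - 1) ≤ M ^ k := by
      calc symbol α γ x ^ (k - 1) ≤ M ^ (k - 1) := by gcongr; exact hsM x hx'
        _ ≤ M ^ k := pow_le_pow_right₀ hM1 (Nat.sub_le k 1)
    calc |-(1 / R) * symbol α γ x ^ k + (1 - x / R) * (k * symbol α γ x ^ (k - 1) * s' x)|
        ≤ |-(1 / R) * symbol α γ x ^ k| +
          |(1 - x / R) * (k * symbol α γ x ^ (k - 1) * s' x)| := abs_add_le _ _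
      _ = (1 / R) * symbol α γ x ^ k + (1 - x / R) * (k * symbol α γ x ^ (k - 1) * |s' x|) := by
          rw [abs_mul, abs_mul, abs_mul, abs_neg, abs_of_nonneg (show 0 ≤ 1 / R by positivity),
            abs_of_nonneg (show 0 ≤ symbol α γ x ^ k by positivity), abs_of_nonneg hc0,
            abs_of_nonneg (show 0 ≤ (k : ℝ) * symbol α γ x ^ (k - 1) by positivity)]
      _ ≤ (1 / R) * M ^ k + 1 * (2 ^ k * M ^ k * (D * x ^ (α - 1))) := by
          gcongr
          exact hs'D x hx
      _ ≤ (1 / R) * (2 ^ k * M ^ k) + 1 * (2 ^ k * M ^ k * (D * x ^ (α - 1))) := by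
          gcongr
          exact le_mul_of_one_le_left (by positivity) h12k
      _ = (1 / R + D * x ^ (α - 1)) * (2 * M) ^ k := by rw [mul_pow]; ring
      _ ≤ ((1 + 1 / R + D) * (1 + x ^ (α - 1))) * (2 * M) ^ k := by
          gcongr
          have e3 : 0 ≤ x ^ (α - 1) := by positivity
          have e4 : 0 < 1 / R := by positivity
          nlinarith [mul_nonneg e4.le e3]
      _ = (1 + 1 / R + D) * (2 * M) ^ k * (1 + x ^ (α - 1)) := by ring

lemma ofReal_testKernel {α γ R : ℝ} (hα : 1 / 2 < α) (hR : 0 < R) (k : ℕ) (y : ℝ) :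
    (testKernel α γ R k y : ℂ) = 𝓕 (fun ξ => (multiplier α γ R k ξ : ℂ)) y := by
  obtain ⟨K, M, -, -, h⟩ := fourier_multiplier_bound (γ := γ) hα hR
  rw [testKernel, fourier_even (multiplier_neg α γ R k) (h k).1, Complex.ofReal_re]

lemma exists_testKernel_bound {α γ R : ℝ} (hα : 1 / 2 < α) (hR : 0 < R) :
    ∃ K M : ℝ, 0 ≤ K ∧ 0 ≤ M ∧ ∀ k, ∫ y, ‖testKernel α γ R k y‖ ≤ K * M ^ k := by
  obtain ⟨K, M, hK, hM, h⟩ := fourier_multiplier_bound (γ := γ) hα hR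
  refine ⟨K, M, hK, hM, fun k => ?_⟩
  have : ∀ y, ‖testKernel α γ R k y‖ = ‖𝓕 (fun ξ => (multiplier α γ R k ξ : ℂ)) y‖ := fun y => by
    rw [← ofReal_testKernel hα hR, Complex.norm_real]
  simp only [this]
  exact (h k).2.2

lemma integrable_testKernel {α γ R : ℝ} (hα : 1 / 2 < α) (hR : 0 < R) (k : ℕ) :
    Integrable (testKernel α γ R k) := by
  obtain ⟨K, M, -, -, h⟩ := fourier_multiplier_bound (γ := γ) hα hR
  exact (h k).2.1.re

/-- Fourier inversion: the multiplier is even, so its transform and its inverse transform coincide.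
-/
lemma fourier_testKernel {α γ R : ℝ} (hα : 1 / 2 < α) (hR : 0 < R) (k : ℕ) (ξ : ℝ) :
    𝓕 (fun y => (testKernel α γ R k y : ℂ)) ξ = (multiplier α γ R k ξ : ℂ) := by
  obtain ⟨K, M, -, -, h⟩ := fourier_multiplier_bound (γ := γ) hα hR
  have hc : Continuous fun ξ => (multiplier α γ R k ξ : ℂ) :=
    Complex.continuous_ofReal.comp (continuous_multiplier (by linarith) R k)
  have h1 := hc.fourier_fourierInv_eq (h k).1.ofReal (h k).2.1
  rw [Real.fourierInv_eq_fourier_comp_neg] at h1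
  simp only [multiplier_neg] at h1
  simp only [ofReal_testKernel hα hR]
  exact congrFun h1 ξ

lemma fourier_testKernel_sub {α γ R : ℝ} (hα : 1 / 2 < α) (hR : 0 < R) (k : ℕ) (x ξ : ℝ) :
    𝓕 (fun y => (testKernel α γ R k (y - x) : ℂ)) ξ =
      Complex.exp (↑(-2 * Real.pi * x * ξ) * Complex.I) * (multiplier α γ R k ξ : ℂ) := by
  rw [← fourier_testKernel hα hR, Real.fourier_real_eq_integral_exp_smul,
    Real.fourier_real_eq_integral_exp_smul, ← integral_const_mul]
  refine Eq.trans ?_ (integral_sub_right_eq_self _ x)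
  refine integral_congr_ae (.of_forall fun y => ?_)
  simp only [smul_eq_mul]
  rw [← mul_assoc, ← Complex.exp_add]
  congr 2
  push_cast
  ring

/-- Raising `k` by one multiplies the transform by the symbol, so the translated kernels are
admissible pairs in the weak equation. This is what produces the chain of equations. -/
lemma isRieszBessel_testKernel {α γ R : ℝ} (hα : 1 / 2 < α) (hR : 0 < R) (k : ℕ) (x : ℝ) :
    IsRieszBessel α γ (fun y => testKernel α γ R k (y - x))
      (fun y => testKernel α γ R (k + 1) (y - x)) := by
  refine ⟨(integrable_testKernel hα hR k).comp_sub_right x,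
    (integrable_testKernel hα hR (k + 1)).comp_sub_right x, fun ξ => ?_⟩
  rw [fourier_testKernel_sub hα hR, fourier_testKernel_sub hα hR, multiplier_succ, symbol]
  push_cast
  ring

/-- For `k = 0` the symbol is absent and only the cutoff is left, which depends on `ξ / R` alone. -/
lemma testKernel_zero_scaling {α γ R : ℝ} (hR : 0 < R) (y : ℝ) :
    testKernel α γ R 0 y = R * testKernel α γ 1 0 (R * y) := by
  have h1 : ∀ ξ, multiplier α γ R 0 (R * ξ) = multiplier α γ 1 0 ξ := fun ξ => by
    simp only [multiplier, cutoff, pow_zero, mul_one, abs_mul, abs_of_pos hR, div_one]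
    rw [mul_div_cancel_left₀ _ hR.ne']
  have h2 := Measure.integral_comp_mul_left (fun ξ : ℝ =>
    Complex.exp (↑(-2 * Real.pi * ξ * y) * Complex.I) • (multiplier α γ R 0 ξ : ℂ)) R
  rw [testKernel, testKernel, Real.fourier_real_eq_integral_exp_smul,
    Real.fourier_real_eq_integral_exp_smul, ← Complex.re_ofReal_mul]
  congr 1
  simp only [h1] at h2
  have h3 : ∫ ξ : ℝ, Complex.exp (↑(-2 * Real.pi * ξ * (R * y)) * Complex.I) •
      (multiplier α γ 1 0 ξ : ℂ) = ∫ ξ : ℝ, Complex.exp (↑(-2 * Real.pi * (R * ξ) * y) * Complex.I) •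
      (multiplier α γ 1 0 ξ : ℂ) := by
    refine integral_congr_ae (.of_forall fun ξ => ?_)
    simp only
    congr 3
    ring_nf
  rw [h3, h2, abs_of_pos (inv_pos.2 hR), Complex.real_smul, ← mul_assoc]
  push_cast
  rw [mul_inv_cancel₀ (by exact_mod_cast hR.ne'), one_mul]

lemma integral_testKernel_one {α γ : ℝ} (hα : 1 / 2 < α) : ∫ y, testKernel α γ 1 0 y = 1 := by
  have h := fourier_testKernel (γ := γ) hα one_pos 0 0
  rw [Real.fourier_real_eq_integral_exp_smul] at h
  simp only [mul_zero, Complex.ofReal_zero, zero_mul, Complex.exp_zero, one_smul,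
    integral_complex_ofReal] at h
  have h2 : multiplier α γ 1 0 0 = 1 := by simp [multiplier, cutoff]
  rw [h2] at h
  exact_mod_cast h

/-- The test functions of order zero form an approximate identity. -/
lemma tendsto_integral_testKernel_smul {E : Type*} [NormedAddCommGroup E] [NormedSpace ℝ E]
    [CompleteSpace E] {α γ : ℝ} (hα : 1 / 2 < α) {f : ℝ → E} (hf : Continuous f) {C : ℝ}
    (hC : ∀ x, ‖f x‖ ≤ C) (x : ℝ) :
    Tendsto (fun R => ∫ y, testKernel α γ R 0 (y - x) • f y) atTop (𝓝 (f x)) := by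
  have h1 : ∀ R : ℝ, 0 < R → ∫ y, testKernel α γ R 0 (y - x) • f y =
      ∫ z, testKernel α γ 1 0 z • f (x + z / R) := by
    intro R hR
    have e1 : ∫ y, testKernel α γ R 0 (y - x) • f y = ∫ y, testKernel α γ R 0 y • f (x + y) := by
      refine (integral_add_right_eq_self (fun y => testKernel α γ R 0 (y - x) • f y) x).symm.trans ?_
      simp only [add_sub_cancel_right, add_comm x]
    have e2 := Measure.integral_comp_mul_left
      (fun z : ℝ => testKernel α γ 1 0 z • f (x + z / R)) R
    simp only [mul_div_cancel_left₀ _ hR.ne'] at e2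
    rw [e1]
    simp only [testKernel_zero_scaling hR, mul_smul]
    rw [integral_smul, e2, abs_of_pos (inv_pos.2 hR), smul_inv_smul₀ hR.ne']
  have h2 : Tendsto (fun R : ℝ => ∫ z, testKernel α γ 1 0 z • f (x + z / R)) atTop
      (𝓝 (∫ z, testKernel α γ 1 0 z • f x)) := by
    have hi := integrable_testKernel (γ := γ) hα one_pos 0
    refine tendsto_integral_filter_of_dominated_convergence
      (fun z => ‖testKernel α γ 1 0 z‖ * C) ?_ ?_ (hi.norm.mul_const C) ?_
    · refine .of_forall fun R => hi.1.smul ?_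
      exact (hf.comp (by fun_prop)).aestronglyMeasurable
    · refine .of_forall fun R => .of_forall fun z => ?_
      rw [norm_smul]
      gcongr
      exact hC _
    · refine .of_forall fun z => Tendsto.const_smul ?_ _
      have : Tendsto (fun R : ℝ => x + z / R) atTop (𝓝 (x + 0)) :=
        tendsto_const_nhds.add (tendsto_const_nhds.div_atTop tendsto_id)
      rw [add_zero] at this
      exact (hf.tendsto x).comp this
  rw [integral_smul_const, integral_testKernel_one hα, one_smul] at h2
  refine h2.congr' ?_
  filter_upwards [eventually_gt_atTop 0] with R hR using (h1 R hR).symm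

/-! ### The spectral density -/

/-- The mixing kernel of Gaussian densities. -/
noncomputable def mixKernel (κ s k : ℝ) : ℝ :=
  s ^ (κ / 2 - 1) * Real.exp (-s) * (√(Real.pi / s) * Real.exp (-(Real.pi ^ 2 / s) * k ^ 2))

/-- The density with Fourier transform `(1 + x²)^(-κ/2)`. -/
noncomputable def baseDensity (κ k : ℝ) : ℝ :=
  (Real.Gamma (κ / 2))⁻¹ * ∫ s in Set.Ioi (0 : ℝ), mixKernel κ s k

lemma measurable_mixKernel (κ : ℝ) : Measurable fun p : ℝ × ℝ => mixKernel κ p.1 p.2 := by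
  unfold mixKernel
  fun_prop

lemma mixKernel_nonneg {κ s : ℝ} (hs : 0 < s) (k : ℝ) : 0 ≤ mixKernel κ s k := by
  unfold mixKernel; positivity

lemma integrable_gamma_density {a : ℝ} (ha : 0 < a) :
    IntegrableOn (fun s : ℝ => s ^ (a - 1) * Real.exp (-s)) (Set.Ioi 0) := by
  have := Real.GammaIntegral_convergent ha
  simpa only [mul_comm] using this

lemma integrable_mixKernel {κ : ℝ} (hκ : 0 < κ) :
    Integrable (Function.uncurry (mixKernel κ))
      ((volume.restrict (Set.Ioi (0 : ℝ))).prod volume) := by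
  rw [integrable_prod_iff (f := Function.uncurry (mixKernel κ))
    (measurable_mixKernel κ).aestronglyMeasurable]
  constructor
  · filter_upwards [ae_restrict_mem measurableSet_Ioi] with s hs
    have hs : 0 < s := hs
    simp only [Function.uncurry, mixKernel]
    exact ((integrable_exp_neg_mul_sq (by positivity)).const_mul _).const_mul _
  · refine (integrable_gamma_density (a := κ / 2) (by positivity)).congr ?_
    filter_upwards [ae_restrict_mem measurableSet_Ioi] with s hs
    have hs : 0 < s := hs
    simp only [Function.uncurry, Real.norm_of_nonneg (mixKernel_nonneg hs _)]
    simp only [mixKernel]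
    rw [integral_const_mul, integral_const_mul, integral_gaussian, ← Real.sqrt_mul (by positivity),
      show Real.pi / s * (Real.pi / (Real.pi ^ 2 / s)) = 1 by field_simp, Real.sqrt_one, mul_one]

lemma integrable_baseDensity {κ : ℝ} (hκ : 0 < κ) : Integrable (baseDensity κ) :=
  (integrable_mixKernel hκ).integral_prod_right.const_mul _

lemma fourier_gaussian_mix {s : ℝ} (hs : 0 < s) (x : ℝ) :
    ∫ k : ℝ, Complex.exp (↑(-2 * Real.pi * k * x) * Complex.I) •
      ((√(Real.pi / s) * Real.exp (-(Real.pi ^ 2 / s) * k ^ 2) : ℝ) : ℂ) =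
      ((Real.exp (-(s * x ^ 2)) : ℝ) : ℂ) := by
  have h := congrFun (fourier_gaussian_pi (b := ((Real.pi / s : ℝ) : ℂ)) (by
    rw [Complex.ofReal_re]; positivity)) x
  rw [Real.fourier_real_eq_integral_exp_smul] at h
  have h1 : ∀ k : ℝ, Complex.exp (↑(-2 * Real.pi * k * x) * Complex.I) •
      ((√(Real.pi / s) * Real.exp (-(Real.pi ^ 2 / s) * k ^ 2) : ℝ) : ℂ) =
      (√(Real.pi / s) : ℂ) * (Complex.exp (↑(-2 * Real.pi * k * x) * Complex.I) •
        Complex.exp (-Real.pi * ((Real.pi / s : ℝ) : ℂ) * (k : ℂ) ^ 2)) := fun k => by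
    push_cast
    rw [smul_eq_mul, smul_eq_mul, show -((Real.pi : ℂ) ^ 2 / s) * (k : ℂ) ^ 2 =
      -Real.pi * (Real.pi / s) * (k : ℂ) ^ 2 by ring]
    ring
  simp only [h1]
  rw [integral_const_mul, h]
  have h2 : ((Real.pi / s : ℝ) : ℂ) ^ (1 / 2 : ℂ) = (√(Real.pi / s) : ℂ) := by
    rw [Real.sqrt_eq_rpow, Complex.ofReal_cpow (by positivity)]
    push_cast
    rfl
  have h3 : (√(Real.pi / s) : ℂ) ≠ 0 := by
    have : √(Real.pi / s) ≠ 0 := by positivity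
    exact_mod_cast this
  rw [h2, ← mul_assoc, mul_one_div_cancel h3, one_mul]
  push_cast
  congr 1
  have hs' : (s : ℂ) ≠ 0 := by exact_mod_cast hs.ne'
  have hp : (Real.pi : ℂ) ≠ 0 := by exact_mod_cast Real.pi_ne_zero
  field_simp

/-- `(1+x²)^(-κ/2)` is the Gamma integral of `s^(κ/2-1) e^(-s) e^(-s x²)` divided by `Γ(κ/2)`, and
each `e^(-s x²)` is the transform of a Gaussian density; Fubini puts the two together. -/
lemma fourier_baseDensity {κ : ℝ} (hκ : 0 < κ) (x : ℝ) :
    𝓕 (fun k => (baseDensity κ k : ℂ)) x = (((1 + x ^ 2) ^ (-(κ / 2)) : ℝ) : ℂ) := by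
  have hG : 0 < Real.Gamma (κ / 2) := Real.Gamma_pos_of_pos (by positivity)
  let F : ℝ → ℝ → ℂ := fun s k =>
    Complex.exp (↑(-2 * Real.pi * k * x) * Complex.I) * (mixKernel κ s k : ℂ)
  have hF : Integrable (Function.uncurry F) ((volume.restrict (Set.Ioi (0 : ℝ))).prod volume) := by
    refine Integrable.bdd_mul (c := 1) (integrable_mixKernel hκ).ofReal
      (Continuous.aestronglyMeasurable (by fun_prop)) (.of_forall fun p => ?_)
    rw [Complex.norm_exp_ofReal_mul_I]
  have hswap := integral_integral_swap hF
  rw [Real.fourier_real_eq_integral_exp_smul]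
  have h1 : ∀ k : ℝ, Complex.exp (↑(-2 * Real.pi * k * x) * Complex.I) • (baseDensity κ k : ℂ) =
      ((Real.Gamma (κ / 2))⁻¹ : ℂ) * ∫ s in Set.Ioi (0 : ℝ), F s k := fun k => by
    simp only [F]
    rw [integral_const_mul, integral_complex_ofReal, baseDensity, smul_eq_mul]
    push_cast
    ring
  simp only [h1]
  rw [integral_const_mul, ← hswap]
  have h2 : ∀ s ∈ Set.Ioi (0 : ℝ), ∫ k, F s k =
      ((s ^ (κ / 2 - 1) * Real.exp (-((1 + x ^ 2) * s)) : ℝ) : ℂ) := fun s hs => by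
    have h3 : ∀ k, F s k = ((s ^ (κ / 2 - 1) * Real.exp (-s) : ℝ) : ℂ) *
        (Complex.exp (↑(-2 * Real.pi * k * x) * Complex.I) •
        ((√(Real.pi / s) * Real.exp (-(Real.pi ^ 2 / s) * k ^ 2) : ℝ) : ℂ)) := fun k => by
      simp only [F, mixKernel, smul_eq_mul]
      push_cast
      ring
    simp only [h3]
    rw [integral_const_mul, fourier_gaussian_mix hs, ← Complex.ofReal_mul, mul_assoc,
      ← Real.exp_add]
    congr 4
    ring
  rw [setIntegral_congr_fun measurableSet_Ioi h2, integral_complex_ofReal,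
    Real.integral_rpow_mul_exp_neg_mul_Ioi (by positivity) (by positivity), ← Complex.ofReal_inv,
    ← Complex.ofReal_mul]
  congr 1
  rw [one_div, Real.inv_rpow (by positivity), ← Real.rpow_neg (by positivity)]
  field_simp

/-- Near `k₀ ≠ 0` the factor `exp(-π² k² / s)` is at most `s / c`. This extra power of `s` makes the
mixture converge at `s = 0` uniformly in `k`; at `k = 0` it would be lost. -/
lemma continuousAt_baseDensity {κ k₀ : ℝ} (hκ : 0 < κ) (hk₀ : k₀ ≠ 0) :
    ContinuousAt (baseDensity κ) k₀ := by
  refine ContinuousAt.mul continuousAt_const ?_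
  have hk : 0 < |k₀| := abs_pos.2 hk₀
  set c : ℝ := Real.pi ^ 2 * (k₀ ^ 2 / 4) with hc
  have hk2 : 0 < k₀ ^ 2 := by positivity
  have hc0 : 0 < c := by positivity
  refine continuousAt_of_dominated (bound := fun s =>
    (√Real.pi / c) * (s ^ ((κ + 1) / 2 - 1) * Real.exp (-s))) ?_ ?_ ?_ ?_
  · refine .of_forall fun k => Measurable.aestronglyMeasurable ?_
    exact (measurable_mixKernel κ).comp (measurable_id.prodMk measurable_const)
  · have : ∀ᶠ k in 𝓝 k₀, k₀ ^ 2 / 4 < k ^ 2 :=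
      (continuous_pow 2).continuousAt.eventually_const_lt (by linarith)
    filter_upwards [this] with k hk
    filter_upwards [ae_restrict_mem measurableSet_Ioi] with s hs
    have hs : 0 < s := hs
    rw [Real.norm_of_nonneg (mixKernel_nonneg hs _), mixKernel]
    have e1 : Real.exp (-(Real.pi ^ 2 / s) * k ^ 2) ≤ s / c := by
      have e2 : c / s ≤ Real.pi ^ 2 / s * k ^ 2 := by
        rw [div_mul_eq_mul_div, hc]
        gcongr
      have e3 : c / s ≤ Real.exp (c / s) := by linarith [Real.add_one_le_exp (c / s)]
      calc Real.exp (-(Real.pi ^ 2 / s) * k ^ 2) ≤ Real.exp (-(c / s)) :=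
            Real.exp_le_exp.2 (by linarith)
        _ = (Real.exp (c / s))⁻¹ := Real.exp_neg _
        _ ≤ (c / s)⁻¹ := by gcongr
        _ = s / c := inv_div _ _
    have e4 : s ^ ((κ + 1) / 2 - 1) = s ^ (κ / 2 - 1) * s / √s := by
      rw [Real.sqrt_eq_rpow, eq_div_iff (by positivity), ← Real.rpow_add hs,
        ← Real.rpow_add_one hs.ne']
      congr 1
      ring
    rw [e4, Real.sqrt_div Real.pi_pos.le]
    calc s ^ (κ / 2 - 1) * Real.exp (-s) * (√Real.pi / √s * Real.exp (-(Real.pi ^ 2 / s) * k ^ 2))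
        ≤ s ^ (κ / 2 - 1) * Real.exp (-s) * (√Real.pi / √s * (s / c)) := by gcongr
      _ = _ := by ring
  · exact (integrable_gamma_density (by positivity)).const_mul _
  · refine .of_forall fun s => ?_
    unfold mixKernel
    fun_prop

/-- The substitution `s = w σ / 2` makes the exponent symmetric in `σ` and `1/σ`. Fixing only `k²`
covers both shifts `±w/2π`, and `2π` is the Jacobian between frequency and angular frequency. -/
lemma baseDensity_eq_besselK {κ w : ℝ} (hκ : 0 < κ) (hw : 0 < w) {k : ℝ}
    (hk : k ^ 2 = (w / (2 * Real.pi)) ^ 2) :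
    baseDensity κ k = 2 * Real.pi *
      (c₁ κ * besselK ((κ - 1) / 2) w * w ^ ((κ - 1) / 2)) := by
  have hG : 0 < Real.Gamma (κ / 2) := Real.Gamma_pos_of_pos (by positivity)
  have h1 := integral_comp_mul_left_Ioi (fun s => mixKernel κ s k) 0 (half_pos hw)
  rw [mul_zero, smul_eq_mul] at h1
  have h2 : ∫ s in Set.Ioi (0 : ℝ), mixKernel κ s k =
      (w / 2) * ∫ σ in Set.Ioi (0 : ℝ), mixKernel κ (w / 2 * σ) k := by
    rw [h1, ← mul_assoc, mul_inv_cancel₀ (by positivity), one_mul]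
  have h3 : ∀ σ ∈ Set.Ioi (0 : ℝ), mixKernel κ (w / 2 * σ) k =
      ((w / 2) ^ ((κ - 1) / 2 - 1) * √Real.pi) *
      (σ ^ ((κ - 1) / 2 - 1) * Real.exp (-(1 / 2) * (σ + 1 / σ) * w)) := by
    intro σ hσ
    have hσ : 0 < σ := hσ
    have e1 : 0 < w / 2 * σ := by positivity
    rw [mixKernel, Real.sqrt_div Real.pi_pos.le, hk]
    have e2 : (w / 2 * σ) ^ (κ / 2 - 1) / √(w / 2 * σ) =
        (w / 2) ^ ((κ - 1) / 2 - 1) * σ ^ ((κ - 1) / 2 - 1) := by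
      rw [← Real.mul_rpow (by positivity) hσ.le, Real.sqrt_eq_rpow, ← Real.rpow_sub e1]
      congr 1
      ring
    have e3 : Real.exp (-(w / 2 * σ)) *
        Real.exp (-(Real.pi ^ 2 / (w / 2 * σ)) * (w / (2 * Real.pi)) ^ 2) =
        Real.exp (-(1 / 2) * (σ + 1 / σ) * w) := by
      rw [← Real.exp_add]
      congr 1
      field_simp
      ring
    rw [← e3]
    calc _ = ((w / 2 * σ) ^ (κ / 2 - 1) / √(w / 2 * σ)) * √Real.pi * (Real.exp (-(w / 2 * σ)) *
        Real.exp (-(Real.pi ^ 2 / (w / 2 * σ)) * (w / (2 * Real.pi)) ^ 2)) := by ring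
      _ = _ := by rw [e2]; ring
  rw [baseDensity, h2, setIntegral_congr_fun measurableSet_Ioi h3, integral_const_mul, besselK, c₁,
    ← mul_assoc (w / 2), ← mul_assoc (w / 2)]
  have e5 : w / 2 * (w / 2) ^ ((κ - 1) / 2 - 1) = 2 ^ ((1 - κ) / 2) * w ^ ((κ - 1) / 2) := by
    rw [mul_comm, ← Real.rpow_add_one (by positivity), sub_add_cancel,
      Real.div_rpow hw.le (by norm_num), show (1 - κ) / 2 = -((κ - 1) / 2) by ring,
      Real.rpow_neg (by norm_num)]
    ring
  rw [e5]
  have e6 : Real.pi = √Real.pi * √Real.pi := (Real.mul_self_sqrt Real.pi_pos.le).symm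
  have e7 : 0 < √Real.pi := by positivity
  generalize (∫ s in Set.Ioi (0 : ℝ), s ^ ((κ - 1) / 2 - 1) *
    Real.exp (-(1 / 2) * (s + 1 / s) * w)) = I
  have e8 : 2 * Real.pi * (2 ^ ((1 - κ) / 2) / (√Real.pi * Real.Gamma (κ / 2)) * (1 / 2 * I) *
      w ^ ((κ - 1) / 2)) = (Real.pi / √Real.pi) *
      (2 ^ ((1 - κ) / 2) / Real.Gamma (κ / 2) * I * w ^ ((κ - 1) / 2)) := by
    field_simp
  rw [e8, Real.div_sqrt]
  ring

/-- The spectral density of the initial covariance function, in the frequency `k = l / 2π`. -/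
noncomputable def specDens (n : ℕ) (A w κ : ℕ → ℝ) (k : ℝ) : ℝ :=
  ∑ j ∈ Finset.Icc 1 n, A j * ((baseDensity (κ j) (k - w j / (2 * Real.pi)) +
    baseDensity (κ j) (k + w j / (2 * Real.pi))) / 2)

section SpecDens

variable {n : ℕ} {A w κ : ℕ → ℝ}

lemma integrable_specDens (hp : CyclicParams n A w κ) : Integrable (specDens n A w κ) := by
  refine integrable_finsetSum _ fun j hj => ?_
  rw [Finset.mem_Icc] at hj
  have h := integrable_baseDensity (hp.κ_mem j hj.1 hj.2).1
  exact (((h.comp_sub_right _).add (h.comp_add_right _)).div_const 2).const_mul _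

/-- The shifted base densities can be singular only at `±w_j / 2π`, and these are nonzero since `w_j
> 0`. -/
lemma continuousAt_specDens (hp : CyclicParams n A w κ) : ContinuousAt (specDens n A w κ) 0 := by
  refine tendsto_finsetSum _ fun j hj => ?_
  rw [Finset.mem_Icc] at hj
  have hw := hp.w_pos j hj.1 hj.2
  have hκ := (hp.κ_mem j hj.1 hj.2).1
  have h1 : ContinuousAt (fun k => baseDensity (κ j) (k - w j / (2 * Real.pi))) 0 :=
    ContinuousAt.comp (g := baseDensity (κ j))
      (continuousAt_baseDensity hκ (by simp [hw.ne', Real.pi_ne_zero]))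
      (by fun_prop)
  have h2 : ContinuousAt (fun k => baseDensity (κ j) (k + w j / (2 * Real.pi))) 0 :=
    ContinuousAt.comp (g := baseDensity (κ j))
      (continuousAt_baseDensity hκ (by simp [hw.ne', Real.pi_ne_zero]))
      (by fun_prop)
  exact (((h1.add h2).div_const 2).const_mul (A j))

lemma specDens_zero (hp : CyclicParams n A w κ) :
    specDens n A w κ 0 = 2 * Real.pi * specDensZero n A w κ := by
  rw [specDens, specDensZero, Finset.mul_sum]
  refine Finset.sum_congr rfl fun j hj => ?_
  rw [Finset.mem_Icc] at hj
  have hw := hp.w_pos j hj.1 hj.2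
  have hκ := (hp.κ_mem j hj.1 hj.2).1
  rw [baseDensity_eq_besselK hκ hw (by ring), baseDensity_eq_besselK hκ hw (by ring),
    abs_of_pos hw]
  ring

lemma fourier_comp_add (f : ℝ → ℂ) (b x : ℝ) :
    𝓕 (fun k => f (k + b)) x = Complex.exp (↑(2 * Real.pi * b * x) * Complex.I) * 𝓕 f x := by
  rw [Real.fourier_real_eq_integral_exp_smul, Real.fourier_real_eq_integral_exp_smul,
    ← integral_const_mul]
  refine Eq.trans ?_ (integral_add_right_eq_self _ b)
  refine integral_congr_ae (.of_forall fun k => ?_)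
  simp only [smul_eq_mul]
  rw [← mul_assoc, ← Complex.exp_add]
  congr 2
  push_cast
  ring

/-- Shifts by `±w_j / 2π` become phases `e^(±i w_j x)`, whose half-sum is the cosine; `A 0 = 0`
removes the remaining summand `j = 0` of the covariance. -/
lemma fourier_specDens (hp : CyclicParams n A w κ) (hA₀ : A 0 = 0) (x : ℝ) :
    𝓕 (fun k => (specDens n A w κ k : ℂ)) x = (initialCov n A w κ x : ℂ) := by
  have hone : ∀ j ∈ Finset.Icc 1 n, ∫ k : ℝ, Complex.exp (↑(-2 * Real.pi * k * x) * Complex.I) •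
      ((A j * ((baseDensity (κ j) (k - w j / (2 * Real.pi)) +
        baseDensity (κ j) (k + w j / (2 * Real.pi))) / 2) : ℝ) : ℂ) =
      ((A j * (Real.cos (w j * x) / (1 + x ^ 2) ^ (κ j / 2)) : ℝ) : ℂ) := by
    intro j hj
    rw [Finset.mem_Icc] at hj
    have hκ := (hp.κ_mem j hj.1 hj.2).1
    have h := integrable_baseDensity hκ
    set b := w j / (2 * Real.pi) with hb
    have h1 := fourier_comp_add (fun k => (baseDensity (κ j) k : ℂ)) b x
    have h2 := fourier_comp_add (fun k => (baseDensity (κ j) k : ℂ)) (-b) x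
    rw [fourier_baseDensity hκ, Real.fourier_real_eq_integral_exp_smul] at h1 h2
    have hE : ∀ f : ℝ → ℂ, Integrable f → Integrable fun k : ℝ =>
        Complex.exp (↑(-2 * Real.pi * k * x) * Complex.I) • f k := fun f hf => by
      refine Integrable.bdd_mul (c := 1) hf
        (Continuous.aestronglyMeasurable (by fun_prop)) (.of_forall fun p => ?_)
      rw [Complex.norm_exp_ofReal_mul_I]
    have h3 : ∀ k : ℝ, Complex.exp (↑(-2 * Real.pi * k * x) * Complex.I) •
        ((A j * ((baseDensity (κ j) (k - b) + baseDensity (κ j) (k + b)) / 2) : ℝ) : ℂ) =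
        ((A j / 2 : ℝ) : ℂ) * (Complex.exp (↑(-2 * Real.pi * k * x) * Complex.I) •
          (baseDensity (κ j) (k + -b) : ℂ) +
          Complex.exp (↑(-2 * Real.pi * k * x) * Complex.I) •
          (baseDensity (κ j) (k + b) : ℂ)) := fun k => by
      rw [sub_eq_add_neg]
      push_cast
      simp only [smul_eq_mul]
      ring
    have i1 : Integrable fun k : ℝ => (baseDensity (κ j) (k + -b) : ℂ) :=
      (h.comp_add_right (-b)).ofReal
    have i2 : Integrable fun k : ℝ => (baseDensity (κ j) (k + b) : ℂ) :=
      (h.comp_add_right b).ofReal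
    simp only [h3]
    rw [integral_const_mul, integral_add (hE _ i1) (hE _ i2), h1, h2, ← add_mul]
    have h4 : Complex.exp (↑(2 * Real.pi * -b * x) * Complex.I) +
        Complex.exp (↑(2 * Real.pi * b * x) * Complex.I) = ((2 * Real.cos (w j * x) : ℝ) : ℂ) := by
      rw [show 2 * Real.pi * -b * x = -(w j * x) by rw [hb]; field_simp,
        show 2 * Real.pi * b * x = w j * x by rw [hb]; field_simp]
      push_cast
      rw [Complex.two_cos]
      ring_nf
    rw [h4, ← Complex.ofReal_mul, ← Complex.ofReal_mul, Real.rpow_neg (by positivity)]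
    congr 1
    field_simp
  rw [Real.fourier_real_eq_integral_exp_smul]
  have h5 : ∀ k : ℝ, Complex.exp (↑(-2 * Real.pi * k * x) * Complex.I) •
      (specDens n A w κ k : ℂ) = ∑ j ∈ Finset.Icc 1 n,
      Complex.exp (↑(-2 * Real.pi * k * x) * Complex.I) •
      ((A j * ((baseDensity (κ j) (k - w j / (2 * Real.pi)) +
        baseDensity (κ j) (k + w j / (2 * Real.pi))) / 2) : ℝ) : ℂ) := fun k => by
    rw [specDens, Complex.ofReal_sum, Finset.smul_sum]
  simp only [h5]
  rw [integral_finsetSum, Finset.sum_congr rfl hone, ← Complex.ofReal_sum, initialCov]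
  · congr 1
    rw [Finset.sum_range_succ', hA₀, zero_mul, add_zero, Finset.range_eq_Ico,
      Finset.sum_Ico_add' (fun j => A j * (Real.cos (w j * x) / (1 + x ^ 2) ^ (κ j / 2))) 0 n 1]
    rfl
  · intro j hj
    rw [Finset.mem_Icc] at hj
    have h := integrable_baseDensity (hp.κ_mem j hj.1 hj.2).1
    have h' := (((h.comp_sub_right (w j / (2 * Real.pi))).add
      (h.comp_add_right (w j / (2 * Real.pi)))).div_const 2).const_mul (A j)
    refine Integrable.bdd_mul (c := 1) h'.ofReal
      (Continuous.aestronglyMeasurable (by fun_prop)) (.of_forall fun p => ?_)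
    rw [Complex.norm_exp_ofReal_mul_I]

end SpecDens

/-! ### Stationary fields in a Hilbert space -/

section Hilbert

variable {E : Type*} [NormedAddCommGroup E] [InnerProductSpace ℝ E]

lemma integrable_smul_of_bounded {φ : ℝ → ℝ} (hφ : Integrable φ) {X : ℝ → E} (hX : Continuous X)
    {C : ℝ} (hC : ∀ x, ‖X x‖ ≤ C) : Integrable fun y => φ y • X y := by
  refine (hφ.norm.mul_const C).mono' (hφ.1.smul hX.aestronglyMeasurable) (.of_forall fun y => ?_)
  rw [norm_smul]
  gcongr
  exact hC y

variable [CompleteSpace E]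

lemma inner_integral_smul {φ : ℝ → ℝ} (hφ : Integrable φ) {X : ℝ → E} (hX : Continuous X)
    {C : ℝ} (hC : ∀ x, ‖X x‖ ≤ C) (c : E) :
    inner ℝ c (∫ y, φ y • X y) = ∫ y, φ y * inner ℝ c (X y) := by
  have h := (innerSL ℝ c).integral_comp_comm (integrable_smul_of_bounded hφ hX hC)
  simp only [innerSL_apply_apply, inner_smul_right] at h
  exact h.symm

/-- A closed subspace is its own double orthogonal complement, so it suffices to pair the integral
with vectors orthogonal to `S`. -/
lemma integral_smul_mem {φ : ℝ → ℝ} (hφ : Integrable φ) {X : ℝ → E} (hX : Continuous X)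
    {C : ℝ} (hC : ∀ x, ‖X x‖ ≤ C) {S : Submodule ℝ E} (hS : IsClosed (S : Set E))
    (hXS : ∀ x, X x ∈ S) : ∫ y, φ y • X y ∈ S := by
  have : CompleteSpace S := hS.completeSpace_coe
  rw [← Submodule.orthogonal_orthogonal S, Submodule.mem_orthogonal]
  intro c hc
  rw [inner_integral_smul hφ hX hC]
  have : ∀ y, φ y * inner ℝ c (X y) = 0 := fun y => by
    rw [Submodule.inner_left_of_mem_orthogonal (hXS y) hc, mul_zero]
  simp only [this, integral_zero]

/-- The inner product of two linear functionals of a field with spectral density `F`. -/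
lemma inner_integral_integral {X : ℝ → E} (hX : Continuous X) {C : ℝ} (hC : ∀ x, ‖X x‖ ≤ C)
    {r F : ℝ → ℝ} (hr : ∀ x y, inner ℝ (X x) (X y) = r (x - y)) (hF : Integrable F)
    (hrF : ∀ x, 𝓕 (fun k => (F k : ℂ)) x = (r x : ℂ)) {φ ψ : ℝ → ℝ} (hφ : Integrable φ)
    (hψ : Integrable ψ) :
    ((inner ℝ (∫ y, φ y • X y) (∫ y, ψ y • X y) : ℝ) : ℂ) =
      ∫ k, 𝓕 (fun y => (φ y : ℂ)) (-k) * (𝓕 (fun y => (ψ y : ℂ)) k * F k) := by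
  have hEi : ∀ (f : ℝ → ℂ) (y : ℝ), Integrable f → Integrable fun k : ℝ =>
      Complex.exp (↑(2 * Real.pi * k * y) * Complex.I) * f k := fun f y hf => by
    refine Integrable.bdd_mul (c := 1) hf
      (Continuous.aestronglyMeasurable (by fun_prop)) (.of_forall fun p => ?_)
    rw [Complex.norm_exp_ofReal_mul_I]
  have hFψ : Integrable fun k => 𝓕 (fun y => (ψ y : ℂ)) k * (F k : ℂ) := by
    refine Integrable.bdd_mul (c := ∫ y, ‖(ψ y : ℂ)‖) hF.ofReal
      (continuous_fourier hψ.ofReal).aestronglyMeasurable (.of_forall fun k => ?_)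
    exact VectorFourier.norm_fourierIntegral_le_integral_norm _ _ _ _ _
  have h1 : ∀ y, ((inner ℝ (X y) (∫ y, ψ y • X y) : ℝ) : ℂ) =
      𝓕 (fun k => 𝓕 (fun y => (ψ y : ℂ)) k * (F k : ℂ)) (-y) := by
    intro y
    -- Symmetry of the inner product makes `r` even, and a translation in space is a modulation of
    -- the spectral density.
    have e1 : ∀ y', (r (y - y') : ℂ) =
        𝓕 (fun k : ℝ => Complex.exp (↑(2 * Real.pi * k * y) * Complex.I) * (F k : ℂ)) y' := by
      intro y'
      rw [← hr, real_inner_comm, hr, ← hrF, Real.fourier_real_eq_integral_exp_smul,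
        Real.fourier_real_eq_integral_exp_smul]
      refine integral_congr_ae (.of_forall fun k => ?_)
      simp only [smul_eq_mul]
      rw [← mul_assoc, ← Complex.exp_add]
      congr 2
      push_cast
      ring
    rw [inner_integral_smul hψ hX hC, ← integral_complex_ofReal]
    have hψ' : Integrable fun y => (ψ y : ℂ) := hψ.ofReal
    have hF' : Integrable fun k => (F k : ℂ) := hF.ofReal
    have e2 : ∀ y', ((ψ y' * inner ℝ (X y) (X y') : ℝ) : ℂ) = (ψ y' : ℂ) *
        𝓕 (fun k : ℝ => Complex.exp (↑(2 * Real.pi * k * y) * Complex.I) * (F k : ℂ)) y' :=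
      fun y' => by rw [hr, Complex.ofReal_mul, e1]
    simp only [e2]
    rw [← integral_fourier_mul hψ' (hEi _ y hF'), Real.fourier_real_eq_integral_exp_smul]
    refine integral_congr_ae (.of_forall fun k => ?_)
    simp only [smul_eq_mul]
    rw [show -2 * Real.pi * k * -y = 2 * Real.pi * k * y by ring]
    ring
  rw [real_inner_comm, inner_integral_smul hφ hX hC, ← integral_complex_ofReal]
  simp only [Complex.ofReal_mul]
  simp only [real_inner_comm, h1]
  -- `h1` evaluates a transform at `-y`. Reflecting the variable moves the sign onto `φ`, so that
  -- the multiplication formula applies.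
  have h2 := integral_neg_eq_self (fun y : ℝ => (φ (-y) : ℂ) *
    𝓕 (fun k => 𝓕 (fun y => (ψ y : ℂ)) k * (F k : ℂ)) y) volume
  simp only [neg_neg] at h2
  have hφ' : Integrable fun y => (φ (-y) : ℂ) := hφ.comp_neg.ofReal
  rw [h2, ← integral_fourier_mul hφ' hFψ]
  refine integral_congr_ae (.of_forall fun k => ?_)
  simp only
  congr 1
  rw [Real.fourier_real_eq_integral_exp_smul, Real.fourier_real_eq_integral_exp_smul,
    ← integral_neg_eq_self]
  refine integral_congr_ae (.of_forall fun y => ?_)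
  simp only [neg_neg]
  congr 3
  push_cast
  ring

/-- The two translations combine into one phase `e^(2πi(x-x')ξ)`. The inner product is real, so only
its cosine survives. -/
lemma inner_integral_testKernel {X : ℝ → E} (hX : Continuous X) {C : ℝ} (hC : ∀ x, ‖X x‖ ≤ C)
    {r F : ℝ → ℝ} (hr : ∀ x y, inner ℝ (X x) (X y) = r (x - y)) (hF : Integrable F)
    (hrF : ∀ x, 𝓕 (fun k => (F k : ℂ)) x = (r x : ℂ)) {α γ R : ℝ} (hα : 1 / 2 < α) (hR : 0 < R)
    (k l : ℕ) (x x' : ℝ) :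
    Integrable (fun ξ => Real.cos (2 * Real.pi * (x - x') * ξ) * cutoff R ξ ^ 2 *
      symbol α γ ξ ^ k * symbol α γ ξ ^ l * F ξ) ∧
    inner ℝ (∫ y, testKernel α γ R k (y - x) • X y) (∫ y, testKernel α γ R l (y - x') • X y) =
      ∫ ξ, Real.cos (2 * Real.pi * (x - x') * ξ) * cutoff R ξ ^ 2 * symbol α γ ξ ^ k *
        symbol α γ ξ ^ l * F ξ := by
  have hφ := (integrable_testKernel (γ := γ) hα hR k).comp_sub_right x
  have hψ := (integrable_testKernel (γ := γ) hα hR l).comp_sub_right x'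
  have h := inner_integral_integral hX hC hr hF hrF hφ hψ
  have hint : Integrable fun ξ => 𝓕 (fun y => (testKernel α γ R k (y - x) : ℂ)) (-ξ) *
      (𝓕 (fun y => (testKernel α γ R l (y - x') : ℂ)) ξ * F ξ) := by
    have hFψ : Integrable fun ξ => 𝓕 (fun y => (testKernel α γ R l (y - x') : ℂ)) ξ * (F ξ : ℂ) := by
      refine Integrable.bdd_mul (c := ∫ y, ‖(testKernel α γ R l (y - x') : ℂ)‖) hF.ofReal
        (continuous_fourier hψ.ofReal).aestronglyMeasurable (.of_forall fun k => ?_)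
      exact VectorFourier.norm_fourierIntegral_le_integral_norm _ _ _ _ _
    refine Integrable.bdd_mul (c := ∫ y, ‖(testKernel α γ R k (y - x) : ℂ)‖) hFψ
        ((continuous_fourier hφ.ofReal).comp continuous_neg).aestronglyMeasurable
        (.of_forall fun k => ?_)
    exact VectorFourier.norm_fourierIntegral_le_integral_norm _ _ _ _ _
  have hre : ∀ ξ : ℝ, (𝓕 (fun y => (testKernel α γ R k (y - x) : ℂ)) (-ξ) *
      (𝓕 (fun y => (testKernel α γ R l (y - x') : ℂ)) ξ * F ξ)).re =
      Real.cos (2 * Real.pi * (x - x') * ξ) * cutoff R ξ ^ 2 * symbol α γ ξ ^ k *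
        symbol α γ ξ ^ l * F ξ := fun ξ => by
    rw [fourier_testKernel_sub hα hR, fourier_testKernel_sub hα hR, multiplier_neg]
    have e1 : Complex.exp (↑(-2 * Real.pi * x * -ξ) * Complex.I) * (multiplier α γ R k ξ : ℂ) *
        (Complex.exp (↑(-2 * Real.pi * x' * ξ) * Complex.I) * (multiplier α γ R l ξ : ℂ) * F ξ) =
        Complex.exp (↑(2 * Real.pi * (x - x') * ξ) * Complex.I) *
          ((multiplier α γ R k ξ * multiplier α γ R l ξ * F ξ : ℝ) : ℂ) := by
      have e2 : Complex.exp (↑(2 * Real.pi * (x - x') * ξ) * Complex.I) =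
          Complex.exp (↑(-2 * Real.pi * x * -ξ) * Complex.I) *
          Complex.exp (↑(-2 * Real.pi * x' * ξ) * Complex.I) := by
        rw [← Complex.exp_add]
        congr 1
        push_cast
        ring
      rw [e2]
      push_cast
      ring
    rw [e1, Complex.re_mul_ofReal, Complex.exp_ofReal_mul_I_re, multiplier, multiplier]
    ring
  refine ⟨hint.re.congr (.of_forall fun ξ => hre ξ), ?_⟩
  have h3 := congrArg Complex.re h
  rw [Complex.ofReal_re, ← RCLike.re_eq_complex_re, ← integral_re hint] at h3
  rw [h3]
  exact integral_congr_ae (.of_forall fun ξ => hre ξ)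

end Hilbert

/-! ### The covariance function of a mean-square solution -/

section Hilbert

variable {E : Type*} [NormedAddCommGroup E] [InnerProductSpace ℝ E]

/-- A solution of the fractional Riesz–Bessel equation with values in a Hilbert space. -/
structure IsHilbertSolution (α β γ μ : ℝ) (v : ℝ → ℝ → E) : Prop where
  continuousOn : ContinuousOn (fun p : ℝ × ℝ => v p.1 p.2) (Set.Ici 0 ×ˢ Set.univ)
  bounded : ∀ T : ℝ, ∃ C : ℝ, ∀ t ∈ Set.Icc 0 T, ∀ x, ‖v t x‖ ≤ C
  equation : ∀ φ ψ : ℝ → ℝ, IsRieszBessel α γ φ ψ → ∀ t, 0 < t →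
    HasTimeDerivAt β (fun s => ∫ x, φ x • v s x) (-μ • ∫ x, ψ x • v t x) t

namespace IsHilbertSolution

variable {α β γ μ : ℝ} {v : ℝ → ℝ → E}

lemma continuous_space (hv : IsHilbertSolution α β γ μ v) {t : ℝ} (ht : 0 ≤ t) :
    Continuous (v t) :=
  hv.continuousOn.comp_continuous (f := fun x : ℝ => (t, x)) (by fun_prop)
    fun x => ⟨ht, Set.mem_univ _⟩

lemma continuousOn_time (hv : IsHilbertSolution α β γ μ v) (x : ℝ) :
    ContinuousOn (fun t => v t x) (Set.Ici 0) :=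
  hv.continuousOn.comp (f := fun t : ℝ => (t, x)) (by fun_prop) fun t ht => ⟨ht, Set.mem_univ _⟩

lemma exists_bound (hv : IsHilbertSolution α β γ μ v) {t : ℝ} (ht : 0 ≤ t) :
    ∃ C : ℝ, ∀ x, ‖v t x‖ ≤ C := by
  obtain ⟨C, hC⟩ := hv.bounded t
  exact ⟨C, hC t ⟨ht, le_rfl⟩⟩

lemma continuousOn_integral (hv : IsHilbertSolution α β γ μ v) {φ : ℝ → ℝ} (hφ : Integrable φ) :
    ContinuousOn (fun s => ∫ x, φ x • v s x) (Set.Ici 0) := by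
  intro t ht
  obtain ⟨C, hC⟩ := hv.bounded (t + 1)
  have hev : ∀ᶠ s in 𝓝[Set.Ici 0] t, s ∈ Set.Icc 0 (t + 1) := by
    filter_upwards [self_mem_nhdsWithin,
      nhdsWithin_le_nhds (Iio_mem_nhds (show t < t + 1 by linarith))] with s hs hs'
    exact ⟨hs, le_of_lt hs'⟩
  refine continuousWithinAt_of_dominated (bound := fun x => ‖φ x‖ * C) ?_ ?_
    (hφ.norm.mul_const C) (.of_forall fun x => ?_)
  · filter_upwards [self_mem_nhdsWithin] with s hs
    exact hφ.1.smul (hv.continuous_space hs).aestronglyMeasurable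
  · filter_upwards [hev] with s hs
    refine .of_forall fun x => ?_
    rw [norm_smul]
    gcongr
    exact hC s hs x
  · exact continuousWithinAt_const.smul (hv.continuousOn_time x t ht)

variable [CompleteSpace E]

/-- The Mittag-Leffler expansion of a solution smoothed in space. -/
lemma hasSum_integral (hv : IsHilbertSolution α β γ μ v) (hα : 1 / 2 < α)
    (hβ : β ∈ Set.Ioc (0 : ℝ) 1) {R : ℝ} (hR : 0 < R) (x : ℝ) {t : ℝ} (ht : 0 < t) :
    HasSum (fun k : ℕ => ((-μ * t ^ β) ^ k / Real.Gamma (1 + β * k)) •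
      ∫ y, testKernel α γ R k (y - x) • v 0 y) (∫ y, testKernel α γ R 0 (y - x) • v t y) := by
  obtain ⟨K, M, hK, hM, hKM⟩ := exists_testKernel_bound (γ := γ) hα hR
  obtain ⟨C, hC⟩ := hv.bounded (t + 1)
  have hC0 : 0 ≤ C := (norm_nonneg _).trans (hC t ⟨ht.le, by linarith⟩ 0)
  have hint := fun k => (integrable_testKernel (γ := γ) hα hR k).comp_sub_right x
  refine hasSum_of_hasTimeDerivAt (V := fun k s => ∫ y, testKernel α γ R k (y - x) • v s y)
    (C := K * C) hβ (fun k => hv.continuousOn_integral (hint k))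
    (fun k s hs => hv.equation _ _ (isRieszBessel_testKernel hα hR k x) s hs)
    (by positivity) hM (fun k s hs => ?_) (T := t + 1) ⟨ht, by linarith⟩
  calc ‖∫ y, testKernel α γ R k (y - x) • v s y‖
      ≤ ∫ y, ‖testKernel α γ R k (y - x)‖ * C := by
        refine norm_integral_le_of_norm_le ((hint k).norm.mul_const C) (.of_forall fun y => ?_)
        rw [norm_smul]
        gcongr
        exact hC s hs y
    _ = (∫ y, ‖testKernel α γ R k y‖) * C := by
        rw [integral_mul_const,
          integral_sub_right_eq_self (fun y => ‖testKernel α γ R k y‖) x]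
    _ ≤ K * M ^ k * C := by gcongr; exact hKM k
    _ = K * C * M ^ k := by ring

/-- A solution stays in the closed linear span of its initial values. -/
lemma mem_of_initial (hv : IsHilbertSolution α β γ μ v) (hα : 1 / 2 < α)
    (hβ : β ∈ Set.Ioc (0 : ℝ) 1) {S : Submodule ℝ E} (hS : IsClosed (S : Set E))
    (h0 : ∀ x, v 0 x ∈ S) {t : ℝ} (ht : 0 < t) (x : ℝ) : v t x ∈ S := by
  obtain ⟨C, hC⟩ := hv.exists_bound ht.le
  obtain ⟨C₀, hC₀⟩ := hv.exists_bound le_rfl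
  refine hS.mem_of_tendsto
    (tendsto_integral_testKernel_smul (γ := γ) hα (hv.continuous_space ht.le) hC x) ?_
  filter_upwards [eventually_gt_atTop 0] with R hR
  refine hS.mem_of_tendsto (hv.hasSum_integral hα hβ hR x ht) (.of_forall fun s => ?_)
  exact S.sum_mem fun k _ => S.smul_mem _ (integral_smul_mem
    ((integrable_testKernel hα hR k).comp_sub_right x) (hv.continuous_space le_rfl) hC₀ hS h0)

variable {r F : ℝ → ℝ}

/-- The covariance of the smoothed solution. -/
lemma inner_integral_eq (hv : IsHilbertSolution α β γ μ v) (hα : 1 / 2 < α)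
    (hβ : β ∈ Set.Ioc (0 : ℝ) 1) (hr : ∀ x y, inner ℝ (v 0 x) (v 0 y) = r (x - y))
    (hF : Integrable F) (hrF : ∀ x, 𝓕 (fun k => (F k : ℂ)) x = (r x : ℂ)) {R : ℝ} (hR : 0 < R)
    {t t' : ℝ} (ht : 0 < t) (ht' : 0 < t') (x x' : ℝ) :
    inner ℝ (∫ y, testKernel α γ R 0 (y - x) • v t y)
        (∫ y, testKernel α γ R 0 (y - x') • v t' y) =
      ∫ ξ, Real.cos (2 * Real.pi * (x - x') * ξ) * cutoff R ξ ^ 2 *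
        (mittagLeffler β (-μ * t ^ β * symbol α γ ξ) *
          mittagLeffler β (-μ * t' ^ β * symbol α γ ξ)) * F ξ := by
  obtain ⟨C₀, hC₀⟩ := hv.exists_bound le_rfl
  obtain ⟨-, M, -, hM, -, -, hsM, -⟩ := exists_symbol_bound (γ := γ) (show 0 < α by linarith) hR
  have hX := hv.continuous_space le_rfl
  let a : ℝ → ℕ → ℝ := fun t k => (-μ * t ^ β) ^ k / Real.Gamma (1 + β * k)
  let e : ℝ → ℕ → ℝ → ℝ := fun t N ξ => ∑ k ∈ Finset.range N, a t k * symbol α γ ξ ^ k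
  have hlim : ∀ {t : ℝ}, 0 < t → ∀ x, Tendsto (fun N => ∑ k ∈ Finset.range N,
      a t k • ∫ y, testKernel α γ R k (y - x) • v 0 y) atTop
      (𝓝 (∫ y, testKernel α γ R 0 (y - x) • v t y)) := fun ht x =>
    (hv.hasSum_integral hα hβ hR x ht).tendsto_sum_nat
  have hI := inner_integral_testKernel hX hC₀ hr hF hrF (γ := γ) hα hR
  have hpart : ∀ N, inner ℝ
      (∑ k ∈ Finset.range N, a t k • ∫ y, testKernel α γ R k (y - x) • v 0 y)
      (∑ k ∈ Finset.range N, a t' k • ∫ y, testKernel α γ R k (y - x') • v 0 y) =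
      ∫ ξ, Real.cos (2 * Real.pi * (x - x') * ξ) * cutoff R ξ ^ 2 * (e t N ξ * e t' N ξ) * F ξ := by
    intro N
    have : ∀ ξ, Real.cos (2 * Real.pi * (x - x') * ξ) * cutoff R ξ ^ 2 * (e t N ξ * e t' N ξ) * F ξ
        = ∑ k ∈ Finset.range N, ∑ l ∈ Finset.range N, a t k * a t' l *
          (Real.cos (2 * Real.pi * (x - x') * ξ) * cutoff R ξ ^ 2 *
            symbol α γ ξ ^ k * symbol α γ ξ ^ l * F ξ) := fun ξ => by
      simp only [e]
      rw [Finset.sum_mul_sum, Finset.mul_sum, Finset.sum_mul]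
      refine Finset.sum_congr rfl fun k _ => ?_
      rw [Finset.mul_sum, Finset.sum_mul]
      exact Finset.sum_congr rfl fun l _ => by ring
    simp only [this]
    rw [integral_finsetSum _ fun k _ => integrable_finsetSum _ fun l _ =>
      (hI k l x x').1.const_mul _, sum_inner]
    refine Finset.sum_congr rfl fun k _ => ?_
    rw [integral_finsetSum _ fun l _ => (hI k l x x').1.const_mul _, inner_sum]
    refine Finset.sum_congr rfl fun l _ => ?_
    rw [integral_const_mul, real_inner_smul_left, real_inner_smul_right, (hI k l x x').2]
    ring
  have hterm : ∀ (t ξ : ℝ) (k : ℕ), a t k * symbol α γ ξ ^ k =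
      (-μ * t ^ β * symbol α γ ξ) ^ k / Real.Gamma (1 + β * k) := fun t ξ k => by
    simp only [a]
    rw [mul_pow _ (symbol α γ ξ)]
    ring
  have he : ∀ t ξ, Tendsto (fun N => e t N ξ) atTop
      (𝓝 (mittagLeffler β (-μ * t ^ β * symbol α γ ξ))) := fun t ξ => by
    simp only [e, hterm]
    exact (summable_mittagLeffler₂ hβ.1 one_pos _).hasSum.tendsto_sum_nat
  -- The series with absolute values at the largest symbol on the support of the cutoff; it bounds
  -- all partial sums at once.
  let B : ℝ → ℝ := fun t => mittagLeffler₂ β 1 (|-μ * t ^ β| * M)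
  have hsb : ∀ ξ, cutoff R ξ ≠ 0 → symbol α γ ξ ≤ M := fun ξ hξ => by
    have h1 : |ξ| < R := by
      by_contra h
      exact hξ (cutoff_eq_zero hR (not_lt.1 h))
    have h2 := hsM |ξ| ⟨abs_nonneg _, h1.le⟩
    rcases abs_choice ξ with h | h
    · rwa [h] at h2
    · rwa [h, symbol_neg] at h2
  -- Partial sums are not controlled uniformly off the cutoff's support, so the two factors of
  -- `cutoff R ξ ^ 2` are distributed one to each partial sum.
  have heb : ∀ t N ξ, |cutoff R ξ * e t N ξ| ≤ B t := fun t N ξ => by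
    have hB0 : 0 ≤ B t := (abs_nonneg _).trans
      (abs_mittagLeffler₂_le hβ.1 one_pos (s := 0) (by rw [abs_zero]; positivity))
    by_cases hξ : cutoff R ξ = 0
    · rwa [hξ, zero_mul, abs_zero]
    have h1 : |e t N ξ| ≤ B t := by
      simp only [e, hterm]
      refine (Finset.abs_sum_le_sum_abs _ _).trans ?_
      have hle : ∀ k : ℕ, |(-μ * t ^ β * symbol α γ ξ) ^ k / Real.Gamma (1 + β * k)| ≤
          (|-μ * t ^ β| * M) ^ k / Real.Gamma (1 + β * k) := fun k => by
        have hG := Gamma_add_mul_pos hβ.1 one_pos k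
        rw [abs_div, abs_of_pos hG, abs_pow, abs_mul, abs_of_nonneg (symbol_nonneg α γ ξ)]
        have hs0 := symbol_nonneg α γ ξ
        gcongr
        exact hsb ξ hξ
      refine (Finset.sum_le_sum fun k _ => hle k).trans ?_
      refine (summable_mittagLeffler₂ hβ.1 one_pos _).sum_le_tsum _ fun k _ => ?_
      have hG := Gamma_add_mul_pos hβ.1 one_pos k
      positivity
    rw [abs_mul, abs_of_nonneg (cutoff_nonneg R ξ)]
    calc cutoff R ξ * |e t N ξ| ≤ 1 * B t := by
          gcongr
          exact cutoff_le_one hR ξ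
      _ = B t := one_mul _
  have hsc := continuous_symbol (γ := γ) (show 0 ≤ α by linarith)
  have hcc := continuous_cutoff R
  have hec : ∀ t N, Continuous (e t N) := fun t N => by
    simp only [e]
    fun_prop
  refine tendsto_nhds_unique ((hlim ht x).inner (hlim ht' x')) ?_
  simp only [hpart]
  refine tendsto_integral_of_dominated_convergence (fun ξ => B t * B t' * ‖F ξ‖) (fun N => ?_)
    (hF.norm.const_mul _) (fun N => .of_forall fun ξ => ?_) (.of_forall fun ξ => ?_)
  · have h1 := hec t N
    have h2 := hec t' N
    exact (Continuous.aestronglyMeasurable (by fun_prop)).mul hF.1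
  · rw [norm_mul, Real.norm_eq_abs,
      show Real.cos (2 * Real.pi * (x - x') * ξ) * cutoff R ξ ^ 2 * (e t N ξ * e t' N ξ) =
        Real.cos (2 * Real.pi * (x - x') * ξ) *
          ((cutoff R ξ * e t N ξ) * (cutoff R ξ * e t' N ξ)) by ring, abs_mul, abs_mul]
    refine mul_le_mul_of_nonneg_right ?_ (norm_nonneg _)
    calc _ ≤ 1 * (B t * B t') := by
          gcongr
          · exact Real.abs_cos_le_one _
          · exact (abs_nonneg _).trans (heb t N ξ)
          · exact heb t N ξ
          · exact heb t' N ξ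
      _ = B t * B t' := one_mul _
  · exact (((he t ξ).mul (he t' ξ)).const_mul _).mul_const _

/-- The covariance function of a solution in terms of the spectral density of its initial value. -/
theorem inner_eq (hv : IsHilbertSolution α β γ μ v) (hα : 1 / 2 < α)
    (hβ : β ∈ Set.Ioc (0 : ℝ) 1) (hμ : 0 < μ) (hr : ∀ x y, inner ℝ (v 0 x) (v 0 y) = r (x - y))
    (hF : Integrable F) (hrF : ∀ x, 𝓕 (fun k => (F k : ℂ)) x = (r x : ℂ))
    {t t' : ℝ} (ht : 0 < t) (ht' : 0 < t') (x x' : ℝ) :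
    inner ℝ (v t x) (v t' x') =
      ∫ ξ, Real.cos (2 * Real.pi * (x - x') * ξ) *
        (mittagLeffler β (-μ * t ^ β * symbol α γ ξ) *
          mittagLeffler β (-μ * t' ^ β * symbol α γ ξ)) * F ξ := by
  obtain ⟨C, hC0, hC⟩ := exists_abs_mittagLeffler_neg_le hβ
  have hEb : ∀ {t : ℝ}, 0 < t → ∀ ξ, |mittagLeffler β (-μ * t ^ β * symbol α γ ξ)| ≤ C :=
    fun {t} ht ξ => by
      have h0 : 0 ≤ μ * t ^ β * symbol α γ ξ := by
        have := symbol_nonneg α γ ξ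
        positivity
      have := hC _ h0
      rw [show -(μ * t ^ β * symbol α γ ξ) = -μ * t ^ β * symbol α γ ξ by ring] at this
      exact this.trans (div_le_self hC0.le (by linarith))
  have hlim : ∀ {t : ℝ}, 0 < t → ∀ x, Tendsto
      (fun R => ∫ y, testKernel α γ R 0 (y - x) • v t y) atTop (𝓝 (v t x)) := fun {t} ht x => by
    obtain ⟨C, hC⟩ := hv.exists_bound ht.le
    exact tendsto_integral_testKernel_smul hα (hv.continuous_space ht.le) hC x
  refine tendsto_nhds_unique ((hlim ht x).inner (hlim ht' x')) ?_
  have hsc := continuous_symbol (γ := γ) (show 0 ≤ α by linarith)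
  have hEc := continuous_mittagLeffler hβ.1
  refine Tendsto.congr' (f₁ := fun R => ∫ ξ, Real.cos (2 * Real.pi * (x - x') * ξ) *
    cutoff R ξ ^ 2 * (mittagLeffler β (-μ * t ^ β * symbol α γ ξ) *
      mittagLeffler β (-μ * t' ^ β * symbol α γ ξ)) * F ξ) ?_ ?_
  · filter_upwards [eventually_gt_atTop 0] with R hR
    exact (hv.inner_integral_eq hα hβ hr hF hrF hR ht ht' x x').symm
  -- Once the series has been summed, `E_β` is bounded on the negative half-line. The majorant no
  -- longer depends on `R`, and the cutoff can be removed.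
  refine tendsto_integral_filter_of_dominated_convergence (fun ξ => C * C * ‖F ξ‖)
    (.of_forall fun R => ?_) ?_ (hF.norm.const_mul _) (.of_forall fun ξ => ?_)
  · have hcc := continuous_cutoff R
    exact (Continuous.aestronglyMeasurable (by fun_prop)).mul hF.1
  · filter_upwards [eventually_gt_atTop 0] with R hR
    refine .of_forall fun ξ => ?_
    rw [norm_mul, norm_mul, norm_mul, norm_mul, norm_pow]
    simp only [Real.norm_eq_abs, abs_of_nonneg (cutoff_nonneg R ξ)]
    refine mul_le_mul_of_nonneg_right ?_ (abs_nonneg _)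
    calc _ ≤ 1 * 1 ^ 2 * (C * C) := by
          gcongr
          · exact Real.abs_cos_le_one _
          · exact cutoff_nonneg _ _
          · exact cutoff_le_one hR ξ
          · exact hEb ht ξ
          · exact hEb ht' ξ
      _ = C * C := by ring
  · have := ((((tendsto_cutoff ξ).pow 2).const_mul
      (Real.cos (2 * Real.pi * (x - x') * ξ))).mul_const
      (mittagLeffler β (-μ * t ^ β * symbol α γ ξ) *
        mittagLeffler β (-μ * t' ^ β * symbol α γ ξ))).mul_const (F ξ)
    simpa only [one_pow, mul_one] using this

end IsHilbertSolution

end Hilbert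

/-! ### The scaling limit of the covariance function -/

/-- The decay `C / (1 + x)` written as a power whose square is integrable in `l` when `2α > 1`. The
inequality `c|l|^α ≤ x` lets one bound serve all rescaled symbols, since the Bessel factor only
increases `x`. -/
lemma exists_abs_mittagLeffler_neg_le_rpow {α β c : ℝ} (hα : 0 < α) (hβ : β ∈ Set.Ioc (0 : ℝ) 1)
    (hc : 0 < c) :
    ∃ K, 0 < K ∧ ∀ l x, c * |l| ^ α ≤ x → |mittagLeffler β (-x)| ≤ K * (1 + |l|) ^ (-α) := by
  obtain ⟨C, hC0, hC⟩ := exists_abs_mittagLeffler_neg_le hβ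
  refine ⟨C * (2 ^ α * (1 + c⁻¹)), by positivity, fun l x hx => ?_⟩
  have hl : 0 ≤ |l| ^ α := by positivity
  have hx0 : 0 ≤ x := le_trans (by positivity) hx
  refine (hC x hx0).trans ?_
  rw [Real.rpow_neg (by positivity), ← div_eq_mul_inv, div_le_div_iff₀ (by positivity)
    (by positivity), mul_assoc]
  gcongr
  have h1 : (1 + |l|) ^ α ≤ 2 ^ α * (1 + |l| ^ α) := by
    rcases le_total |l| 1 with h | h
    · calc (1 + |l|) ^ α ≤ 2 ^ α := by gcongr; linarith
        _ ≤ 2 ^ α * (1 + |l| ^ α) := le_mul_of_one_le_right (by positivity) (by linarith)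
    · calc (1 + |l|) ^ α ≤ (2 * |l|) ^ α := by gcongr; linarith
        _ = 2 ^ α * |l| ^ α := Real.mul_rpow (by norm_num) (abs_nonneg _)
        _ ≤ 2 ^ α * (1 + |l| ^ α) := by gcongr; linarith
  refine h1.trans ?_
  rw [mul_assoc]
  gcongr
  have h2 : |l| ^ α = c⁻¹ * (c * |l| ^ α) := by field_simp
  have h3 : c⁻¹ * (c * |l| ^ α) ≤ c⁻¹ * x := by gcongr
  have h4 : 0 ≤ c⁻¹ := by positivity
  nlinarith

lemma integrable_one_add_abs_rpow_sq {α : ℝ} (hα : 1 / 2 < α) (K K' : ℝ) :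
    Integrable fun l : ℝ => K * (1 + |l|) ^ (-α) * (K' * (1 + |l|) ^ (-α)) := by
  have h : Integrable fun l : ℝ => (1 + ‖l‖) ^ (-(2 * α)) :=
    integrable_one_add_norm (by rw [Module.finrank_self]; push_cast; linarith)
  refine (h.const_mul (K * K')).congr (.of_forall fun l => ?_)
  have h1 : (1 + ‖l‖) ^ (-(2 * α)) = (1 + |l|) ^ (-α) * (1 + |l|) ^ (-α) := by
    rw [← Real.rpow_add (by positivity), Real.norm_eq_abs]
    congr 1
    ring
  simp only [h1]
  ring

section Kernel

variable {α β μ : ℝ}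

lemma continuous_mittagLeffler_rpow (hα : 0 ≤ α) (hβ : 0 < β) (c : ℝ) :
    Continuous fun l : ℝ => mittagLeffler β (c * |l| ^ α) :=
  (continuous_mittagLeffler hβ).comp
    (continuous_const.mul (continuous_abs.rpow_const fun _ => Or.inr hα))

lemma exists_kernel_bound (hα : 0 < α) (hβ : β ∈ Set.Ioc (0 : ℝ) 1) (hμ : 0 < μ) {t : ℝ}
    (ht : 0 < t) :
    ∃ K, 0 < K ∧ ∀ l, |mittagLeffler β (-μ * t ^ β * |l| ^ α)| ≤ K * (1 + |l|) ^ (-α) := by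
  obtain ⟨K, hK0, hK⟩ := exists_abs_mittagLeffler_neg_le_rpow hα hβ
    (show 0 < μ * t ^ β by positivity)
  refine ⟨K, hK0, fun l => ?_⟩
  rw [show -μ * t ^ β * |l| ^ α = -(μ * t ^ β * |l| ^ α) by ring]
  exact hK l _ le_rfl

lemma integrable_kernel_mul (hα : 1 / 2 < α) (hβ : β ∈ Set.Ioc (0 : ℝ) 1) (hμ : 0 < μ) {t t' : ℝ}
    (ht : 0 < t) (ht' : 0 < t') :
    Integrable fun l : ℝ => mittagLeffler β (-μ * t ^ β * |l| ^ α) *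
      mittagLeffler β (-μ * t' ^ β * |l| ^ α) := by
  have hα0 : 0 < α := by linarith
  obtain ⟨K, hK0, hK⟩ := exists_kernel_bound hα0 hβ hμ ht
  obtain ⟨K', hK0', hK'⟩ := exists_kernel_bound hα0 hβ hμ ht'
  refine (integrable_one_add_abs_rpow_sq hα K K').mono'
    ((continuous_mittagLeffler_rpow hα0.le hβ.1 _).mul
      (continuous_mittagLeffler_rpow hα0.le hβ.1 _)).aestronglyMeasurable (.of_forall fun l => ?_)
  rw [norm_mul]
  exact mul_le_mul (hK l) (hK' l) (norm_nonneg _) (by positivity)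

lemma integrable_cos_mul_kernel (hα : 1 / 2 < α) (hβ : β ∈ Set.Ioc (0 : ℝ) 1) (hμ : 0 < μ)
    {t t' : ℝ} (ht : 0 < t) (ht' : 0 < t') (d : ℝ) :
    Integrable fun l : ℝ => Real.cos (l * d) * mittagLeffler β (-μ * t ^ β * |l| ^ α) *
      mittagLeffler β (-μ * t' ^ β * |l| ^ α) := by
  simp only [mul_assoc (Real.cos _)]
  refine Integrable.bdd_mul (c := 1) (integrable_kernel_mul hα hβ hμ ht ht')
    (Continuous.aestronglyMeasurable (by fun_prop)) (.of_forall fun l => ?_)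
  rw [Real.norm_eq_abs]
  exact Real.abs_cos_le_one _

lemma memLp_limitKernel (hα : 1 / 2 < α) (hβ : β ∈ Set.Ioc (0 : ℝ) 1) (hμ : 0 < μ) {t : ℝ}
    (ht : 0 < t) (x : ℝ) : MemLp (limitKernel α β μ t x) 2 volume := by
  have hc := continuous_mittagLeffler_rpow (show 0 ≤ α by linarith) hβ.1 (-μ * t ^ β)
  have hm : Continuous (limitKernel α β μ t x) := by
    unfold limitKernel
    exact Continuous.mul (by fun_prop) (Complex.continuous_ofReal.comp hc)
  rw [memLp_two_iff_integrable_sq_norm hm.aestronglyMeasurable]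
  refine (integrable_kernel_mul hα hβ hμ ht ht).congr (.of_forall fun l => ?_)
  simp only [limitKernel]
  rw [norm_mul, show Complex.I * l * x = ((l * x : ℝ) : ℂ) * Complex.I by push_cast; ring,
    Complex.norm_exp_ofReal_mul_I, one_mul, Complex.norm_real, Real.norm_eq_abs, sq_abs, sq]

/-- The integral of an even function of this form over the line. -/
lemma integral_cos_mul_kernel (t t' d : ℝ) :
    ∫ l : ℝ, Real.cos (l * d) * mittagLeffler β (-μ * t ^ β * |l| ^ α) *
      mittagLeffler β (-μ * t' ^ β * |l| ^ α) =
    2 * ∫ l in Set.Ioi (0 : ℝ), Real.cos (l * d) * mittagLeffler β (-μ * t ^ β * |l| ^ α) *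
      mittagLeffler β (-μ * t' ^ β * |l| ^ α) := by
  rw [← integral_comp_abs (f := fun l => Real.cos (l * d) *
    mittagLeffler β (-μ * t ^ β * |l| ^ α) * mittagLeffler β (-μ * t' ^ β * |l| ^ α))]
  refine integral_congr_ae (.of_forall fun l => ?_)
  simp only [abs_abs]
  congr 2
  rcases abs_choice l with h | h
  · rw [h]
  · rw [h, neg_mul, Real.cos_neg]

/-- The integrand is continuous, nonnegative and equal to 1 at 0. Strict positivity allows dividing
by this integral to obtain the sign of `f(0)`. -/
lemma integral_kernel_sq_pos (hα : 1 / 2 < α) (hβ : β ∈ Set.Ioc (0 : ℝ) 1) (hμ : 0 < μ) {t : ℝ}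
    (ht : 0 < t) :
    0 < ∫ l : ℝ, mittagLeffler β (-μ * t ^ β * |l| ^ α) *
      mittagLeffler β (-μ * t ^ β * |l| ^ α) := by
  have hα0 : 0 < α := by linarith
  have hc := continuous_mittagLeffler_rpow hα0.le hβ.1 (-μ * t ^ β)
  refine integral_pos_of_integrable_nonneg_nonzero (x := 0) (hc.mul hc)
    (integrable_kernel_mul hα hβ hμ ht ht) (fun l => mul_self_nonneg _) ?_
  rw [abs_zero, Real.zero_rpow hα0.ne', mul_zero, mittagLeffler_zero]
  norm_num

end Kernel

section Limit

variable {α β γ μ : ℝ}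

/-- The Riesz part is homogeneous and absorbs the scaling, while the Bessel part is evaluated at `h
l` and tends to 1; this is why `γ` disappears in the limit. -/
lemma symbol_eq {h : ℝ} (hh : 0 < h) (l : ℝ) :
    symbol α γ (h * (l / (2 * Real.pi))) / h ^ α = |l| ^ α * (1 + |h * l| ^ 2) ^ (γ / 2) := by
  have h1 : 2 * Real.pi * (h * (l / (2 * Real.pi))) = h * l := by
    field_simp
  rw [symbol, h1, abs_mul h l, abs_of_pos hh, Real.mul_rpow hh.le (abs_nonneg _)]
  field_simp

lemma rpow_le_symbol (hγ : 0 ≤ γ) (ξ : ℝ) : |2 * Real.pi * ξ| ^ α ≤ symbol α γ ξ := by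
  rw [symbol]
  refine le_mul_of_one_le_right (by positivity) (Real.one_le_rpow ?_ (by positivity))
  nlinarith [sq_nonneg |2 * Real.pi * ξ|]

/-- Near the zero frequency the covariance concentrates on the value of the spectral density. -/
lemma tendsto_low_frequency (hα : 1 / 2 < α) (hβ : β ∈ Set.Ioc (0 : ℝ) 1) (hγ : 0 ≤ γ) (hμ : 0 < μ)
    {F : ℝ → ℝ} (hF : Integrable F) (hF0 : ContinuousAt F 0) {B : ℝ} (hB : ∀ ξ, |F ξ| ≤ B)
    {t t' : ℝ} (ht : 0 < t) (ht' : 0 < t') (d : ℝ) :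
    Tendsto (fun h : ℝ => h⁻¹ * ∫ ξ, Real.cos (2 * Real.pi * (d / h) * ξ) *
      (mittagLeffler β (-μ * (t ^ β / h ^ α) * symbol α γ ξ) *
        mittagLeffler β (-μ * (t' ^ β / h ^ α) * symbol α γ ξ)) * F ξ) (𝓝[>] 0)
      (𝓝 (F 0 / (2 * Real.pi) * ∫ l : ℝ, Real.cos (l * d) *
        mittagLeffler β (-μ * t ^ β * |l| ^ α) * mittagLeffler β (-μ * t' ^ β * |l| ^ α))) := by
  have hα0 : 0 < α := by linarith
  have hπ := Real.pi_pos
  obtain ⟨K, hK0, hK⟩ := exists_abs_mittagLeffler_neg_le_rpow hα0 hβ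
    (show 0 < μ * t ^ β by positivity)
  obtain ⟨K', hK0', hK'⟩ := exists_abs_mittagLeffler_neg_le_rpow hα0 hβ
    (show 0 < μ * t' ^ β by positivity)
  let s : ℝ → ℝ → ℝ := fun h l => |l| ^ α * (1 + |h * l| ^ 2) ^ (γ / 2)
  have hs : ∀ h l, |l| ^ α ≤ s h l := fun h l =>
    le_mul_of_one_le_right (by positivity)
      (Real.one_le_rpow (by nlinarith [sq_nonneg |h * l|]) (by positivity))
  have hsc : ∀ h, Continuous (s h) := fun h =>
    (continuous_abs.rpow_const fun _ => Or.inr hα0.le).mul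
      (Continuous.rpow_const (by fun_prop) fun _ => Or.inr (by positivity))
  have hsl : ∀ l, Tendsto (fun h => s h l) (𝓝[>] 0) (𝓝 (|l| ^ α)) := fun l => by
    have h1 : Continuous fun h : ℝ => s h l :=
      continuous_const.mul (Continuous.rpow_const (by fun_prop) fun _ => Or.inr (by positivity))
    have h2 := (h1.tendsto 0).mono_left (nhdsWithin_le_nhds (s := Set.Ioi 0))
    simpa [s] using h2
  have hEc := continuous_mittagLeffler hβ.1
  -- Substituting `ξ = h l / 2π`: the Jacobian cancels `h⁻¹` and leaves `1 / 2π`.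
  have hsub : ∀ h : ℝ, 0 < h → (∫ l, Real.cos (l * d) * (mittagLeffler β (-μ * t ^ β * s h l) *
      mittagLeffler β (-μ * t' ^ β * s h l)) * F (h * (l / (2 * Real.pi)))) / (2 * Real.pi) =
      h⁻¹ * ∫ ξ, Real.cos (2 * Real.pi * (d / h) * ξ) *
      (mittagLeffler β (-μ * (t ^ β / h ^ α) * symbol α γ ξ) *
        mittagLeffler β (-μ * (t' ^ β / h ^ α) * symbol α γ ξ)) * F ξ := by
    intro h hh
    have e1 := Measure.integral_comp_mul_left (fun ξ => Real.cos (2 * Real.pi * (d / h) * ξ) *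
      (mittagLeffler β (-μ * (t ^ β / h ^ α) * symbol α γ ξ) *
        mittagLeffler β (-μ * (t' ^ β / h ^ α) * symbol α γ ξ)) * F ξ) (h / (2 * Real.pi))
    rw [abs_of_pos (by positivity), smul_eq_mul, inv_div] at e1
    have e2 : ∀ l : ℝ, Real.cos (l * d) * (mittagLeffler β (-μ * t ^ β * s h l) *
        mittagLeffler β (-μ * t' ^ β * s h l)) * F (h * (l / (2 * Real.pi))) =
        Real.cos (2 * Real.pi * (d / h) * (h / (2 * Real.pi) * l)) *
        (mittagLeffler β (-μ * (t ^ β / h ^ α) * symbol α γ (h / (2 * Real.pi) * l)) *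
          mittagLeffler β (-μ * (t' ^ β / h ^ α) * symbol α γ (h / (2 * Real.pi) * l))) *
          F (h / (2 * Real.pi) * l) := fun l => by
      rw [show h / (2 * Real.pi) * l = h * (l / (2 * Real.pi)) by ring]
      have e3 : ∀ c : ℝ, -μ * (c / h ^ α) * symbol α γ (h * (l / (2 * Real.pi))) =
          -μ * c * s h l := fun c => by
        have e4 : s h l = symbol α γ (h * (l / (2 * Real.pi))) / h ^ α := (symbol_eq hh l).symm
        rw [e4]
        ring
      rw [e3, e3, show 2 * Real.pi * (d / h) * (h * (l / (2 * Real.pi))) = l * d by field_simp]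
    simp only [e2]
    rw [e1, mul_div_right_comm]
    congr 1
    field_simp
  refine Tendsto.congr' (f₁ := fun h => (∫ l, Real.cos (l * d) *
    (mittagLeffler β (-μ * t ^ β * s h l) * mittagLeffler β (-μ * t' ^ β * s h l)) *
      F (h * (l / (2 * Real.pi)))) / (2 * Real.pi))
    (by filter_upwards [self_mem_nhdsWithin] with h hh using hsub h hh) ?_
  rw [div_mul_eq_mul_div]
  refine Tendsto.div_const ?_ _
  rw [mul_comm (F 0), ← integral_mul_const]
  refine tendsto_integral_filter_of_dominated_convergence
    (fun l => K * (1 + |l|) ^ (-α) * (K' * (1 + |l|) ^ (-α)) * B) ?_ ?_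
    ((integrable_one_add_abs_rpow_sq hα K K').mul_const B) (.of_forall fun l => ?_)
  · filter_upwards [self_mem_nhdsWithin] with h hh
    have h1 := hsc h
    refine (Continuous.aestronglyMeasurable (by fun_prop)).mul ?_
    have h2 := hF.comp_mul_left' (R := h / (2 * Real.pi)) (by have : (0 : ℝ) < h := hh; positivity)
    refine h2.1.congr (.of_forall fun l => ?_)
    simp only
    congr 1
    ring
  · refine .of_forall fun h => .of_forall fun l => ?_
    have hE : ∀ {c K : ℝ}, 0 ≤ c → (∀ l x, μ * c * |l| ^ α ≤ x →
        |mittagLeffler β (-x)| ≤ K * (1 + |l|) ^ (-α)) →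
        |mittagLeffler β (-μ * c * s h l)| ≤ K * (1 + |l|) ^ (-α) := fun {c K} hc hK => by
      rw [show -μ * c * s h l = -(μ * c * s h l) by ring]
      refine hK l _ ?_
      have := hs h l
      gcongr
    rw [norm_mul, norm_mul, norm_mul]
    simp only [Real.norm_eq_abs]
    refine mul_le_mul ?_ (hB _) (abs_nonneg _) (by positivity)
    calc _ ≤ 1 * (K * (1 + |l|) ^ (-α) * (K' * (1 + |l|) ^ (-α))) := by
          gcongr
          · exact Real.abs_cos_le_one _
          · exact hE (by positivity) hK
          · exact hE (by positivity) hK'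
      _ = _ := one_mul _
  · have h1 : ∀ c, Tendsto (fun h => mittagLeffler β (-μ * c * s h l)) (𝓝[>] 0)
        (𝓝 (mittagLeffler β (-μ * c * |l| ^ α))) := fun c =>
      (hEc.tendsto _).comp ((hsl l).const_mul _)
    have h2 : Tendsto (fun h : ℝ => h * (l / (2 * Real.pi))) (𝓝[>] 0) (𝓝 0) := by
      have h3 : Continuous fun h : ℝ => h * (l / (2 * Real.pi)) := by fun_prop
      have := (h3.tendsto 0).mono_left (nhdsWithin_le_nhds (s := Set.Ioi 0))
      simpa using this
    have h4 : Tendsto (fun h : ℝ => F (h * (l / (2 * Real.pi)))) (𝓝[>] 0) (𝓝 (F 0)) :=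
      Tendsto.comp hF0 h2
    simp only [mul_assoc (Real.cos _)]
    have := (((h1 (t ^ β)).mul (h1 (t' ^ β))).const_mul (Real.cos (l * d))).mul h4
    simpa only [mul_assoc] using this

/-- Frequencies away from zero do not contribute to the limit. -/
lemma tendsto_high_frequency (hα : 1 / 2 < α) (hβ : β ∈ Set.Ioc (0 : ℝ) 1) (hγ : 0 ≤ γ)
    (hμ : 0 < μ) {F : ℝ → ℝ} (hF : Integrable F) {δ : ℝ} (hδ : 0 < δ)
    (hFδ : ∀ ξ, |ξ| < δ → F ξ = 0) {t t' : ℝ} (ht : 0 < t) (ht' : 0 < t') (d : ℝ) :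
    Tendsto (fun h : ℝ => h⁻¹ * ∫ ξ, Real.cos (2 * Real.pi * (d / h) * ξ) *
      (mittagLeffler β (-μ * (t ^ β / h ^ α) * symbol α γ ξ) *
        mittagLeffler β (-μ * (t' ^ β / h ^ α) * symbol α γ ξ)) * F ξ) (𝓝[>] 0) (𝓝 0) := by
  have hα0 : 0 < α := by linarith
  have hπ := Real.pi_pos
  obtain ⟨C, hC0, hC⟩ := exists_abs_mittagLeffler_neg_le hβ
  -- For `|ξ| ≥ δ` the symbol is at least `(2πδ)^α`, so the argument of `E_β` is of order `h^(-α)`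
  -- or larger and the decay bound gives `b t * h^α`.
  let b : ℝ → ℝ := fun t => C / (μ * t ^ β * (2 * Real.pi * δ) ^ α)
  have hb : ∀ {t : ℝ}, 0 < t → ∀ {h : ℝ}, 0 < h → ∀ ξ, δ ≤ |ξ| →
      |mittagLeffler β (-μ * (t ^ β / h ^ α) * symbol α γ ξ)| ≤ b t * h ^ α := by
    intro t ht h hh ξ hξ
    have h1 : (2 * Real.pi * δ) ^ α ≤ symbol α γ ξ := by
      refine le_trans ?_ (rpow_le_symbol hγ ξ)
      rw [abs_mul, abs_of_pos (show 0 < 2 * Real.pi by positivity)]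
      gcongr
    have h0 : 0 < symbol α γ ξ := lt_of_lt_of_le (by positivity) h1
    rw [show -μ * (t ^ β / h ^ α) * symbol α γ ξ = -(μ * (t ^ β / h ^ α) * symbol α γ ξ) by ring]
    refine (hC _ (by positivity)).trans ?_
    calc C / (1 + μ * (t ^ β / h ^ α) * symbol α γ ξ)
        ≤ C / (μ * (t ^ β / h ^ α) * (2 * Real.pi * δ) ^ α) := by
          gcongr
          refine le_trans ?_ (le_add_of_nonneg_left zero_le_one)
          gcongr
      _ = b t * h ^ α := by
          simp only [b]
          field_simp
  have hb0 : ∀ {t : ℝ}, 0 < t → 0 ≤ b t := fun ht => by positivity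
  -- Two factors `h^α` against the prefactor `h⁻¹`; the exponent is positive because `α > 1/2`.
  have hlim : Tendsto (fun h : ℝ => h ^ (2 * α - 1) * (b t * b t' * ∫ ξ, ‖F ξ‖)) (𝓝[>] 0) (𝓝 0) := by
    have h1 : Tendsto (fun h : ℝ => h ^ (2 * α - 1)) (𝓝[>] 0) (𝓝 0) := by
      have h2 := (Real.continuousAt_rpow_const 0 (2 * α - 1) (Or.inr (by linarith))).tendsto
      rw [Real.zero_rpow (by linarith)] at h2
      exact h2.mono_left nhdsWithin_le_nhds
    simpa using h1.mul_const (b t * b t' * ∫ ξ, ‖F ξ‖)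
  refine squeeze_zero_norm' ?_ hlim
  filter_upwards [self_mem_nhdsWithin] with h hh
  have hh0 : 0 < h := hh
  have h1 : ‖∫ ξ, Real.cos (2 * Real.pi * (d / h) * ξ) *
      (mittagLeffler β (-μ * (t ^ β / h ^ α) * symbol α γ ξ) *
        mittagLeffler β (-μ * (t' ^ β / h ^ α) * symbol α γ ξ)) * F ξ‖ ≤
      ∫ ξ, b t * h ^ α * (b t' * h ^ α) * ‖F ξ‖ := by
    refine norm_integral_le_of_norm_le (hF.norm.const_mul _) (.of_forall fun ξ => ?_)
    rcases lt_or_ge |ξ| δ with hξ | hξ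
    · simp [hFδ ξ hξ]
    rw [norm_mul, norm_mul, norm_mul]
    simp only [Real.norm_eq_abs]
    refine mul_le_mul_of_nonneg_right ?_ (abs_nonneg _)
    have := hb0 ht
    calc _ ≤ 1 * (b t * h ^ α * (b t' * h ^ α)) := by
          gcongr
          · exact Real.abs_cos_le_one _
          · exact hb ht hh0 ξ hξ
          · exact hb ht' hh0 ξ hξ
      _ = _ := one_mul _
  rw [norm_mul, norm_inv, Real.norm_of_nonneg hh0.le]
  refine (mul_le_mul_of_nonneg_left h1 (by positivity)).trans_eq ?_
  rw [integral_const_mul, show 2 * α - 1 = α + α - 1 by ring, Real.rpow_sub hh0, Real.rpow_add hh0,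
    Real.rpow_one]
  field_simp

/-- The scaling limit of a covariance function with integrable spectral density `F`. -/
lemma tendsto_scaled_covariance (hα : 1 / 2 < α) (hβ : β ∈ Set.Ioc (0 : ℝ) 1) (hγ : 0 ≤ γ)
    (hμ : 0 < μ) {F : ℝ → ℝ} (hF : Integrable F) (hF0 : ContinuousAt F 0)
    {t t' : ℝ} (ht : 0 < t) (ht' : 0 < t') (d : ℝ) :
    Tendsto (fun h : ℝ => h⁻¹ * ∫ ξ, Real.cos (2 * Real.pi * (d / h) * ξ) *
      (mittagLeffler β (-μ * (t ^ β / h ^ α) * symbol α γ ξ) *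
        mittagLeffler β (-μ * (t' ^ β / h ^ α) * symbol α γ ξ)) * F ξ) (𝓝[>] 0)
      (𝓝 (F 0 / (2 * Real.pi) * ∫ l : ℝ, Real.cos (l * d) *
        mittagLeffler β (-μ * t ^ β * |l| ^ α) * mittagLeffler β (-μ * t' ^ β * |l| ^ α))) := by
  have hα0 : 0 < α := by linarith
  -- `F` is not assumed bounded. Continuity at 0 bounds it by `|F 0| + 1` on a ball, where the
  -- low-frequency lemma applies; outside, integrability is enough.
  obtain ⟨δ, hδ, hFδ⟩ := Metric.continuousAt_iff.1 hF0 1 one_pos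
  have hS : MeasurableSet (Metric.ball (0 : ℝ) δ) := measurableSet_ball
  have hF1 : Integrable ((Metric.ball (0 : ℝ) δ).indicator F) := hF.indicator hS
  have hF2 : Integrable ((Metric.ball (0 : ℝ) δ)ᶜ.indicator F) := hF.indicator hS.compl
  have h0 : (0 : ℝ) ∈ Metric.ball (0 : ℝ) δ := Metric.mem_ball_self hδ
  have h1 := tendsto_low_frequency hα hβ hγ hμ hF1 (B := |F 0| + 1)
    (hF0.congr (by
      filter_upwards [Metric.ball_mem_nhds (0 : ℝ) hδ] with ξ hξ
      rw [Set.indicator_of_mem hξ]))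
    (fun ξ => by
      by_cases hξ : ξ ∈ Metric.ball (0 : ℝ) δ
      · rw [Set.indicator_of_mem hξ]
        have h2 := hFδ hξ
        rw [Real.dist_eq] at h2
        have h3 := abs_add_le (F ξ - F 0) (F 0)
        rw [sub_add_cancel] at h3
        linarith
      · rw [Set.indicator_of_notMem hξ, abs_zero]
        positivity) ht ht' d
  have h2 := tendsto_high_frequency hα hβ hγ hμ hF2 hδ
    (fun ξ hξ => Set.indicator_of_notMem (by simpa using hξ) _) ht ht' d
  rw [Set.indicator_of_mem h0] at h1
  have h3 := h1.add h2
  rw [add_zero] at h3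
  refine h3.congr' ?_
  filter_upwards [self_mem_nhdsWithin] with h hh
  have hh0 : 0 < h := hh
  have hsc := continuous_symbol (γ := γ) hα0.le
  have hEc := continuous_mittagLeffler hβ.1
  obtain ⟨C, hC0, hC⟩ := exists_abs_mittagLeffler_neg_le hβ
  have hE : ∀ {t : ℝ}, 0 < t → ∀ ξ,
      |mittagLeffler β (-μ * (t ^ β / h ^ α) * symbol α γ ξ)| ≤ C := fun {t} ht ξ => by
    have h0 : 0 ≤ μ * (t ^ β / h ^ α) * symbol α γ ξ := by
      have := symbol_nonneg α γ ξ
      positivity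
    have := hC _ h0
    rw [← neg_mul, ← neg_mul] at this
    exact this.trans (div_le_self hC0.le (by linarith))
  have hint : ∀ G : ℝ → ℝ, Integrable G → Integrable fun ξ =>
      Real.cos (2 * Real.pi * (d / h) * ξ) *
      (mittagLeffler β (-μ * (t ^ β / h ^ α) * symbol α γ ξ) *
        mittagLeffler β (-μ * (t' ^ β / h ^ α) * symbol α γ ξ)) * G ξ := fun G hG => by
    refine Integrable.bdd_mul (c := 1 * (C * C)) hG
      (Continuous.aestronglyMeasurable (by fun_prop)) (.of_forall fun ξ => ?_)
    rw [norm_mul, norm_mul]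
    simp only [Real.norm_eq_abs]
    gcongr
    · exact Real.abs_cos_le_one _
    · exact hE ht ξ
    · exact hE ht' ξ
  rw [← mul_add, ← integral_add (hint _ hF1) (hint _ hF2)]
  congr 1
  refine integral_congr_ae (.of_forall fun ξ => ?_)
  simp only
  rw [← mul_add]
  congr 1
  exact congrFun (Set.indicator_self_add_compl _ F) ξ

end Limit

/-- The limit of the covariances of the rescaled solution. -/
theorem IsHilbertSolution.tendsto_inner_rescaled {E : Type*} [NormedAddCommGroup E]
    [InnerProductSpace ℝ E] [CompleteSpace E] {α β γ μ : ℝ} {v : ℝ → ℝ → E} {r F : ℝ → ℝ}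
    (hv : IsHilbertSolution α β γ μ v) (hα : 1 / 2 < α)
    (hβ : β ∈ Set.Ioc (0 : ℝ) 1) (hγ : 0 ≤ γ) (hμ : 0 < μ)
    (hr : ∀ x y, inner ℝ (v 0 x) (v 0 y) = r (x - y))
    (hF : Integrable F) (hF0 : ContinuousAt F 0) (hrF : ∀ x, 𝓕 (fun k => (F k : ℂ)) x = (r x : ℂ))
    {t t' : ℝ} (ht : 0 < t) (ht' : 0 < t') (x x' : ℝ) :
    Tendsto (fun ε : ℝ => inner ℝ (ε ^ (-(β / (2 * α))) • v (t / ε) (x / ε ^ (β / α)))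
      (ε ^ (-(β / (2 * α))) • v (t' / ε) (x' / ε ^ (β / α)))) (𝓝[>] 0)
      (𝓝 (F 0 / (2 * Real.pi) * ∫ l : ℝ, Real.cos (l * (x - x')) *
        mittagLeffler β (-μ * t ^ β * |l| ^ α) * mittagLeffler β (-μ * t' ^ β * |l| ^ α))) := by
  have hα0 : 0 < α := by linarith
  have hβ0 := hβ.1
  have hq : 0 < β / α := by positivity
  have h1 : Tendsto (fun ε : ℝ => ε ^ (β / α)) (𝓝[>] 0) (𝓝[>] 0) := by
    refine tendsto_nhdsWithin_of_tendsto_nhds_of_eventually_within _ ?_ ?_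
    · have h2 := (Real.continuousAt_rpow_const 0 (β / α) (Or.inr hq.le)).tendsto
      rw [Real.zero_rpow hq.ne'] at h2
      exact h2.mono_left nhdsWithin_le_nhds
    · filter_upwards [self_mem_nhdsWithin] with ε hε
      exact Real.rpow_pos_of_pos hε _
  -- With `h = ε^(β/α)` one has `(t/ε)^β = t^β / h^α`, and the two normalising factors multiply to
  -- `h⁻¹`.
  refine ((tendsto_scaled_covariance hα hβ hγ hμ hF hF0 ht ht' (x - x')).comp h1).congr' ?_
  filter_upwards [self_mem_nhdsWithin] with ε hε
  have hε0 : 0 < ε := hε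
  rw [real_inner_smul_left, real_inner_smul_right,
    hv.inner_eq hα hβ hμ hr hF hrF (div_pos ht hε0) (div_pos ht' hε0), ← mul_assoc,
    ← Real.rpow_add hε0]
  have e1 : ε ^ (-(β / (2 * α)) + -(β / (2 * α))) = (ε ^ (β / α))⁻¹ := by
    rw [← Real.rpow_neg hε0.le]
    congr 1
    field_simp
    ring
  have e2 : (ε ^ (β / α)) ^ α = ε ^ β := by
    rw [← Real.rpow_mul hε0.le]
    congr 1
    field_simp
  rw [e1, Function.comp_apply, e2, Real.div_rpow ht.le hε0.le, Real.div_rpow ht'.le hε0.le, sub_div]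

/-! ### Gaussian Hilbert spaces -/

section Gaussian

variable {Ω : Type*} [MeasurableSpace Ω] {P : Measure Ω}

lemma real_inner_Lp_eq_integral {f g : Lp ℝ 2 P} {X Y : Ω → ℝ} (hX : X =ᵐ[P] f) (hY : Y =ᵐ[P] g) :
    inner ℝ f g = ∫ ω, X ω * Y ω ∂P := by
  rw [L2.inner_def]
  refine integral_congr_ae ?_
  filter_upwards [hX, hY] with ω h1 h2
  rw [h1, h2, RCLike.inner_apply, conj_trivial, mul_comm]

lemma coeFn_sum_smul {ι : Type*} (I : Finset ι) (c : ι → ℝ) (Y : ι → Lp ℝ 2 P) :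
    ⇑(∑ i ∈ I, c i • Y i) =ᵐ[P] fun ω => ∑ i ∈ I, c i * Y i ω := by
  classical
  induction I using Finset.induction_on with
  | empty =>
    simp only [Finset.sum_empty]
    exact Lp.coeFn_zero _ _ _
  | insert i I hi ih =>
    rw [Finset.sum_insert hi]
    filter_upwards [Lp.coeFn_add (c i • Y i) (∑ i ∈ I, c i • Y i), Lp.coeFn_smul (c i) (Y i), ih]
      with ω h1 h2 h3
    rw [h1, Pi.add_apply, h2, h3, Pi.smul_apply, smul_eq_mul, Finset.sum_insert hi]

/-- Gaussianity is recorded only by the characteristic function at 1, with the `L²` norm as standard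
deviation. This condition survives `L²` limits and, imposed on a whole subspace, determines all
joint laws by the Cramér–Wold principle. -/
lemma integral_exp_of_hasGaussianLaw {f : Lp ℝ 2 P} (h : HasGaussianLaw f P)
    (h0 : ∫ ω, f ω ∂P = 0) :
    ∫ ω, Complex.exp (f ω * Complex.I) ∂P = Complex.exp (-(‖f‖ ^ 2 : ℝ) / 2) := by
  have h1 : Var[f; P] = ‖f‖ ^ 2 := by
    rw [variance_of_integral_eq_zero h.aemeasurable h0, ← real_inner_self_eq_norm_sq,
      real_inner_Lp_eq_integral ae_eq_rfl ae_eq_rfl]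
    simp only [sq]
  have h2 := charFun_gaussianReal (μ := 0) (v := Var[f; P].toNNReal) 1
  rw [← h0, ← h.map_eq_gaussianReal, charFun_apply_real,
    integral_map h.aemeasurable (Continuous.aestronglyMeasurable (by fun_prop)), h0, h1,
    Real.coe_toNNReal _ (sq_nonneg _)] at h2
  simp only [Complex.ofReal_one, one_mul, Complex.ofReal_zero, zero_mul, zero_sub, one_pow,
    mul_one] at h2
  rw [h2, neg_div]

lemma integral_norm_le_norm [IsProbabilityMeasure P] (f : Lp ℝ 2 P) : ∫ ω, ‖f ω‖ ∂P ≤ ‖f‖ := by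
  rw [integral_norm_eq_lintegral_enorm (Lp.aestronglyMeasurable f), ← eLpNorm_one_eq_lintegral_enorm,
    Lp.norm_def]
  exact ENNReal.toReal_mono (Lp.eLpNorm_ne_top f)
    (eLpNorm_le_eLpNorm_of_exponent_le (by norm_num) (Lp.aestronglyMeasurable f))

lemma norm_exp_mul_I_sub_le (a b : ℝ) :
    ‖Complex.exp (a * Complex.I) - Complex.exp (b * Complex.I)‖ ≤ |a - b| := by
  have h1 : Complex.exp (a * Complex.I) - Complex.exp (b * Complex.I) =
      Complex.exp (b * Complex.I) * (Complex.exp (Complex.I * ((a - b : ℝ) : ℂ)) - 1) := by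
    rw [mul_sub, mul_one, ← Complex.exp_add]
    congr 2
    push_cast
    ring
  rw [h1, norm_mul, Complex.norm_exp_ofReal_mul_I, one_mul]
  exact Real.norm_exp_I_mul_ofReal_sub_one_le

lemma continuous_integral_exp [IsProbabilityMeasure P] :
    Continuous fun f : Lp ℝ 2 P => ∫ ω, Complex.exp (f ω * Complex.I) ∂P := by
  have hint : ∀ f : Lp ℝ 2 P, Integrable (fun ω => Complex.exp (f ω * Complex.I)) P := fun f => by
    have h1 : Continuous fun x : ℝ => Complex.exp (x * Complex.I) := by fun_prop
    refine (integrable_const (1 : ℝ)).mono'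
      (h1.comp_aestronglyMeasurable (Lp.aestronglyMeasurable f)) (.of_forall fun ω => ?_)
    rw [Complex.norm_exp_ofReal_mul_I]
  refine (LipschitzWith.of_dist_le_mul (K := 1) fun f g => ?_).continuous
  rw [dist_eq_norm, dist_eq_norm, ← integral_sub (hint f) (hint g), NNReal.coe_one, one_mul]
  have hfg : (fun ω => ‖(f - g) ω‖) =ᵐ[P] fun ω => |f ω - g ω| := by
    filter_upwards [Lp.coeFn_sub f g] with ω hω
    rw [hω, Pi.sub_apply, Real.norm_eq_abs]
  have hfgi : Integrable (fun ω => |f ω - g ω|) P :=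
    (((Lp.memLp (f - g)).integrable (by norm_num)).norm).congr hfg
  refine (norm_integral_le_of_norm_le hfgi (.of_forall fun ω =>
    norm_exp_mul_I_sub_le (f ω) (g ω))).trans ?_
  rw [← integral_congr_ae hfg]
  exact integral_norm_le_norm _

/-- Every element of the closed linear span of a centred Gaussian process is centred Gaussian. -/
theorem integral_exp_of_mem_closure_span {T : Type*} {X : T → Ω → ℝ} (hX : IsGaussianProcess X P)
    (hX0 : ∀ t, ∫ ω, X t ω ∂P = 0) {Y : T → Lp ℝ 2 P} (hXY : ∀ t, X t =ᵐ[P] Y t) {f : Lp ℝ 2 P}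
    (hf : f ∈ (Submodule.span ℝ (Set.range Y)).topologicalClosure) :
    ∫ ω, Complex.exp (f ω * Complex.I) ∂P = Complex.exp (-(‖f‖ ^ 2 : ℝ) / 2) := by
  have hP : IsProbabilityMeasure P := hX.isProbabilityMeasure
  have hcl : IsClosed {f : Lp ℝ 2 P | ∫ ω, Complex.exp (f ω * Complex.I) ∂P =
      Complex.exp (-(‖f‖ ^ 2 : ℝ) / 2)} :=
    isClosed_eq continuous_integral_exp (by fun_prop)
  -- The identity is a closed condition on `f`, so it passes from finite combinations, where joint
  -- Gaussianity gives it, to the closed span.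
  refine closure_minimal ?_ hcl hf
  intro g hg
  obtain ⟨c, rfl⟩ := Finsupp.mem_span_range_iff_exists_finsupp.1 hg
  have hY : IsGaussianProcess (fun t => ⇑(Y t)) P := hX.congr hXY
  have hsum : ⇑(c.sum fun i a => a • Y i) =ᵐ[P] fun ω => ∑ i ∈ c.support, c i * Y i ω :=
    coeFn_sum_smul c.support c Y
  refine integral_exp_of_hasGaussianLaw ?_ ?_
  · exact ((hY.smul c).hasGaussianLaw_fun_sum (I := c.support)).congr hsum.symm
  · rw [integral_congr_ae hsum, integral_finsetSum _ fun i _ =>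
      ((Lp.memLp (Y i)).integrable (by norm_num)).const_mul _]
    refine Finset.sum_eq_zero fun i _ => ?_
    rw [integral_const_mul, ← integral_congr_ae (hXY i), hX0, mul_zero]

/-- The joint characteristic function at `a` is the scalar one of `∑ a k • V k`, which again lies in
`S`; expanding its squared norm gives the covariance form. -/
lemma charFun_map_toLp {m : ℕ} {X : Ω → Fin m → ℝ} (hX : AEMeasurable X P) {V : Fin m → Lp ℝ 2 P}
    (hXV : ∀ k, (fun ω => X ω k) =ᵐ[P] V k) {S : Submodule ℝ (Lp ℝ 2 P)}
    (hS : ∀ f ∈ S, ∫ ω, Complex.exp (f ω * Complex.I) ∂P = Complex.exp (-(‖f‖ ^ 2 : ℝ) / 2))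
    (hV : ∀ k, V k ∈ S) (a : EuclideanSpace ℝ (Fin m)) :
    charFun (P.map fun ω => (WithLp.toLp 2 (X ω) : EuclideanSpace ℝ (Fin m))) a =
      Complex.exp (-((∑ k, ∑ k', a k * (a k' * inner ℝ (V k) (V k')) : ℝ) : ℂ) / 2) := by
  have hm : AEMeasurable (fun ω => (WithLp.toLp 2 (X ω) : EuclideanSpace ℝ (Fin m))) P :=
    (WithLp.measurable_toLp 2 _).comp_aemeasurable hX
  have h1 := hS (∑ k, a k • V k) (S.sum_mem fun k _ => S.smul_mem _ (hV k))
  have h2 : ‖∑ k, a k • V k‖ ^ 2 = ∑ k, ∑ k', a k * (a k' * inner ℝ (V k) (V k')) := by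
    rw [← real_inner_self_eq_norm_sq, sum_inner]
    refine Finset.sum_congr rfl fun k _ => ?_
    rw [inner_sum]
    refine Finset.sum_congr rfl fun k' _ => ?_
    rw [real_inner_smul_left, real_inner_smul_right]
  rw [← h2, ← h1, charFun_apply,
    integral_map hm (Continuous.aestronglyMeasurable (by fun_prop))]
  refine integral_congr_ae ?_
  filter_upwards [coeFn_sum_smul Finset.univ (fun k => a k) V, ae_all_iff.2 hXV] with ω h3 h4
  rw [h3]
  congr 3
  simp only [PiLp.inner_apply, RCLike.inner_apply, conj_trivial]
  exact Finset.sum_congr rfl fun k _ => by rw [← h4 k]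

end Gaussian

/-- Convergence of the finite-dimensional distributions of Gaussian vectors follows from convergence
of their covariances. -/
theorem tendstoInDistribution_of_inner {Ω Ω' ι : Type*} [MeasurableSpace Ω] [MeasurableSpace Ω']
    {P : Measure Ω} [IsProbabilityMeasure P] {P' : Measure Ω'} [IsProbabilityMeasure P']
    {l : Filter ι} [l.IsCountablyGenerated] {m : ℕ} {X : ι → Ω → Fin m → ℝ} {Z : Ω' → Fin m → ℝ}
    {V : ι → Fin m → Lp ℝ 2 P} {Y : Fin m → Lp ℝ 2 P'}
    (hXV : ∀ i k, (fun ω => X i ω k) =ᵐ[P] V i k) (hZY : ∀ k, (fun ω => Z ω k) =ᵐ[P'] Y k)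
    {S : Submodule ℝ (Lp ℝ 2 P)} {S' : Submodule ℝ (Lp ℝ 2 P')}
    (hS : ∀ f ∈ S, ∫ ω, Complex.exp (f ω * Complex.I) ∂P = Complex.exp (-(‖f‖ ^ 2 : ℝ) / 2))
    (hS' : ∀ f ∈ S', ∫ ω, Complex.exp (f ω * Complex.I) ∂P' = Complex.exp (-(‖f‖ ^ 2 : ℝ) / 2))
    (hV : ∀ i k, V i k ∈ S) (hY : ∀ k, Y k ∈ S')
    (hlim : ∀ k k', Tendsto (fun i => inner ℝ (V i k) (V i k')) l (𝓝 (inner ℝ (Y k) (Y k')))) :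
    TendstoInDistribution X l Z (fun _ => P) P' := by
  have hX : ∀ i, AEMeasurable (X i) P := fun i => aemeasurable_pi_lambda _ fun k =>
    (Lp.aestronglyMeasurable (V i k)).aemeasurable.congr (hXV i k).symm
  have hZ : AEMeasurable Z P' := aemeasurable_pi_lambda _ fun k =>
    (Lp.aestronglyMeasurable (Y k)).aemeasurable.congr (hZY k).symm
  -- Characteristic functions are taken on an inner product space, so the vectors are moved to
  -- `EuclideanSpace` and brought back at the end by a continuous map. Lévy's theorem is applied
  -- along sequences, which suffices for a countably generated filter.
  have hE : TendstoInDistribution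
      (fun i ω => (WithLp.toLp 2 (X i ω) : EuclideanSpace ℝ (Fin m))) l
      (fun ω => (WithLp.toLp 2 (Z ω) : EuclideanSpace ℝ (Fin m))) (fun _ => P) P' := by
    refine ⟨fun i => (WithLp.measurable_toLp 2 _).comp_aemeasurable (hX i),
      (WithLp.measurable_toLp 2 _).comp_aemeasurable hZ, ?_⟩
    refine tendsto_of_seq_tendsto fun x hx => ?_
    refine ProbabilityMeasure.tendsto_iff_tendsto_charFun.2 fun a => ?_
    simp only [ProbabilityMeasure.coe_mk]
    rw [charFun_map_toLp hZ hZY hS' hY]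
    refine Tendsto.congr
      (fun n => (charFun_map_toLp (hX (x n)) (hXV (x n)) hS (hV (x n)) a).symm) ?_
    refine (Complex.continuous_exp.tendsto _).comp (Tendsto.div_const (Tendsto.neg ?_) _)
    refine (Complex.continuous_ofReal.tendsto _).comp ?_
    exact tendsto_finsetSum _ fun k _ => tendsto_finsetSum _ fun k' _ =>
      (((hlim k k').comp hx).const_mul _).const_mul _
  exact hE.continuous_comp (g := WithLp.ofLp) (PiLp.continuous_ofLp 2 _)

/-! ### Wiener integrals -/

section WhiteNoise

variable {Ω : Type*} [MeasurableSpace Ω] {P : Measure Ω}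

namespace SymmWhiteNoise

lemma integral_eq (W : SymmWhiteNoise P) {g : ℝ → ℂ} (hg : MemLp g 2 volume) :
    W.integral g = W.toIsometry (hg.toLp g) := by
  funext ω
  rw [SymmWhiteNoise.integral, dif_pos hg]

/-- The Wiener integral of a function with `g(-l) = conj g(l)` is real. -/
lemma integral_im_eq_zero (W : SymmWhiteNoise P) {g : ℝ → ℂ} (hg : MemLp g 2 volume)
    (hsymm : ∀ l, g l = star (g (-l))) : ∀ᵐ ω ∂P, (W.integral g ω).im = 0 := by
  have h1 : W.toIsometry (hg.toLp g) = star (W.toIsometry (hg.toLp g)) := by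
    refine W.symm _ _ ?_
    have h2 : ∀ᵐ l : ℝ, hg.toLp g (-l) = g (-l) :=
      (Measure.measurePreserving_neg (volume : Measure ℝ)).quasiMeasurePreserving.ae
        hg.coeFn_toLp
    filter_upwards [hg.coeFn_toLp, h2] with l h3 h4
    rw [h3, h4, ← hsymm l]
  rw [W.integral_eq hg]
  have h5 := Lp.coeFn_star (W.toIsometry (hg.toLp g))
  rw [← h1] at h5
  filter_upwards [h5] with ω hω
  exact Complex.conj_eq_iff_im.1 hω.symm

lemma memLp_integral (W : SymmWhiteNoise P) {g : ℝ → ℂ} (hg : MemLp g 2 volume) :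
    MemLp (W.integral g) 2 P := by
  rw [W.integral_eq hg]
  exact Lp.memLp _

lemma integral_re_integral [IsProbabilityMeasure P] (W : SymmWhiteNoise P) {g : ℝ → ℂ}
    (hg : MemLp g 2 volume) : ∫ ω, (W.integral g ω).re ∂P = 0 := by
  have h1 := Complex.reCLM.integral_comp_comm ((W.memLp_integral hg).integrable (by norm_num))
  simp only [Complex.reCLM_apply] at h1
  rw [h1, W.integral_eq hg, W.centred, Complex.zero_re]

/-- Hermitian symmetry makes both Wiener integrals real almost surely, so the product of real parts
is the full `L²` inner product and the isometry applies. -/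
lemma integral_re_mul_re (W : SymmWhiteNoise P) {g h : ℝ → ℂ} (hg : MemLp g 2 volume)
    (hh : MemLp h 2 volume) (hgs : ∀ l, g l = star (g (-l))) (hhs : ∀ l, h l = star (h (-l))) :
    ∫ ω, (W.integral g ω).re * (W.integral h ω).re ∂P = ∫ l, (star (g l) * h l).re := by
  have h1 := W.toIsometry.inner_map_map (hg.toLp g) (hh.toLp h)
  have h2 := congrArg Complex.re h1
  rw [L2.inner_def, L2.inner_def] at h2
  have h3 := Complex.reCLM.integral_comp_comm
    (L2.integrable_inner (𝕜 := ℂ) (W.toIsometry (hg.toLp g)) (W.toIsometry (hh.toLp h)))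
  have h4 := Complex.reCLM.integral_comp_comm
    (L2.integrable_inner (𝕜 := ℂ) (hg.toLp g) (hh.toLp h))
  simp only [Complex.reCLM_apply] at h3 h4
  rw [← h3, ← h4] at h2
  refine (integral_congr_ae ?_).trans (h2.trans (integral_congr_ae ?_))
  · filter_upwards [W.integral_im_eq_zero hg hgs, W.integral_im_eq_zero hh hhs] with ω h5 h6
    rw [← W.integral_eq hg, ← W.integral_eq hh, RCLike.inner_apply, Complex.mul_re,
      Complex.conj_re, Complex.conj_im, h5, h6]
    ring
  · filter_upwards [hg.coeFn_toLp, hh.coeFn_toLp] with l h5 h6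
    rw [h5, h6, RCLike.inner_apply, mul_comm]
    rfl

end SymmWhiteNoise

lemma star_limitKernel (α β μ t x l : ℝ) :
    star (limitKernel α β μ t x l) = Complex.exp (Complex.I * (-l : ℝ) * x) *
      (mittagLeffler β (-μ * t ^ β * |l| ^ α) : ℂ) := by
  rw [limitKernel, star_mul', Complex.star_def, Complex.conj_ofReal,
    ← Complex.exp_conj]
  simp only [map_mul, Complex.conj_I, Complex.conj_ofReal]
  congr 2
  push_cast
  ring

lemma limitKernel_symm (α β μ t x l : ℝ) :
    limitKernel α β μ t x l = star (limitKernel α β μ t x (-l)) := by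
  rw [star_limitKernel, limitKernel, neg_neg, abs_neg]

lemma re_star_limitKernel_mul (α β μ t t' x x' l : ℝ) :
    (star (limitKernel α β μ t x l) * limitKernel α β μ t' x' l).re =
      Real.cos (l * (x - x')) * mittagLeffler β (-μ * t ^ β * |l| ^ α) *
        mittagLeffler β (-μ * t' ^ β * |l| ^ α) := by
  have h1 : star (limitKernel α β μ t x l) * limitKernel α β μ t' x' l =
      Complex.exp (((-(l * (x - x')) : ℝ) : ℂ) * Complex.I) *
        ((mittagLeffler β (-μ * t ^ β * |l| ^ α) *
          mittagLeffler β (-μ * t' ^ β * |l| ^ α) : ℝ) : ℂ) := by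
    have h2 : Complex.exp (((-(l * (x - x')) : ℝ) : ℂ) * Complex.I) =
        Complex.exp (Complex.I * (-l : ℝ) * x) * Complex.exp (Complex.I * l * x') := by
      rw [← Complex.exp_add]
      congr 1
      push_cast
      ring
    rw [star_limitKernel, limitKernel, h2]
    push_cast
    ring
  rw [h1, Complex.re_mul_ofReal, Complex.exp_ofReal_mul_I_re, Real.cos_neg]
  ring

end WhiteNoise

end FRBE

/-! ### Proof of the scaling limit theorem -/

theorem mainTheorem1
    {Ω Ω' : Type*} [MeasurableSpace Ω] [MeasurableSpace Ω']
    (P : Measure Ω) [IsProbabilityMeasure P] (P' : Measure Ω') [IsProbabilityMeasure P']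
    (α β γ μ : ℝ) (hα : 1 / 2 < α) (hβ : β ∈ Set.Ioc (0 : ℝ) 1) (hγ : 0 < γ) (hμ : 0 < μ)
    (n : ℕ) (A w κ : ℕ → ℝ) (hparams : FRBE.CyclicParams n A w κ) (hA₀ : A 0 = 0)
    (ξ : ℝ → Ω → ℝ) (hξ_meas : Measurable (Function.uncurry ξ))
    (hξ_gauss : IsGaussianProcess ξ P) (hξ_mean : ∀ x, ∫ ω, ξ x ω ∂P = 0)
    (hξ_cov : ∀ x y, covariance (ξ x) (ξ y) P = FRBE.initialCov n A w κ (x - y))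
    (u : ℝ → ℝ → Ω → ℝ) (hu : FRBE.IsMeanSquareSolution P α β γ μ ξ u)
    (W : FRBE.SymmWhiteNoise P') :
    -- the constant under the square root is non-negative and the integrands are square-integrable
    0 ≤ FRBE.specDensZero n A w κ ∧
    (∀ t, 0 < t → ∀ x, MemLp (FRBE.limitKernel α β μ t x) 2 volume) ∧
    ∃ U₀ : ℝ → ℝ → Ω' → ℝ,
      -- `U₀` is the real-valued field given by the Wiener integral
      (∀ t, 0 < t → ∀ x, ∀ᵐ ω ∂P',
        (U₀ t x ω : ℂ) = FRBE.limitField W n A w κ α β μ t x ω) ∧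
      -- it is a zero-mean Gaussian field
      IsGaussianProcess (fun p : Set.Ioi (0 : ℝ) × ℝ => U₀ p.1 p.2) P' ∧
      (∀ t, 0 < t → ∀ x, ∫ ω, U₀ t x ω ∂P' = 0) ∧
      -- with the stated covariance function
      (∀ t t', 0 < t → 0 < t' → ∀ x x',
        IntegrableOn (fun l : ℝ => Real.cos (l * (x - x')) *
          FRBE.mittagLeffler β (-μ * t ^ β * |l| ^ α) *
          FRBE.mittagLeffler β (-μ * t' ^ β * |l| ^ α)) (Set.Ioi 0) ∧
        covariance (U₀ t x) (U₀ t' x') P' =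
          (∑ j ∈ Finset.Icc 1 n, 2 * FRBE.c₁ (κ j) * A j *
            FRBE.besselK ((κ j - 1) / 2) |w j| * |w j| ^ ((κ j - 1) / 2)) *
          ∫ l in Set.Ioi (0 : ℝ), Real.cos (l * (x - x')) *
            FRBE.mittagLeffler β (-μ * t ^ β * |l| ^ α) *
            FRBE.mittagLeffler β (-μ * t' ^ β * |l| ^ α)) ∧
      -- the finite-dimensional distributions of `U_ε` converge weakly to those of `U₀` as `ε ↓ 0`
      ∀ (m : ℕ) (t x : Fin m → ℝ), (∀ i, 0 < t i) →
        TendstoInDistribution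
          (fun (ε : Set.Ioi (0 : ℝ)) (ω : Ω) (i : Fin m) =>
            FRBE.rescaled α β u ε (t i) (x i) ω)
          (comap (fun ε : Set.Ioi (0 : ℝ) => (ε : ℝ)) (𝓝 0))
          (fun ω i => U₀ (t i) (x i) ω) (fun _ => P) P' := by
  have hα0 : 0 < α := by linarith
  obtain ⟨v, huv, hvc, hvb, hu0, hve⟩ := hu
  have hv : FRBE.IsHilbertSolution α β γ μ v := ⟨hvc, hvb, hve⟩
  have hξv : ∀ x, ξ x =ᵐ[P] v 0 x := fun x => (hu0 x).symm.trans (huv 0 le_rfl x)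
  have hξ2 : ∀ x, MemLp (ξ x) 2 P := fun x => (hξ_gauss.hasGaussianLaw_eval x).memLp_two
  have hr : ∀ x y, inner ℝ (v 0 x) (v 0 y) = FRBE.initialCov n A w κ (x - y) := fun x y => by
    rw [FRBE.real_inner_Lp_eq_integral (hξv x) (hξv y), ← hξ_cov x y,
      covariance_eq_sub (hξ2 x) (hξ2 y), hξ_mean x, zero_mul, sub_zero]
    rfl
  have hlim : ∀ {t t' : ℝ}, 0 < t → 0 < t' → ∀ x x', Tendsto
      (fun ε : ℝ => inner ℝ (ε ^ (-(β / (2 * α))) • v (t / ε) (x / ε ^ (β / α)))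
        (ε ^ (-(β / (2 * α))) • v (t' / ε) (x' / ε ^ (β / α)))) (𝓝[>] 0)
      (𝓝 (FRBE.specDensZero n A w κ * ∫ l : ℝ, Real.cos (l * (x - x')) *
        FRBE.mittagLeffler β (-μ * t ^ β * |l| ^ α) *
          FRBE.mittagLeffler β (-μ * t' ^ β * |l| ^ α))) := fun {t t'} ht ht' x x' => by
    have h := hv.tendsto_inner_rescaled hα hβ hγ.le hμ hr (FRBE.integrable_specDens hparams)
      (FRBE.continuousAt_specDens hparams) (FRBE.fourier_specDens hparams hA₀) ht ht' x x'
    rwa [FRBE.specDens_zero hparams, mul_div_cancel_left₀ _ (by positivity)] at h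
  -- A limit of squared norms at `t = 1`, `x = 0` equals the constant times a strictly positive
  -- integral.
  have hf0 : 0 ≤ FRBE.specDensZero n A w κ := by
    have h1 : 0 ≤ FRBE.specDensZero n A w κ * ∫ l : ℝ, Real.cos (l * (0 - 0)) *
        FRBE.mittagLeffler β (-μ * 1 ^ β * |l| ^ α) *
          FRBE.mittagLeffler β (-μ * 1 ^ β * |l| ^ α) :=
      ge_of_tendsto' (hlim one_pos one_pos 0 0) fun ε => real_inner_self_nonneg
    simp only [sub_zero, mul_zero, Real.cos_zero, one_mul] at h1
    exact nonneg_of_mul_nonneg_left h1 (FRBE.integral_kernel_sq_pos hα hβ hμ one_pos)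
  have hmem : ∀ t, 0 < t → ∀ x, MemLp (FRBE.limitKernel α β μ t x) 2 volume :=
    fun t ht x => FRBE.memLp_limitKernel hα hβ hμ ht x
  have hsymm := FRBE.limitKernel_symm α β μ
  -- Taking real parts makes the field real everywhere; for `t > 0` the discarded imaginary part
  -- vanishes almost surely because the kernel is Hermitian.
  let U₀ : ℝ → ℝ → Ω' → ℝ := fun t x ω => (FRBE.limitField W n A w κ α β μ t x ω).re
  have hU : ∀ t x ω, U₀ t x ω = √(FRBE.specDensZero n A w κ) *
      (W.integral (FRBE.limitKernel α β μ t x) ω).re := fun t x ω => by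
    simp only [U₀, FRBE.limitField, Complex.re_ofReal_mul]
  have hgauss : IsGaussianProcess (fun p : Set.Ioi (0 : ℝ) × ℝ => U₀ p.1 p.2) P' := by
    have h1 := W.gaussian.comp_right fun p : Set.Ioi (0 : ℝ) × ℝ =>
      (hmem p.1 p.1.2 p.2).toLp (FRBE.limitKernel α β μ p.1 p.2)
    refine (h1.smul fun _ => √(FRBE.specDensZero n A w κ)).congr fun p => .of_forall fun ω => ?_
    simp only [hU, W.integral_eq (hmem p.1 p.1.2 p.2), smul_eq_mul, Function.comp_apply]
  have hmean : ∀ t, 0 < t → ∀ x, ∫ ω, U₀ t x ω ∂P' = 0 := fun t ht x => by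
    simp only [hU]
    rw [integral_const_mul, W.integral_re_integral (hmem t ht x), mul_zero]
  have hU2 : ∀ t, 0 < t → ∀ x, MemLp (U₀ t x) 2 P' := fun t ht x =>
    (hgauss.hasGaussianLaw_eval (⟨t, ht⟩, x)).memLp_two
  have hprod : ∀ t t', 0 < t → 0 < t' → ∀ x x', ∫ ω, U₀ t x ω * U₀ t' x' ω ∂P' =
      FRBE.specDensZero n A w κ * ∫ l : ℝ, Real.cos (l * (x - x')) *
        FRBE.mittagLeffler β (-μ * t ^ β * |l| ^ α) *
          FRBE.mittagLeffler β (-μ * t' ^ β * |l| ^ α) := fun t t' ht ht' x x' => by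
    simp only [hU, mul_mul_mul_comm, Real.mul_self_sqrt hf0]
    rw [integral_const_mul, W.integral_re_mul_re (hmem t ht x) (hmem t' ht' x') (hsymm t x)
      (hsymm t' x')]
    simp only [FRBE.re_star_limitKernel_mul]
  refine ⟨hf0, hmem, U₀, fun t ht x => ?_, hgauss, hmean, fun t t' ht ht' x x' => ⟨?_, ?_⟩,
    fun m t x ht => ?_⟩
  · filter_upwards [W.integral_im_eq_zero (hmem t ht x) (hsymm t x)] with ω hω
    refine Complex.ext (by rw [Complex.ofReal_re]) ?_
    rw [Complex.ofReal_im, FRBE.limitField, Complex.im_ofReal_mul, hω, mul_zero]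
  · exact (FRBE.integrable_cos_mul_kernel hα hβ hμ ht ht' (x - x')).integrableOn
  · rw [covariance_eq_sub (hU2 t ht x) (hU2 t' ht' x'), hmean t ht x, zero_mul, sub_zero]
    have h2 : ∑ j ∈ Finset.Icc 1 n, 2 * FRBE.c₁ (κ j) * A j *
        FRBE.besselK ((κ j - 1) / 2) |w j| * |w j| ^ ((κ j - 1) / 2) =
        2 * FRBE.specDensZero n A w κ := by
      rw [FRBE.specDensZero, Finset.mul_sum]
      exact Finset.sum_congr rfl fun j _ => by ring
    rw [h2]
    refine (hprod t t' ht ht' x x').trans ?_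
    rw [FRBE.integral_cos_mul_kernel]
    ring
  · let Y : Set.Ioi (0 : ℝ) × ℝ → Lp ℝ 2 P' := fun p => (hU2 p.1 p.1.2 p.2).toLp (U₀ p.1 p.2)
    have hUY : ∀ p : Set.Ioi (0 : ℝ) × ℝ, U₀ p.1 p.2 =ᵐ[P'] Y p := fun p =>
      (MemLp.coeFn_toLp _).symm
    -- The closed span of the initial values is the Gaussian space in which all rescaled values lie;
    -- the span of the limit field plays the same role on `Ω'`.
    have h0 : ∀ x, v 0 x ∈ (Submodule.span ℝ (Set.range (v 0))).topologicalClosure := fun x =>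
      Submodule.le_topologicalClosure _ (Submodule.subset_span ⟨x, rfl⟩)
    refine FRBE.tendstoInDistribution_of_inner
      (V := fun ε i => (ε : ℝ) ^ (-(β / (2 * α))) • v (t i / ε) (x i / (ε : ℝ) ^ (β / α)))
      (Y := fun i => Y (⟨t i, ht i⟩, x i)) (fun ε i => ?_) (fun i => hUY (⟨t i, ht i⟩, x i))
      (fun f hf => FRBE.integral_exp_of_mem_closure_span hξ_gauss hξ_mean hξv hf)
      (fun f hf => FRBE.integral_exp_of_mem_closure_span hgauss (fun p => hmean p.1 p.1.2 p.2)
        hUY hf)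
      (fun ε i => Submodule.smul_mem _ _ (hv.mem_of_initial hα hβ
        (Submodule.isClosed_topologicalClosure _) h0 (div_pos (ht i) ε.2) _))
      (fun i => Submodule.le_topologicalClosure _ (Submodule.subset_span ⟨_, rfl⟩))
      (fun i j => ?_)
    · have hε : (0 : ℝ) < ε := ε.2
      filter_upwards [huv (t i / ε) (div_pos (ht i) hε).le (x i / (ε : ℝ) ^ (β / α)),
        Lp.coeFn_smul ((ε : ℝ) ^ (-(β / (2 * α)))) (v (t i / ε) (x i / (ε : ℝ) ^ (β / α)))]
        with ω h1 h2
      rw [h2, Pi.smul_apply, ← h1, smul_eq_mul, FRBE.rescaled]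
    · rw [FRBE.real_inner_Lp_eq_integral (hUY (⟨t i, ht i⟩, x i)) (hUY (⟨t j, ht j⟩, x j)),
        hprod _ _ (ht i) (ht j)]
      refine (hlim (ht i) (ht j) (x i) (x j)).comp (g := fun ε : ℝ => _) ?_
      -- The filter `comap` on the subtype of positive reals maps into `𝓝[>] 0`, where the
      -- covariance limit was established.
      refine tendsto_nhdsWithin_of_tendsto_nhds_of_eventually_within _ tendsto_comap
        (.of_forall fun ε => ε.2)
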